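/- For a real homogeneous polynomial $h$ of degree $4$ in two variables, a point $p\in\mathbb{R}^2$ is a hyperbolic point of $h$ if $-\partial^2 h_p$ has Lorentzian signature $(1,1)$; put $S_h=\{h=1\}\cap\{\text{hyperbolic points of }h\}$. A quartic GPSR curve with defining polynomial $h$ is a smooth embedded curve $\mathcal H\subset\mathbb{R}^2$ with $\mathcal H\subset S_h$. A quartic CCGPSR curve is one that is non-empty, connected and closed in $\mathbb{R}^2$. Two such curves are equivalent if $A(\mathcal H)=\mathcal H'$ for some $A\in\mathrm{GL}(2)$. The linear automorphism group is $G^h=\{A\in\mathrm{GL}(2): h\circ A=h\}$. A curve $\mathcal H$ is a homogeneous space if the group $\{A\in\mathrm{GL}(2):A(\mathcal H)=\mathcal H\}$ acts transitively on $\mathcal H$. It is singular at infinity if there is a point $p\neq0$ in the boundary of the cone $\mathbb{R}_{>0}\cdot\mathcal H$ with $h(p)=0$ and $dh_p=0$. For $(L,K)\in\mathbb{R}^2$ let $h_{L,K}=x^4-x^2y^2+Lxy^3+Ky^4$ and let $\mathcal H_{L,K}$ be the connected component of $S_{h_{L,K}}$ containing $(1,0)$. **Theorem.** The curves $\mathcal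 H_{L,K}$ with $(L,K)$ in the list a) $(0,\tfrac14)$; b) $\left(\tfrac{2\sqrt2}{3\sqrt3},-\tfrac1{12}\right)$; c) $\left(\tfrac{2}{3\sqrt3},0\right)$; d) $(0,K)$ with $K<\tfrac14$ are quartic CCGPSR curves, and every quartic CCGPSR curve is equivalent to $\mathcal H_{L,K}$ for exactly one $(L,K)$ in the list (in case d), for exactly one $K<\tfrac14$). Write $h=h_{L,K}$, $D_4$ for the dihedral group of order $8$, and $\sigma(x,y)=(x,-y)$. Then: a) $S_h$ has exactly $4$ connected components, which are closed in $\mathbb{R}^2$ and pairwise equivalent. $G^h\cong\mathbb{R}\rtimes D_4$, where $t\in\mathbb{R}$ acts by the hyperbolic rotation $\begin{pmatrix}\cosh t&\tfrac{1}{\sqrt2}\sinh t\\ \sqrt2\sinh t&\cosh t\end{pmatrix}$ of $dx^2-\tfrac12dy^2$, and $D_4$ is generated by the reflection $\sigma$ and the element $(x,y)\mapsto(-\tfrac1{\sqrt2}y,\sqrt2x)$ of order $4$. $\mathcal H_{L,K}$ is homogeneous and singular at infinity. b) $S_h$ has exactly $2$ connected components, which are closed in $\mathbb{R}^2$ and equivalent.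 $G^h\cong\mathbb{R}\times\mathbb{Z}_2$, where $\mathbb{Z}_2$ acts by $-\mathbb{1}$ and $t\in\mathbb{R}$ acts, preserving $\mathcal H_{L,K}$, by $$\begin{pmatrix}\tfrac14&\tfrac34\\ \tfrac{\sqrt3}{2\sqrt2}&-\tfrac{\sqrt3}{2\sqrt2}\end{pmatrix}\begin{pmatrix}e^{\sqrt3t}&0\\0&e^{-t/\sqrt3}\end{pmatrix}\begin{pmatrix}1&\tfrac{\sqrt3}{\sqrt2}\\1&-\tfrac1{\sqrt6}\end{pmatrix}.$$ $\mathcal H_{L,K}$ is homogeneous and singular at infinity. c) $S_h$ has exactly $4$ connected components, which are closed in $\mathbb{R}^2$ and pairwise equivalent. $G^h\cong\mathbb{Z}_2\times\mathbb{Z}_2$. $\mathcal H_{L,K}$ is not homogeneous and is singular at infinity. d) If $0<K<\tfrac14$, then $S_h$ has exactly $4$ connected components, which are closed in $\mathbb{R}^2$ and pairwise equivalent, and $G^h\cong D_4$, generated by the reflection $\sigma$ and the element $(x,y)\mapsto(-\sqrt[4]{K}\,y,\sqrt[4]{K}^{\,-1}x)$ of order $4$. If $K\le0$, then $S_h$ has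 exactly $2$ connected components, which are closed in $\mathbb{R}^2$ and equivalent, and $G^h\cong\mathbb{Z}_2\times\mathbb{Z}_2$, where the first factor acts by $\sigma$ and the second by $(x,y)\mapsto(-x,y)$. For every $K<\tfrac14$ the curve $\mathcal H_{0,K}$ is neither homogeneous nor singular at infinity. -/

import Mathlib

open scoped ContDiff

namespace QuarticGPSR

/-- The ambient plane, with its standard topology and smooth structure. -/
abbrev Plane := Fin 2 → ℝ

/-- The linear action of `GL(2)` on subsets of the plane. -/
def act (A : GL (Fin 2) ℝ) (S : Set Plane) : Set Plane :=
  (fun p => (A : Matrix (Fin 2) (Fin 2) ℝ).mulVec p) '' S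

/-- The Hessian matrix of the polynomial `h` at the point `p`. -/
noncomputable def hessian (h : MvPolynomial (Fin 2) ℝ) (p : Plane) :
    Matrix (Fin 2) (Fin 2) ℝ :=
  Matrix.of fun i j => MvPolynomial.eval p (MvPolynomial.pderiv i (MvPolynomial.pderiv j h))

/-- The bilinear form with matrix `M` has Lorentzian signature: in some basis of the plane it is
`diag(-1, 1)`. -/
def IsLorentzian (M : Matrix (Fin 2) (Fin 2) ℝ) : Prop :=
  ∃ P : GL (Fin 2) ℝ,
    (P : Matrix (Fin 2) (Fin 2) ℝ).transpose * M * (P : Matrix (Fin 2) (Fin 2) ℝ) =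
      Matrix.diagonal ![-1, 1]

/-- `p` is a hyperbolic point of `h`: minus the Hessian of `h` at `p` is Lorentzian. -/
def IsHyperbolicPoint (h : MvPolynomial (Fin 2) ℝ) (p : Plane) : Prop :=
  IsLorentzian (-hessian h p)

/-- A smooth embedded curve (a hypersurface of the plane): locally the zero set of a smooth
function with nowhere vanishing differential. -/
def IsSmoothCurve (S : Set Plane) : Prop :=
  ∀ p ∈ S, ∃ U : Set Plane, IsOpen U ∧ p ∈ U ∧ ∃ F : Plane → ℝ,
    ContDiffOn ℝ ∞ F U ∧ (∀ q ∈ U, fderiv ℝ F q ≠ 0) ∧ S ∩ U = {q ∈ U | F q = 0}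

/-- `H` is a quartic generalised projective special real curve with defining polynomial `h`:
a smooth curve in the level set `h = 1` of the homogeneous quartic `h`, all of whose points are
hyperbolic points of `h`. -/
structure IsQuarticGPSRCurve (h : MvPolynomial (Fin 2) ℝ) (H : Set Plane) : Prop where
  homogeneous : h.IsHomogeneous 4
  smooth : IsSmoothCurve H
  level : ∀ p ∈ H, MvPolynomial.eval p h = 1
  hyperbolic : ∀ p ∈ H, IsHyperbolicPoint h p

/-- `H` is a closed connected (in particular non-empty) quartic GPSR curve with defining
polynomial `h`. -/
structure IsQuarticCCGPSRCurve (h : MvPolynomial (Fin 2) ℝ) (H : Set Plane) : Prop where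
  gpsr : IsQuarticGPSRCurve h H
  closed : IsClosed H
  connected : IsConnected H

/-- Equivalence of GPSR curves under `GL(2)`. -/
def Equivalent (H H' : Set Plane) : Prop :=
  ∃ A : GL (Fin 2) ℝ, act A H = H'

/-- The set `{h = 1} ∩ {hyperbolic points of h}`. -/
def hyperbolicLevelSet (h : MvPolynomial (Fin 2) ℝ) : Set Plane :=
  {p | MvPolynomial.eval p h = 1 ∧ IsHyperbolicPoint h p}

/-- The set of connected components of a subset of the plane. -/
def components (S : Set Plane) : Set (Set Plane) :=
  {C | ∃ p ∈ S, C = connectedComponentIn S p}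

/-- `{h = 1} ∩ {hyperbolic points of h}` has exactly `n` connected components, all of them closed
in the plane, and any two of them are equivalent. -/
def HasEquivalentClosedComponents (h : MvPolynomial (Fin 2) ℝ) (n : ℕ) : Prop :=
  (components (hyperbolicLevelSet h)).encard = n ∧
  (∀ C ∈ components (hyperbolicLevelSet h), IsClosed C) ∧
  ∀ C ∈ components (hyperbolicLevelSet h), ∀ C' ∈ components (hyperbolicLevelSet h),
    Equivalent C C'

/-- The polynomial `x⁴ - x² y² + L x y³ + K y⁴`, with `x = X 0` and `y = X 1`. -/
noncomputable def stdPoly (L K : ℝ) : MvPolynomial (Fin 2) ℝ :=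
  MvPolynomial.X 0 ^ 4 - MvPolynomial.X 0 ^ 2 * MvPolynomial.X 1 ^ 2
    + MvPolynomial.C L * MvPolynomial.X 0 * MvPolynomial.X 1 ^ 3
    + MvPolynomial.C K * MvPolynomial.X 1 ^ 4

/-- The maximal connected quartic GPSR curve in standard form with polynomial `stdPoly L K`: the
connected component of `(1, 0)` in the hyperbolic part of the level set. -/
noncomputable def stdCurve (L K : ℝ) : Set Plane :=
  connectedComponentIn (hyperbolicLevelSet (stdPoly L K)) ![1, 0]

/-- The linear automorphism group `G^h` of `h`. -/
noncomputable def autGroup (h : MvPolynomial (Fin 2) ℝ) : Subgroup (GL (Fin 2) ℝ) where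
  carrier := {A | ∀ p : Plane,
    MvPolynomial.eval ((A : Matrix (Fin 2) (Fin 2) ℝ).mulVec p) h = MvPolynomial.eval p h}
  one_mem' := by
    intro p
    simp
  mul_mem' := by
    intro A B hA hB p
    have h1 := hA ((B : Matrix (Fin 2) (Fin 2) ℝ).mulVec p)
    rw [Matrix.mulVec_mulVec] at h1
    rw [Units.val_mul, h1, hB p]
  inv_mem' := by
    intro A hA p
    have h1 := hA (((A⁻¹ : GL (Fin 2) ℝ) : Matrix (Fin 2) (Fin 2) ℝ).mulVec p)
    rw [Matrix.mulVec_mulVec, ← Units.val_mul, mul_inv_cancel, Units.val_one,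
      Matrix.one_mulVec] at h1
    exact h1.symm

/-- `H` is a homogeneous space: the group of linear transformations of the plane that map `H`
onto itself acts transitively on `H`. -/
def IsHomogeneousCurve (H : Set Plane) : Prop :=
  ∀ p ∈ H, ∀ q ∈ H, ∃ A : GL (Fin 2) ℝ,
    act A H = H ∧ (A : Matrix (Fin 2) (Fin 2) ℝ).mulVec p = q

/-- The cone `ℝ_{>0} · H`. -/
def cone (H : Set Plane) : Set Plane :=
  {q | ∃ r : ℝ, 0 < r ∧ ∃ p ∈ H, q = r • p}

/-- The curve `H ⊆ {h = 1}` is singular at infinity: `h` and its differential vanish at some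
non-zero point of the boundary of the cone over `H`. -/
def IsSingularAtInfinity (h : MvPolynomial (Fin 2) ℝ) (H : Set Plane) : Prop :=
  ∃ p ∈ frontier (cone H), p ≠ 0 ∧ MvPolynomial.eval p h = 0 ∧
    ∀ i, MvPolynomial.eval p (MvPolynomial.pderiv i h) = 0

/-- The parameter `L` of the curve b). -/
noncomputable def Lb : ℝ := 2 * √2 / (3 * √3)

/-- The parameter `L` of the curve c). -/
noncomputable def Lc : ℝ := 2 / (3 * √3)

/-- The parameters `(L, K)` of the curves a), b), c) and of the family d). -/
def classList : Set (ℝ × ℝ) :=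
  {(0, 1 / 4), (Lb, -1 / 12), (Lc, 0)} ∪ {q | q.1 = 0 ∧ q.2 < 1 / 4}

/-- The reflection `y ↦ -y`. -/
def reflY : Matrix (Fin 2) (Fin 2) ℝ := !![1, 0; 0, -1]

/-- The reflection `x ↦ -x`. -/
def reflX : Matrix (Fin 2) (Fin 2) ℝ := !![-1, 0; 0, 1]

/-- The map `(x, y) ↦ (-c y, c⁻¹ x)`. -/
noncomputable def quarterTurn (c : ℝ) : Matrix (Fin 2) (Fin 2) ℝ := !![0, -c; c⁻¹, 0]

/-- The hyperbolic rotation by `t` of the Lorentzian plane with form `dx² - dy² / 2`. -/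
noncomputable def hypRotation (t : ℝ) : Matrix (Fin 2) (Fin 2) ℝ :=
  !![Real.cosh t, Real.sinh t / √2; √2 * Real.sinh t, Real.cosh t]

/-- The one-parameter group `exp (t a)`, where `a` has the rows `(0, 1/√2)` and `(√2, 2/√3)`,
written out in an eigenbasis of `a`. -/
noncomputable def flowB (t : ℝ) : Matrix (Fin 2) (Fin 2) ℝ :=
  !![1 / 4, 3 / 4; √3 / (2 * √2), -(√3 / (2 * √2))] *
    !![Real.exp (√3 * t), 0; 0, Real.exp (-(t / √3))] *
    !![1, √3 / √2; 1, -(1 / √6)]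

end QuarticGPSR

namespace QuarticGPSR

/-! ### Linear substitutions and their effect on derivatives and Hessians. -/

open MvPolynomial

/-! The classification reduces to arcs in the open first quadrant on which `h` has the form `xy (a
x² + b xy + c y²)`, acted on by positive monomial matrices.

Reduction. By Euler's identity `{h = 1}` is itself a smooth curve, so a smooth curve `H` inside it
is open in it (`IsQuarticGPSRCurve.eventually_mem`); a closed connected `H` is then a whole
component of `{h = 1}`. A linear change moves a point of `H` to `(1, 0)` and `h` to some `stdPoly L
K` (`exists_linSubst_eq_stdPoly`). Put `f y = h (1, y)`. Hyperbolicity at `(1, y)` means `12 f f'' <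
9 f'²`, and this cannot hold for all `y ≥ 0` with `f` positive (`not_forall_pos_and_hyperbolic`).
Hence `h` vanishes on a first ray on either side of `(1, 0)`. With these two rays as coordinate axes
`H` becomes `quad a b c` (`IsLevelComponent.exists_equivalent_quad`), and hyperbolicity along it
leaves exactly the `Admissible` triples, up to swapping the axes.

Classification. A linear map between two such arcs maps the cones over them, that is the quadrant,
onto itself, so it is diagonal or antidiagonal with positive entries `l`, `m`
(`monomial_of_act_quad`). It scales `(a, b, c)` by `l³m`, `l²m²`, `lm³`, possibly with a swap. The
orbits are those of `(0, b, 0)`, `(a, 0, 0)`, `(a, b, 0)`, and of the triples with all entries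
positive, for which `ac / b²` is a complete invariant. They correspond to the cases a), b), c), d).

Properties of the curves. For each listed form an explicit factorisation and finitely many explicit
automorphisms `g i` exhibit all of `{h = 1}` as the disjoint union of the images of one arc
(`LevelDecomposition`). This gives the components at once, and every automorphism is some `g i`
times an element of the stabiliser of the arc, which is monomial. Homogeneity is decided by whether
this stabiliser is transitive on the arc or fixes `(1, 0)`, and a singularity at infinity is a
multiple root of `h` on one of the two boundary rays. -/

/-- The polynomial `h ∘ B` for a linear map `B` of the plane. -/
noncomputable def linSubst (B : Matrix (Fin 2) (Fin 2) ℝ) :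
    MvPolynomial (Fin 2) ℝ →ₐ[ℝ] MvPolynomial (Fin 2) ℝ :=
  aeval fun i => ∑ j, C (B i j) * X j

theorem eval_linSubst (B : Matrix (Fin 2) (Fin 2) ℝ) (h : MvPolynomial (Fin 2) ℝ) (p : Plane) :
    eval p (linSubst B h) = eval (B.mulVec p) h := by
  induction h using MvPolynomial.induction_on with
  | C a => simp [linSubst]
  | add f g hf hg => simp [hf, hg]
  | mul_X f i hf =>
    rw [map_mul, map_mul, map_mul, hf]
    congr 1
    simp only [linSubst, aeval_X, map_sum, map_mul, eval_C, eval_X, Matrix.mulVec, dotProduct]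

theorem pderiv_linSubst (B : Matrix (Fin 2) (Fin 2) ℝ) (h : MvPolynomial (Fin 2) ℝ) (i : Fin 2) :
    pderiv i (linSubst B h) = ∑ j, C (B j i) * linSubst B (pderiv j h) := by
  induction h using MvPolynomial.induction_on with
  | C a => simp [linSubst]
  | add f g hf hg => simp only [map_add, hf, hg, mul_add, Finset.sum_add_distrib]
  | mul_X f k hf =>
    have hX : linSubst B (X k) = ∑ j, C (B k j) * X j := by simp [linSubst]
    have hd : pderiv i (linSubst B (X k)) = C (B k i) := by
      rw [hX]; fin_cases i <;> simp [pderiv_X]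
    rw [map_mul, pderiv_mul, hf, hd]
    fin_cases k <;> simp [pderiv_X] <;> ring

theorem linSubst_mul (A B : Matrix (Fin 2) (Fin 2) ℝ) (h : MvPolynomial (Fin 2) ℝ) :
    linSubst (A * B) h = linSubst B (linSubst A h) := by
  apply MvPolynomial.funext
  intro p
  simp only [eval_linSubst, Matrix.mulVec_mulVec]

theorem linSubst_one (h : MvPolynomial (Fin 2) ℝ) : linSubst 1 h = h := by
  apply MvPolynomial.funext
  intro p
  simp [eval_linSubst]

theorem hessian_linSubst (B : Matrix (Fin 2) (Fin 2) ℝ) (h : MvPolynomial (Fin 2) ℝ) (p : Plane) :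
    hessian (linSubst B h) p = B.transpose * hessian h (B.mulVec p) * B := by
  ext i j
  simp only [hessian, Matrix.of_apply, pderiv_linSubst, map_add, pderiv_C_mul, 
    map_mul, eval_C, eval_linSubst, Matrix.mul_apply, Matrix.transpose_apply, Fin.sum_univ_two]
  ring

/-- Congruent matrices have the same signature: a basis `P` adapted to `M` is pulled back to `B⁻¹
P`. -/
theorem IsLorentzian.congr {M : Matrix (Fin 2) (Fin 2) ℝ} (hM : IsLorentzian M)
    (B : GL (Fin 2) ℝ) :
    IsLorentzian ((B : Matrix (Fin 2) (Fin 2) ℝ).transpose * M * B) := by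
  obtain ⟨P, hP⟩ := hM
  refine ⟨B⁻¹ * P, ?_⟩
  rw [← hP]
  have h1 : (B : Matrix (Fin 2) (Fin 2) ℝ) * ((B⁻¹ : GL (Fin 2) ℝ) : Matrix (Fin 2) (Fin 2) ℝ)
      = 1 := by rw [← Units.val_mul, mul_inv_cancel, Units.val_one]
  have h2 : ((B⁻¹ : GL (Fin 2) ℝ) : Matrix (Fin 2) (Fin 2) ℝ).transpose *
      (B : Matrix (Fin 2) (Fin 2) ℝ).transpose = 1 := by
    rw [← Matrix.transpose_mul, h1, Matrix.transpose_one]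
  rw [Units.val_mul, Matrix.transpose_mul]
  generalize ((B⁻¹ : GL (Fin 2) ℝ) : Matrix (Fin 2) (Fin 2) ℝ) = C at *
  calc _ = P.val.transpose * (C.transpose * B.val.transpose) * M * (B.val * C) * P.val := by
        simp only [Matrix.mul_assoc]
    _ = _ := by rw [h1, h2]; simp

theorem isHyperbolicPoint_linSubst (B : GL (Fin 2) ℝ) {h : MvPolynomial (Fin 2) ℝ} {p : Plane}
    (hp : IsHyperbolicPoint h ((B : Matrix (Fin 2) (Fin 2) ℝ).mulVec p)) :
    IsHyperbolicPoint (linSubst (B : Matrix (Fin 2) (Fin 2) ℝ) h) p := by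
  have := hp.congr B
  unfold IsHyperbolicPoint
  rw [hessian_linSubst]
  simpa only [Matrix.mul_neg, Matrix.neg_mul] using this

/-! ### Lorentzian signature in dimension two as negativity of the determinant. -/

theorem IsLorentzian.det_neg {M : Matrix (Fin 2) (Fin 2) ℝ} (hM : IsLorentzian M) : M.det < 0 := by
  obtain ⟨P, hP⟩ := hM
  have h := congrArg Matrix.det hP
  rw [Matrix.det_mul, Matrix.det_mul, Matrix.det_transpose, Matrix.det_diagonal] at h
  simp at h
  nlinarith [mul_self_nonneg P.val.det]

/-- The vectors `u`, `v` are the columns of the basis matrix. Their independence need not be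
assumed, since the congruent matrix `diag(-1, 1)` has non-zero determinant. -/
theorem isLorentzian_of_vectors {a b c : ℝ} (u v : Plane)
    (huu : a * u 0 ^ 2 + 2 * b * u 0 * u 1 + c * u 1 ^ 2 = -1)
    (hvv : a * v 0 ^ 2 + 2 * b * v 0 * v 1 + c * v 1 ^ 2 = 1)
    (huv : a * u 0 * v 0 + b * (u 0 * v 1 + u 1 * v 0) + c * u 1 * v 1 = 0) :
    IsLorentzian !![a, b; b, c] := by
  have key : (!![u 0, v 0; u 1, v 1] : Matrix (Fin 2) (Fin 2) ℝ).transpose * !![a, b; b, c] *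
      !![u 0, v 0; u 1, v 1] = Matrix.diagonal ![-1, 1] := by
    ext i j
    fin_cases i <;> fin_cases j <;>
      simp [Matrix.mul_apply, Fin.sum_univ_two] <;> linarith
  have hdet : (!![u 0, v 0; u 1, v 1] : Matrix (Fin 2) (Fin 2) ℝ).det ≠ 0 := by
    intro h0
    have h := congrArg Matrix.det key
    rw [Matrix.det_mul, h0, mul_zero, Matrix.det_diagonal] at h
    simp at h
  exact ⟨Matrix.GeneralLinearGroup.mkOfDetNeZero _ hdet, key⟩

/-- If `a ≠ 0`, the first basis vector of the plane and its orthogonal `(-b, a)`, whose square is `a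
(ac - b²)`, have squares of opposite sign and only need rescaling. -/
theorem isLorentzian_of_det_neg {a b c : ℝ} (h : a * c - b ^ 2 < 0) :
    IsLorentzian !![a, b; b, c] := by
  rcases lt_trichotomy a 0 with ha | ha | ha
  · have hD : 0 < a * (a * c - b ^ 2) := mul_pos_of_neg_of_neg ha h
    have h1 : √(-a) ≠ 0 := (Real.sqrt_pos.2 (by linarith)).ne'
    have h2 : √(a * (a * c - b ^ 2)) ≠ 0 := (Real.sqrt_pos.2 hD).ne'
    have h1' : √(-a) ^ 2 = -a := Real.sq_sqrt (by linarith)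
    have h2' : √(a * (a * c - b ^ 2)) ^ 2 = a * (a * c - b ^ 2) := Real.sq_sqrt hD.le
    refine isLorentzian_of_vectors ![1 / √(-a), 0]
      ![-b / √(a * (a * c - b ^ 2)), a / √(a * (a * c - b ^ 2))] ?_ ?_ ?_
    · simp
      rw [h1']; field_simp [ha.ne]
    · simp only [Matrix.cons_val_zero, Matrix.cons_val_one]
      generalize √(a * (a * c - b ^ 2)) = s at *
      field_simp
      rw [h2']; ring
    · simp only [Matrix.cons_val_zero, Matrix.cons_val_one]
      generalize √(a * (a * c - b ^ 2)) = s at *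
      generalize √(-a) = s' at *
      field_simp
      ring
  · subst ha
    have hb : b ≠ 0 := by rintro rfl; simp at h
    -- For `a = 0` the vector `(t, 1)` has square `2bt + c`; the two values of `t` make it `-1` and
    -- `1`.
    refine isLorentzian_of_vectors ![(-1 - c) / (2 * b), 1] ![(1 - c) / (2 * b), 1] ?_ ?_ ?_ <;>
    · simp
      field_simp
      ring
  · have hD : 0 < a * (b ^ 2 - a * c) := mul_pos ha (by linarith)
    have h1 : √a ≠ 0 := (Real.sqrt_pos.2 ha).ne'
    have h2 : √(a * (b ^ 2 - a * c)) ≠ 0 := (Real.sqrt_pos.2 hD).ne'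
    have h1' : √a ^ 2 = a := Real.sq_sqrt ha.le
    have h2' : √(a * (b ^ 2 - a * c)) ^ 2 = a * (b ^ 2 - a * c) := Real.sq_sqrt hD.le
    refine isLorentzian_of_vectors ![-b / √(a * (b ^ 2 - a * c)), a / √(a * (b ^ 2 - a * c))]
      ![1 / √a, 0] ?_ ?_ ?_
    · simp only [Matrix.cons_val_zero, Matrix.cons_val_one]
      generalize √(a * (b ^ 2 - a * c)) = s at *
      field_simp
      rw [h2']; ring
    · simp
      rw [h1']; field_simp
    · simp only [Matrix.cons_val_zero, Matrix.cons_val_one]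
      generalize √(a * (b ^ 2 - a * c)) = s at *
      generalize √a = s' at *
      field_simp
      ring

/-! ### Binary quartic forms in coordinates. -/

/-- The general binary quartic form. -/
noncomputable def quartic (a b c d e : ℝ) : MvPolynomial (Fin 2) ℝ :=
  C a * X 0 ^ 4 + C b * X 0 ^ 3 * X 1 + C c * X 0 ^ 2 * X 1 ^ 2 + C d * X 0 * X 1 ^ 3
    + C e * X 1 ^ 4

theorem eval_quartic (a b c d e : ℝ) (p : Plane) :
    eval p (quartic a b c d e) = a * p 0 ^ 4 + b * p 0 ^ 3 * p 1 + c * p 0 ^ 2 * p 1 ^ 2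
      + d * p 0 * p 1 ^ 3 + e * p 1 ^ 4 := by
  simp [quartic]

theorem eval_pderiv_zero_quartic (a b c d e : ℝ) (p : Plane) :
    eval p (pderiv 0 (quartic a b c d e)) = 4 * a * p 0 ^ 3 + 3 * b * p 0 ^ 2 * p 1
      + 2 * c * p 0 * p 1 ^ 2 + d * p 1 ^ 3 := by
  simp [quartic, pderiv_X, Derivation.leibniz]
  ring

theorem eval_pderiv_one_quartic (a b c d e : ℝ) (p : Plane) :
    eval p (pderiv 1 (quartic a b c d e)) = b * p 0 ^ 3 + 2 * c * p 0 ^ 2 * p 1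
      + 3 * d * p 0 * p 1 ^ 2 + 4 * e * p 1 ^ 3 := by
  simp [quartic, pderiv_X, Derivation.leibniz]
  ring

theorem hessian_quartic (a b c d e : ℝ) (p : Plane) :
    hessian (quartic a b c d e) p =
      !![12 * a * p 0 ^ 2 + 6 * b * p 0 * p 1 + 2 * c * p 1 ^ 2,
         3 * b * p 0 ^ 2 + 4 * c * p 0 * p 1 + 3 * d * p 1 ^ 2;
         3 * b * p 0 ^ 2 + 4 * c * p 0 * p 1 + 3 * d * p 1 ^ 2,
         2 * c * p 0 ^ 2 + 6 * d * p 0 * p 1 + 12 * e * p 1 ^ 2] := by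
  -- Differentiating twice leaves derivatives of the numerals produced by the power rule.
  have hnum : ∀ (i : Fin 2) (n : ℕ), pderiv i (n : MvPolynomial (Fin 2) ℝ) = 0 := fun i n =>
    (pderiv i).map_natCast n
  have h2 := fun i => hnum i 2
  have h3 := fun i => hnum i 3
  have h4 := fun i => hnum i 4
  push_cast at h2 h3 h4
  ext i j
  fin_cases i <;> fin_cases j <;>
    simp [hessian, quartic, pderiv_X, Derivation.leibniz, h2, h3, h4] <;> ring

/-- In dimension two, signature `(1, 1)` is negative determinant, and passing from the Hessian to
its negative does not change the determinant. -/
theorem isHyperbolicPoint_quartic (a b c d e : ℝ) (p : Plane) :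
    IsHyperbolicPoint (quartic a b c d e) p ↔
      (12 * a * p 0 ^ 2 + 6 * b * p 0 * p 1 + 2 * c * p 1 ^ 2) *
        (2 * c * p 0 ^ 2 + 6 * d * p 0 * p 1 + 12 * e * p 1 ^ 2) -
        (3 * b * p 0 ^ 2 + 4 * c * p 0 * p 1 + 3 * d * p 1 ^ 2) ^ 2 < 0 := by
  unfold IsHyperbolicPoint
  rw [hessian_quartic]
  constructor
  · intro h
    have := h.det_neg
    rw [Matrix.det_fin_two] at this
    simp at this
    linarith
  · intro h
    have h' := isLorentzian_of_det_neg (a := -(12 * a * p 0 ^ 2 + 6 * b * p 0 * p 1 + 2 * c * p 1 ^ 2))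
      (b := -(3 * b * p 0 ^ 2 + 4 * c * p 0 * p 1 + 3 * d * p 1 ^ 2))
      (c := -(2 * c * p 0 ^ 2 + 6 * d * p 0 * p 1 + 12 * e * p 1 ^ 2)) (by linarith)
    convert h' using 1
    ext i j
    fin_cases i <;> fin_cases j <;> simp

theorem isHomogeneous_quartic (a b c d e : ℝ) : (quartic a b c d e).IsHomogeneous 4 := by
  have hX : ∀ (i : Fin 2) (n : ℕ), (X i ^ n : MvPolynomial (Fin 2) ℝ).IsHomogeneous n := fun i n => by
    simpa using (isHomogeneous_X ℝ i).pow n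
  have hC : ∀ (r : ℝ), (C r : MvPolynomial (Fin 2) ℝ).IsHomogeneous 0 := isHomogeneous_C _
  unfold quartic
  refine ((((?_ : IsHomogeneous _ 4).add ?_).add ?_).add ?_).add ?_
  · simpa using (hC a).mul (hX 0 4)
  · simpa using ((hC b).mul (hX 0 3)).mul (isHomogeneous_X ℝ (1 : Fin 2))
  · simpa using ((hC c).mul (hX 0 2)).mul (hX 1 2)
  · simpa using ((hC d).mul (isHomogeneous_X ℝ (0 : Fin 2))).mul (hX 1 3)
  · simpa using (hC e).mul (hX 1 4)

theorem exists_eq_quartic {h : MvPolynomial (Fin 2) ℝ} (hh : h.IsHomogeneous 4) :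
    ∃ a b c d e, h = quartic a b c d e := by
  let m : ℕ → ℕ → Fin 2 →₀ ℕ := fun i j => Finsupp.single 0 i + Finsupp.single 1 j
  refine ⟨coeff (m 4 0) h, coeff (m 3 1) h, coeff (m 2 2) h, coeff (m 1 3) h, coeff (m 0 4) h, ?_⟩
  have hq : ∀ a b c d e, quartic a b c d e = monomial (m 4 0) a + monomial (m 3 1) b +
      monomial (m 2 2) c + monomial (m 1 3) d + monomial (m 0 4) e := by
    intro a b c d e
    simp only [quartic, m, monomial_eq]
    simp [Finsupp.prod_add_index', pow_add, Finsupp.prod_single_index, mul_assoc]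
  rw [hq]
  ext n
  simp only [coeff_add, coeff_monomial]
  have hmn : ∀ i j, m i j = n ↔ n 0 = i ∧ n 1 = j := by
    intro i j
    rw [Finsupp.ext_iff]
    simp [Fin.forall_fin_two, m, eq_comm]
  by_cases hn : n 0 + n 1 = 4
  · have hm : m (n 0) (n 1) = n := (hmn _ _).2 ⟨rfl, rfl⟩
    simp only [hmn]
    obtain h0 | h0 | h0 | h0 | h0 : n 0 = 0 ∨ n 0 = 1 ∨ n 0 = 2 ∨ n 0 = 3 ∨ n 0 = 4 := by omega
    all_goals
      have h1 : n 1 = 4 - n 0 := by omega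
      rw [h0] at h1
      rw [h0, h1] at hm
      simp [h0, h1, hm]
  · have h0 : coeff n h = 0 := by
      by_contra hne
      have := hh hne
      rw [Finsupp.weight_apply, Finsupp.sum_fintype _ _ (by simp)] at this
      simp at this
      exact hn this
    rw [h0]
    simp only [hmn]
    rw [if_neg (by omega), if_neg (by omega), if_neg (by omega), if_neg (by omega),
      if_neg (by omega)]
    simp

theorem isHomogeneous_linSubst (B : Matrix (Fin 2) (Fin 2) ℝ) {h : MvPolynomial (Fin 2) ℝ}
    (hh : h.IsHomogeneous 4) : (linSubst B h).IsHomogeneous 4 := by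
  have := hh.aeval (fun i => ∑ j, C (B i j) * X j) (n := 1) (fun i => by
    refine IsHomogeneous.sum _ _ _ fun j _ => ?_
    simpa using (isHomogeneous_C (Fin 2) (B i j)).mul (isHomogeneous_X ℝ j))
  rw [one_mul] at this
  exact this

theorem eval_smul_of_isHomogeneous {h : MvPolynomial (Fin 2) ℝ} (hh : h.IsHomogeneous 4) (r : ℝ)
    (p : Plane) : eval (r • p) h = r ^ 4 * eval p h := by
  obtain ⟨a, b, c, d, e, rfl⟩ := exists_eq_quartic hh
  simp only [eval_quartic, Pi.smul_apply, smul_eq_mul]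
  ring

/-! ### The linear action -/

/-- The homeomorphism of the plane given by an element of `GL(2)`. -/
noncomputable def actHomeo (A : GL (Fin 2) ℝ) : Plane ≃ₜ Plane where
  toFun p := A.val.mulVec p
  invFun p := A⁻¹.val.mulVec p
  left_inv p := by dsimp only; rw [Matrix.mulVec_mulVec, ← Units.val_mul]; simp
  right_inv p := by dsimp only; rw [Matrix.mulVec_mulVec, ← Units.val_mul]; simp
  continuous_toFun := continuous_const.matrix_mulVec continuous_id
  continuous_invFun := continuous_const.matrix_mulVec continuous_id

theorem act_eq_image (A : GL (Fin 2) ℝ) (S : Set Plane) : act A S = actHomeo A '' S := rfl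

theorem inv_mulVec_mulVec (A : GL (Fin 2) ℝ) (p : Plane) :
    A⁻¹.val.mulVec (A.val.mulVec p) = p := (actHomeo A).left_inv p

theorem mulVec_inv_mulVec (A : GL (Fin 2) ℝ) (p : Plane) :
    A.val.mulVec (A⁻¹.val.mulVec p) = p := (actHomeo A).right_inv p

theorem mem_act {A : GL (Fin 2) ℝ} {S : Set Plane} {p : Plane} :
    p ∈ act A S ↔ A⁻¹.val.mulVec p ∈ S := by
  constructor
  · rintro ⟨q, hq, rfl⟩
    simpa only [inv_mulVec_mulVec] using hq
  · intro h
    exact ⟨_, h, mulVec_inv_mulVec A p⟩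

theorem mem_act_inv {A : GL (Fin 2) ℝ} {S : Set Plane} {p : Plane} :
    p ∈ act A⁻¹ S ↔ A.val.mulVec p ∈ S := by
  rw [mem_act, inv_inv]

theorem act_one (S : Set Plane) : act 1 S = S := by
  ext p
  simp [mem_act]

theorem act_act (A B : GL (Fin 2) ℝ) (S : Set Plane) : act A (act B S) = act (A * B) S := by
  ext p
  rw [mem_act, mem_act, mem_act, mul_inv_rev, Units.val_mul, Matrix.mulVec_mulVec]

theorem act_inv_act (A : GL (Fin 2) ℝ) (S : Set Plane) : act A⁻¹ (act A S) = S := by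
  rw [act_act, inv_mul_cancel, act_one]

theorem act_act_inv (A : GL (Fin 2) ℝ) (S : Set Plane) : act A (act A⁻¹ S) = S := by
  rw [act_act, mul_inv_cancel, act_one]

theorem Equivalent.symm {H H' : Set Plane} (h : Equivalent H H') : Equivalent H' H := by
  obtain ⟨A, rfl⟩ := h
  exact ⟨A⁻¹, act_inv_act A H⟩

theorem Equivalent.trans {H H' H'' : Set Plane} (h : Equivalent H H') (h' : Equivalent H' H'') :
    Equivalent H H'' := by
  obtain ⟨A, rfl⟩ := h
  obtain ⟨B, rfl⟩ := h'
  exact ⟨B * A, (act_act B A H).symm⟩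

theorem isClosed_act (A : GL (Fin 2) ℝ) {S : Set Plane} (hS : IsClosed S) : IsClosed (act A S) :=
  (actHomeo A).isClosedMap S hS

theorem isConnected_act (A : GL (Fin 2) ℝ) {S : Set Plane} (hS : IsConnected S) :
    IsConnected (act A S) :=
  hS.image _ (actHomeo A).continuous.continuousOn

theorem linSubst_inv_linSubst (B : GL (Fin 2) ℝ) (h : MvPolynomial (Fin 2) ℝ) :
    linSubst B⁻¹.val (linSubst B.val h) = h := by
  rw [← linSubst_mul, ← Units.val_mul, mul_inv_cancel, Units.val_one, linSubst_one]

theorem isHyperbolicPoint_linSubst_iff (B : GL (Fin 2) ℝ) {h : MvPolynomial (Fin 2) ℝ}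
    {p : Plane} :
    IsHyperbolicPoint (linSubst B.val h) p ↔ IsHyperbolicPoint h (B.val.mulVec p) := by
  refine ⟨fun hp => ?_, isHyperbolicPoint_linSubst B⟩
  have := isHyperbolicPoint_linSubst B⁻¹ (h := linSubst B.val h) (p := B.val.mulVec p)
    (by rwa [inv_mulVec_mulVec])
  rwa [linSubst_inv_linSubst] at this

theorem hyperbolicLevelSet_linSubst (B : GL (Fin 2) ℝ) (h : MvPolynomial (Fin 2) ℝ) :
    hyperbolicLevelSet (linSubst B.val h) = act B⁻¹ (hyperbolicLevelSet h) := by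
  ext p
  rw [mem_act_inv]
  simp only [hyperbolicLevelSet, Set.mem_ofPred_eq, eval_linSubst, isHyperbolicPoint_linSubst_iff]

theorem linSubst_of_mem_autGroup {h : MvPolynomial (Fin 2) ℝ} {A : GL (Fin 2) ℝ}
    (hA : A ∈ autGroup h) : linSubst A.val h = h :=
  MvPolynomial.funext fun p => by rw [eval_linSubst]; exact hA p

theorem act_hyperbolicLevelSet {h : MvPolynomial (Fin 2) ℝ} {A : GL (Fin 2) ℝ}
    (hA : A ∈ autGroup h) : act A (hyperbolicLevelSet h) = hyperbolicLevelSet h := by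
  have := hyperbolicLevelSet_linSubst A⁻¹ h
  rw [linSubst_of_mem_autGroup (inv_mem hA), inv_inv] at this
  exact this.symm

/-! ### Connected components -/

/-- Finiteness makes the union of the other pieces closed, so each piece is clopen in `S`; being
connected as well, it is a component. -/
theorem connectedComponentIn_eq_of_closed_cover {ι : Type*} [Finite ι] {S : Set Plane}
    {C : ι → Set Plane} (hS : S = ⋃ i, C i) (hcl : ∀ i, IsClosed (C i))
    (hco : ∀ i, IsConnected (C i)) (hdis : ∀ i j, ∀ p, p ∈ C i → p ∈ C j → i = j)
    {i : ι} {p : Plane} (hp : p ∈ C i) : connectedComponentIn S p = C i := by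
  have hpS : p ∈ S := hS ▸ Set.mem_iUnion_of_mem i hp
  apply Set.Subset.antisymm
  · have h := isPreconnected_iff_subset_of_disjoint_closed.1
      (isPreconnected_connectedComponentIn (F := S) (x := p)) (C i) (⋃ j : {j // j ≠ i}, C j)
      (hcl i) (isClosed_iUnion_of_finite fun j => hcl j) ?_ ?_
    · rcases h with h | h
      · exact h
      · obtain ⟨⟨j, hj⟩, hpj⟩ := Set.mem_iUnion.1 (h (mem_connectedComponentIn hpS))
        exact (hj (hdis j i p hpj hp)).elim
    · intro q hq
      have hqS := connectedComponentIn_subset S p hq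
      rw [hS] at hqS
      obtain ⟨j, hj⟩ := Set.mem_iUnion.1 hqS
      by_cases hji : j = i
      · exact Or.inl (hji ▸ hj)
      · exact Or.inr (Set.mem_iUnion.2 ⟨⟨j, hji⟩, hj⟩)
    · apply Set.eq_empty_of_forall_notMem
      rintro q ⟨-, hq, hq'⟩
      obtain ⟨⟨j, hj⟩, hqj⟩ := Set.mem_iUnion.1 hq'
      exact hj (hdis j i q hqj hq)
  · exact (hco i).isPreconnected.subset_connectedComponentIn hp
      (hS ▸ Set.subset_iUnion C i)

theorem components_eq_range {ι : Type*} [Finite ι] {S : Set Plane}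
    {C : ι → Set Plane} (hS : S = ⋃ i, C i) (hcl : ∀ i, IsClosed (C i))
    (hco : ∀ i, IsConnected (C i)) (hdis : ∀ i j, ∀ p, p ∈ C i → p ∈ C j → i = j) :
    components S = Set.range C := by
  ext D
  constructor
  · rintro ⟨p, hp, rfl⟩
    rw [hS] at hp
    obtain ⟨i, hi⟩ := Set.mem_iUnion.1 hp
    exact ⟨i, (connectedComponentIn_eq_of_closed_cover hS hcl hco hdis hi).symm⟩
  · rintro ⟨i, rfl⟩
    obtain ⟨p, hp⟩ := (hco i).nonempty
    exact ⟨p, hS ▸ Set.mem_iUnion_of_mem i hp,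
      (connectedComponentIn_eq_of_closed_cover hS hcl hco hdis hp).symm⟩

theorem act_mem_components {h : MvPolynomial (Fin 2) ℝ} {A : GL (Fin 2) ℝ}
    (hA : A ∈ autGroup h) {C : Set Plane} (hC : C ∈ components (hyperbolicLevelSet h)) :
    act A C ∈ components (hyperbolicLevelSet h) := by
  obtain ⟨p, hp, rfl⟩ := hC
  have hS := act_hyperbolicLevelSet hA
  refine ⟨A.val.mulVec p, hS ▸ ⟨p, hp, rfl⟩, ?_⟩
  have := (actHomeo A).image_connectedComponentIn hp
  rw [← act_eq_image, ← act_eq_image, hS] at this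
  exact this

/-! ### Radial projection to the level set -/

theorem continuous_eval (h : MvPolynomial (Fin 2) ℝ) : Continuous fun p : Plane => eval p h :=
  MvPolynomial.continuous_eval h

/-- The radial projection of `{h > 0}` to `{h = 1}` for a quartic form `h`. -/
noncomputable def radialProj (h : MvPolynomial (Fin 2) ℝ) (p : Plane) : Plane :=
  (√√(eval p h))⁻¹ • p

theorem continuousOn_radialProj (h : MvPolynomial (Fin 2) ℝ) :
    ContinuousOn (radialProj h) {p | 0 < eval p h} := by
  unfold radialProj
  have h1 : ContinuousOn (fun p : Plane => √√(eval p h)) {p | 0 < eval p h} :=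
    (Real.continuous_sqrt.comp (Real.continuous_sqrt.comp (continuous_eval h))).continuousOn
  exact (h1.inv₀ fun p hp => (Real.sqrt_pos.2 (Real.sqrt_pos.2 hp)).ne').smul continuousOn_id

theorem eval_radialProj {h : MvPolynomial (Fin 2) ℝ} (hh : h.IsHomogeneous 4) {p : Plane}
    (hp : 0 < eval p h) : eval (radialProj h p) h = 1 := by
  rw [radialProj, eval_smul_of_isHomogeneous hh]
  have h1 : √√(eval p h) ^ 4 = eval p h := by
    rw [show (4 : ℕ) = 2 * 2 from rfl, pow_mul, Real.sq_sqrt (Real.sqrt_nonneg _),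
      Real.sq_sqrt hp.le]
  rw [inv_pow, h1, inv_mul_cancel₀ hp.ne']

theorem radialProj_of_eval_eq_one {h : MvPolynomial (Fin 2) ℝ} {p : Plane} (hp : eval p h = 1) :
    radialProj h p = p := by
  simp [radialProj, hp]

theorem radialProj_scale_pos {h : MvPolynomial (Fin 2) ℝ} {p : Plane} (hp : 0 < eval p h) :
    0 < (√√(eval p h))⁻¹ :=
  inv_pos.2 (Real.sqrt_pos.2 (Real.sqrt_pos.2 hp))

/-! ### Arcs in the open quadrant -/

/-- The open first quadrant. -/
def quadrant : Set Plane := {p | 0 < p 0 ∧ 0 < p 1}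

/-- The part of the level set `a x³y + b x²y² + c xy³ = 1` in the open first quadrant. -/
noncomputable def quad (a b c : ℝ) : Set Plane := {p ∈ quadrant | eval p (quartic 0 a b c 0) = 1}

theorem smul_mem_quadrant {r : ℝ} (hr : 0 < r) {p : Plane} (hp : p ∈ quadrant) :
    r • p ∈ quadrant :=
  ⟨mul_pos hr hp.1, mul_pos hr hp.2⟩

theorem isOpen_quadrant : IsOpen quadrant :=
  (isOpen_lt continuous_const (continuous_apply 0)).inter
    (isOpen_lt continuous_const (continuous_apply 1))

theorem isPreconnected_quadrant : IsPreconnected quadrant := by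
  apply Convex.isPreconnected
  intro p hp q hq s t hs ht hst
  have hcomb : ∀ x y : ℝ, 0 < x → 0 < y → 0 < s * x + t * y := by
    intro x y hx hy
    rcases hs.eq_or_lt with rfl | hs
    · have : t = 1 := by linarith
      simpa [this] using hy
    · have := mul_pos hs hx
      have := mul_nonneg ht hy.le
      linarith
  exact ⟨hcomb _ _ hp.1 hq.1, hcomb _ _ hp.2 hq.2⟩

theorem eval_quartic_of_zero (a b c : ℝ) (p : Plane) :
    eval p (quartic 0 a b c 0) =
      p 0 * p 1 * (a * p 0 ^ 2 + b * p 0 * p 1 + c * p 1 ^ 2) := by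
  rw [eval_quartic]; ring

/-- The form vanishes on both axes, so its level set `1` avoids them and the open quadrant may be
replaced by the closed one. -/
theorem isClosed_quad (a b c : ℝ) : IsClosed (quad a b c) := by
  have : quad a b c = {p : Plane | 0 ≤ p 0} ∩ {p | 0 ≤ p 1} ∩
      {p | eval p (quartic 0 a b c 0) = 1} := by
    ext p
    constructor
    · rintro ⟨⟨h0, h1⟩, h⟩
      exact ⟨⟨h0.le, h1.le⟩, h⟩
    · rintro ⟨⟨h0, h1⟩, h⟩
      simp only [Set.mem_ofPred_eq] at h0 h1 h
      refine ⟨⟨lt_of_le_of_ne h0 fun h' => ?_, lt_of_le_of_ne h1 fun h' => ?_⟩, h⟩ <;>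
      · rw [eval_quartic_of_zero, ← h'] at h
        simp at h
  rw [this]
  exact ((isClosed_le continuous_const (continuous_apply 0)).inter
    (isClosed_le continuous_const (continuous_apply 1))).inter
    (isClosed_eq (continuous_eval _) continuous_const)

theorem quad_eq_image {a b c : ℝ} (hpos : ∀ p ∈ quadrant, 0 < eval p (quartic 0 a b c 0)) :
    quad a b c = radialProj (quartic 0 a b c 0) '' quadrant := by
  ext p
  constructor
  · rintro ⟨hp, h⟩
    exact ⟨p, hp, radialProj_of_eval_eq_one h⟩
  · rintro ⟨q, hq, rfl⟩
    exact ⟨smul_mem_quadrant (radialProj_scale_pos (hpos q hq)) hq,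
      eval_radialProj (isHomogeneous_quartic _ _ _ _ _) (hpos q hq)⟩

theorem isConnected_quad {a b c : ℝ} (hpos : ∀ p ∈ quadrant, 0 < eval p (quartic 0 a b c 0)) :
    IsConnected (quad a b c) := by
  rw [quad_eq_image hpos]
  refine ⟨⟨_, ![1, 1], ?_, rfl⟩, isPreconnected_quadrant.image _
    ((continuousOn_radialProj _).mono hpos)⟩
  simp [quadrant]

/-- The quartic forms `a x³y + b x²y² + c xy³` whose level set in the open first quadrant consists
of hyperbolic points, up to exchanging the coordinates. -/
structure Admissible (a b c : ℝ) : Prop where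
  a_nonneg : 0 ≤ a
  b_nonneg : 0 ≤ b
  c_nonneg : 0 ≤ c
  pos : 0 < b ∨ (0 < a ∧ c = 0)

theorem Admissible.eval_pos {a b c : ℝ} (H : Admissible a b c) {p : Plane} (hp : p ∈ quadrant) :
    0 < eval p (quartic 0 a b c 0) := by
  obtain ⟨h0, h1⟩ := hp
  obtain ⟨ha, hb, hc, h⟩ := H
  rw [eval_quartic_of_zero]
  rcases h with h | ⟨h, -⟩ <;> positivity

/-- The Hessian determinant is `-3` times the expression in `key`. For `b = 0` only the square
survives, and it is positive on the whole quadrant as soon as just one of `a`, `c` is non-zero; this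
is the second alternative of `pos`. -/
theorem Admissible.isHyperbolicPoint {a b c : ℝ} (H : Admissible a b c) {p : Plane}
    (hp : p ∈ quadrant) : IsHyperbolicPoint (quartic 0 a b c 0) p := by
  obtain ⟨h0, h1⟩ := hp
  obtain ⟨ha, hb, hc, h⟩ := H
  rw [isHyperbolicPoint_quartic]
  have key : 0 < (a * p 0 ^ 2 - c * p 1 ^ 2) ^ 2 * 3 + 4 * b ^ 2 * p 0 ^ 2 * p 1 ^ 2
      + 4 * b * p 0 * p 1 * (a * p 0 ^ 2 + c * p 1 ^ 2) := by
    rcases h with h | ⟨h, rfl⟩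
    · positivity
    · simp only [zero_mul, sub_zero]
      positivity
  linarith

theorem Admissible.quad_subset {a b c : ℝ} (H : Admissible a b c) :
    quad a b c ⊆ hyperbolicLevelSet (quartic 0 a b c 0) :=
  fun _ hp => ⟨hp.2, H.isHyperbolicPoint hp.1⟩

theorem Admissible.isConnected_quad {a b c : ℝ} (H : Admissible a b c) :
    IsConnected (quad a b c) :=
  QuarticGPSR.isConnected_quad fun _ => H.eval_pos

theorem mulVec_fin_two (a b c d : ℝ) (p : Plane) :
    (!![a, b; c, d] : Matrix (Fin 2) (Fin 2) ℝ).mulVec p =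
      ![a * p 0 + b * p 1, c * p 0 + d * p 1] := by
  ext i
  fin_cases i <;> simp [Matrix.vecHead, Matrix.vecTail]

/-! ### Smoothness of the level set. -/

theorem contDiff_eval {h : MvPolynomial (Fin 2) ℝ} (hh : h.IsHomogeneous 4) :
    ContDiff ℝ ∞ fun p : Plane => eval p h := by
  obtain ⟨a, b, c, d, e, rfl⟩ := exists_eq_quartic hh
  simp only [eval_quartic]
  fun_prop

/-- By homogeneity the derivative in the radial direction at `q` is `4 h(q)`. -/
theorem fderiv_eval_ne_zero {h : MvPolynomial (Fin 2) ℝ} (hh : h.IsHomogeneous 4) {q : Plane}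
    (hq : eval q h ≠ 0) : fderiv ℝ (fun p : Plane => eval p h - 1) q ≠ 0 := by
  intro h0
  have hd : HasFDerivAt (fun p : Plane => eval p h - 1) (0 : Plane →L[ℝ] ℝ) ((1 : ℝ) • q) := by
    rw [one_smul, ← h0]
    exact (((contDiff_eval hh).differentiable (by simp)).differentiableAt.sub_const 1).hasFDerivAt
  have h1 : HasDerivAt (fun t : ℝ => t • q) ((1 : ℝ) • q) 1 := (hasDerivAt_id 1).smul_const q
  have h2 := hd.comp_hasDerivAt (1 : ℝ) h1
  have h3 : HasDerivAt (fun t : ℝ => t ^ 4 * eval q h - 1) (4 * 1 ^ 3 * eval q h) 1 := by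
    simpa using ((hasDerivAt_pow 4 (1 : ℝ)).mul_const (eval q h)).sub_const 1
  have h4 : (fun p : Plane => eval p h - 1) ∘ (fun t : ℝ => t • q) =
      fun t : ℝ => t ^ 4 * eval q h - 1 := by
    funext t
    simp [eval_smul_of_isHomogeneous hh]
  rw [h4] at h2
  have := h2.unique h3
  simp at this
  exact hq this

theorem isSmoothCurve_level {h : MvPolynomial (Fin 2) ℝ} (hh : h.IsHomogeneous 4) {U : Set Plane}
    (hU : IsOpen U) : IsSmoothCurve {p ∈ U | eval p h = 1} := by
  rintro p ⟨hp, hp1⟩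
  -- Shrinking to `{h > 0}` keeps the differential non-zero on the whole neighbourhood, not only on
  -- the curve.
  refine ⟨U ∩ {q | 0 < eval q h}, hU.inter (isOpen_lt continuous_const (continuous_eval h)),
    ⟨hp, ?_⟩, fun q => eval q h - 1, ((contDiff_eval hh).sub contDiff_const).contDiffOn,
    fun q hq => fderiv_eval_ne_zero hh (ne_of_gt hq.2), ?_⟩
  · show 0 < eval p h
    rw [hp1]; exact one_pos
  · ext q
    constructor
    · rintro ⟨⟨-, h1⟩, h2⟩
      exact ⟨h2, sub_eq_zero.2 h1⟩
    · rintro ⟨h1, h2⟩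
      exact ⟨⟨h1.1, sub_eq_zero.1 h2⟩, h1⟩

/-! ### Linear equivalences between arcs in the quadrant -/

theorem nonneg_of_forall_pos {a b : ℝ} (h : ∀ x y : ℝ, 0 < x → 0 < y → 0 < a * x + b * y) :
    0 ≤ a ∧ 0 ≤ b := by
  have key : ∀ a b : ℝ, (∀ x y : ℝ, 0 < x → 0 < y → 0 < a * x + b * y) → 0 ≤ a := by
    intro a b h
    by_contra! ha
    -- If `a < 0`, this `x` is large enough that `a x + b = -(|b| + 1) + b` is negative.
    have h1 := h ((|b| + 1) / (-a)) 1 (div_pos (by positivity) (by linarith)) one_pos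
    have h2 : a * ((|b| + 1) / (-a)) = -(|b| + 1) := by
      field_simp [ha.ne]
    have := le_abs_self b
    linarith
  exact ⟨key a b h, key b a fun x y hx hy => by have := h y x hy hx; linarith⟩

/-- Both `A` and `A⁻¹` have non-negative entries. An off-diagonal entry of `A A⁻¹ = 1` is a sum of
non-negative terms equal to zero, so every term vanishes, which leaves one non-zero entry in each
row of `A`. -/
theorem exists_monomial_of_maps_quadrant {A : GL (Fin 2) ℝ}
    (h : ∀ p ∈ quadrant, A.val.mulVec p ∈ quadrant)
    (h' : ∀ p ∈ quadrant, A⁻¹.val.mulVec p ∈ quadrant) :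
    ∃ l m : ℝ, 0 < l ∧ 0 < m ∧ (A.val = !![l, 0; 0, m] ∨ A.val = !![0, l; m, 0]) := by
  have entries : ∀ B : Matrix (Fin 2) (Fin 2) ℝ, (∀ p ∈ quadrant, B.mulVec p ∈ quadrant) →
      ∀ i j, 0 ≤ B i j := by
    intro B hB i
    have hrow : ∀ x y : ℝ, 0 < x → 0 < y → 0 < B i 0 * x + B i 1 * y := by
      intro x y hx hy
      have := hB ![x, y] ⟨by simpa using hx, by simpa using hy⟩
      have h2 : 0 < B.mulVec ![x, y] i := by
        fin_cases i
        exacts [this.1, this.2]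
      simpa [Matrix.mulVec, dotProduct, Fin.sum_univ_two] using h2
    have := nonneg_of_forall_pos hrow
    exact Fin.forall_fin_two.2 this
  have hA := entries _ h
  have hA' := entries _ h'
  have hmul : A.val * A⁻¹.val = 1 := by rw [← Units.val_mul]; simp
  have hmul' : A⁻¹.val * A.val = 1 := by rw [← Units.val_mul]; simp
  generalize A⁻¹.val = B at *
  generalize A.val = M at *
  have e := fun i j => congrFun (congrFun hmul i) j
  have e' := fun i j => congrFun (congrFun hmul' i) j
  simp only [Matrix.mul_apply, Fin.sum_univ_two] at e e'
  have e00 := e 0 0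
  have e01 := e 0 1
  have e10 := e 1 0
  have e11 := e 1 1
  have f00 := e' 0 0
  have f01 := e' 0 1
  simp at e00 e01 e10 e11 f00 f01
  have n1 := mul_nonneg (hA 0 0) (hA' 0 1)
  have n2 := mul_nonneg (hA 0 1) (hA' 1 1)
  have n3 := mul_nonneg (hA 1 0) (hA' 0 0)
  have n4 := mul_nonneg (hA 1 1) (hA' 1 0)
  have z1 : M 0 0 * B 0 1 = 0 := by linarith
  have z2 : M 0 1 * B 1 1 = 0 := by linarith
  have z3 : M 1 0 * B 0 0 = 0 := by linarith
  have z4 : M 1 1 * B 1 0 = 0 := by linarith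
  by_cases hM : M 0 0 = 0
  · rw [hM] at e00
    have h1 : B 1 0 ≠ 0 := fun h => by rw [h] at e00; simp at e00
    have h2 : M 1 1 = 0 := (mul_eq_zero.1 z4).resolve_right h1
    have h3 : M 0 1 ≠ 0 := fun h => by rw [h] at e00; simp at e00
    have h4 : M 1 0 ≠ 0 := fun h => by rw [h, h2] at e11; simp at e11
    refine ⟨M 0 1, M 1 0, lt_of_le_of_ne (hA _ _) (Ne.symm h3), lt_of_le_of_ne (hA _ _) (Ne.symm h4),
      Or.inr ?_⟩
    rw [Matrix.eta_fin_two M, hM, h2]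
    simp
  · have h1 : B 0 1 = 0 := (mul_eq_zero.1 z1).resolve_left hM
    rw [h1] at e11
    have h2 : M 1 1 ≠ 0 := fun h => by rw [h] at e11; simp at e11
    have h5 : B 1 1 ≠ 0 := fun h => by rw [h] at e11; simp at e11
    have h3 : M 0 1 = 0 := (mul_eq_zero.1 z2).resolve_right h5
    have h6 : B 0 0 ≠ 0 := fun h => by rw [h, h3] at e00; simp at e00
    have h4 : M 1 0 = 0 := (mul_eq_zero.1 z3).resolve_right h6
    refine ⟨M 0 0, M 1 1, lt_of_le_of_ne (hA _ _) (Ne.symm hM), lt_of_le_of_ne (hA _ _) (Ne.symm h2),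
      Or.inl ?_⟩
    rw [Matrix.eta_fin_two M, h3, h4]
    simp

theorem coeff_eq_of_forall_pos {a b c a' b' c' : ℝ} (h : ∀ x y : ℝ, 0 < x → 0 < y →
    a * x ^ 3 * y + b * x ^ 2 * y ^ 2 + c * x * y ^ 3 =
      a' * x ^ 3 * y + b' * x ^ 2 * y ^ 2 + c' * x * y ^ 3) : a = a' ∧ b = b' ∧ c = c' := by
  have h1 := h 1 1 one_pos one_pos
  have h2 := h 1 2 one_pos two_pos
  have h3 := h 2 1 two_pos one_pos
  refine ⟨?_, ?_, ?_⟩ <;> linarith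

theorem Admissible.exists_smul_mem_quad {a b c : ℝ} (H : Admissible a b c) {p : Plane}
    (hp : p ∈ quadrant) : ∃ r : ℝ, 0 < r ∧ r • p ∈ quad a b c := by
  refine ⟨_, radialProj_scale_pos (H.eval_pos hp), ?_⟩
  rw [quad_eq_image fun _ => H.eval_pos]
  exact ⟨p, hp, rfl⟩

theorem mem_quadrant_of_smul {r : ℝ} (hr : 0 < r) {p : Plane} (hp : r • p ∈ quadrant) :
    p ∈ quadrant := by
  have := smul_mem_quadrant (inv_pos.2 hr) hp
  rwa [smul_smul, inv_mul_cancel₀ hr.ne', one_smul] at this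

/-- Every point of the quadrant is a positive multiple of a point of the arc, so a map of arcs
determines by homogeneity a map of quadrants that respects the two forms. -/
theorem mulVec_mem_quadrant_of_act_quad {a b c a' b' c' : ℝ} (H : Admissible a b c)
    {A : GL (Fin 2) ℝ} (hA : act A (quad a b c) = quad a' b' c') {p : Plane}
    (hp : p ∈ quadrant) : A.val.mulVec p ∈ quadrant ∧
      eval (A.val.mulVec p) (quartic 0 a' b' c' 0) = eval p (quartic 0 a b c 0) := by
  obtain ⟨r, hr, hrp⟩ := H.exists_smul_mem_quad hp
  have h1 : A.val.mulVec (r • p) ∈ quad a' b' c' := hA ▸ ⟨_, hrp, rfl⟩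
  rw [Matrix.mulVec_smul] at h1
  refine ⟨mem_quadrant_of_smul hr h1.1, ?_⟩
  have h2 := h1.2
  have h3 := hrp.2
  rw [eval_smul_of_isHomogeneous (isHomogeneous_quartic _ _ _ _ _)] at h2 h3
  exact mul_left_cancel₀ (pow_pos hr 4).ne' (h2.trans h3.symm)

/-- A linear map between two admissible arcs in the quadrant is monomial with positive entries. -/
theorem monomial_of_act_quad {a b c a' b' c' : ℝ} (H : Admissible a b c)
    (H' : Admissible a' b' c') {A : GL (Fin 2) ℝ} (hA : act A (quad a b c) = quad a' b' c') :
    ∃ l m : ℝ, 0 < l ∧ 0 < m ∧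
      ((A.val = !![l, 0; 0, m] ∧ a = l ^ 3 * m * a' ∧ b = (l * m) ^ 2 * b' ∧ c = l * m ^ 3 * c') ∨
      (A.val = !![0, l; m, 0] ∧ a = l * m ^ 3 * c' ∧ b = (l * m) ^ 2 * b' ∧
        c = l ^ 3 * m * a')) := by
  have hA' : act A⁻¹ (quad a' b' c') = quad a b c := by rw [← hA, act_inv_act]
  obtain ⟨l, m, hl, hm, h⟩ := exists_monomial_of_maps_quadrant
    (fun p hp => (mulVec_mem_quadrant_of_act_quad H hA hp).1)
    (fun p hp => (mulVec_mem_quadrant_of_act_quad H' hA' hp).1)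
  have hev := fun x y (hx : 0 < x) (hy : 0 < y) =>
    (mulVec_mem_quadrant_of_act_quad H hA (p := ![x, y]) ⟨hx, hy⟩).2
  refine ⟨l, m, hl, hm, ?_⟩
  rcases h with h | h
  · left
    refine ⟨h, coeff_eq_of_forall_pos fun x y hx hy => ?_⟩
    have := hev x y hx hy
    rw [h] at this
    rw [mulVec_fin_two] at this
    simp [eval_quartic] at this
    linear_combination -this
  · right
    refine ⟨h, coeff_eq_of_forall_pos fun x y hx hy => ?_⟩
    have := hev x y hx hy
    rw [h] at this
    rw [mulVec_fin_two] at this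
    simp [eval_quartic] at this
    linear_combination -this

/-- The invertible diagonal matrix with positive entries `l` and `m`. -/
noncomputable def diagGL (l m : ℝ) (hl : 0 < l) (hm : 0 < m) : GL (Fin 2) ℝ :=
  Matrix.GeneralLinearGroup.mkOfDetNeZero !![l, 0; 0, m] (by
    simp [Matrix.det_fin_two, hl.ne', hm.ne'])

theorem diagGL_mulVec {l m : ℝ} (hl : 0 < l) (hm : 0 < m) (p : Plane) :
    (diagGL l m hl hm).val.mulVec p = ![l * p 0, m * p 1] := by
  show Matrix.mulVec !![l, 0; 0, m] p = _
  rw [mulVec_fin_two]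
  simp

theorem quad_eq_act_inv_diagGL {l m : ℝ} (hl : 0 < l) (hm : 0 < m) (a b c : ℝ) :
    quad (l ^ 3 * m * a) ((l * m) ^ 2 * b) (l * m ^ 3 * c) =
      act (diagGL l m hl hm)⁻¹ (quad a b c) := by
  ext p
  rw [mem_act_inv, diagGL_mulVec]
  simp only [quad, quadrant, Set.mem_ofPred_eq, eval_quartic, Matrix.cons_val_zero,
    Matrix.cons_val_one]
  refine and_congr (and_congr ?_ ?_) ?_
  · exact (mul_pos_iff_of_pos_left hl).symm
  · exact (mul_pos_iff_of_pos_left hm).symm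
  · ring_nf

theorem equivalent_quad_scale {l m : ℝ} (hl : 0 < l) (hm : 0 < m) (a b c : ℝ) :
    Equivalent (quad a b c) (quad (l ^ 3 * m * a) ((l * m) ^ 2 * b) (l * m ^ 3 * c)) :=
  ⟨_, (quad_eq_act_inv_diagGL hl hm a b c).symm⟩

theorem equivalent_quad_swap (a b c : ℝ) : Equivalent (quad a b c) (quad c b a) := by
  let A : GL (Fin 2) ℝ := Matrix.GeneralLinearGroup.mkOfDetNeZero !![0, 1; 1, 0] (by simp)
  have hA : ∀ p : Plane, A.val.mulVec p = ![p 1, p 0] := by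
    intro p
    show Matrix.mulVec !![0, 1; 1, 0] p = _
    rw [mulVec_fin_two]
    simp
  refine ⟨A⁻¹, ?_⟩
  ext p
  rw [mem_act_inv, hA]
  simp only [quad, quadrant, Set.mem_ofPred_eq, eval_quartic, Matrix.cons_val_zero,
    Matrix.cons_val_one]
  rw [and_comm (a := 0 < p 1)]
  ring_nf

/-! ### Decomposition of the level set into images of one arc. -/

/-- The level set `{h = 1}` of `h = (a x³y + b x²y² + c xy³) ∘ B` is the disjoint union of the
images under the automorphisms `g i` of the part that `B` maps to the open first quadrant. -/
structure LevelDecomposition (h : MvPolynomial (Fin 2) ℝ) (a b c : ℝ) (B : GL (Fin 2) ℝ) {n : ℕ}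
    (g : Fin (n + 1) → GL (Fin 2) ℝ) : Prop where
  eq : h = linSubst B.val (quartic 0 a b c 0)
  admissible : Admissible a b c
  mem_autGroup : ∀ i, g i ∈ autGroup h
  cover : ∀ p, eval p h = 1 → ∃ i, B.val.mulVec ((g i)⁻¹.val.mulVec p) ∈ quadrant
  disjoint : ∀ p i j, B.val.mulVec ((g i)⁻¹.val.mulVec p) ∈ quadrant →
    B.val.mulVec ((g j)⁻¹.val.mulVec p) ∈ quadrant → i = j
  g_zero : g 0 = 1
  base_mem : B.val.mulVec ![1, 0] ∈ quadrant
  eval_base : eval ![1, 0] h = 1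

namespace LevelDecomposition

variable {h : MvPolynomial (Fin 2) ℝ} {a b c : ℝ} {B : GL (Fin 2) ℝ} {n : ℕ}
  {g : Fin (n + 1) → GL (Fin 2) ℝ}

theorem isHomogeneous (D : LevelDecomposition h a b c B g) : h.IsHomogeneous 4 := by
  rw [D.eq]
  exact isHomogeneous_linSubst _ (isHomogeneous_quartic _ _ _ _ _)

theorem act_inv_quad_eq (D : LevelDecomposition h a b c B g) :
    act B⁻¹ (quad a b c) = {p ∈ {p : Plane | B.val.mulVec p ∈ quadrant} | eval p h = 1} := by
  ext p
  rw [mem_act_inv, D.eq]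
  simp only [quad, Set.mem_ofPred_eq, eval_linSubst]

theorem arc_subset (D : LevelDecomposition h a b c B g) :
    act B⁻¹ (quad a b c) ⊆ hyperbolicLevelSet h := by
  rw [D.eq, hyperbolicLevelSet_linSubst]
  exact Set.image_mono D.admissible.quad_subset

theorem isClosed_arc (_ : LevelDecomposition h a b c B g) : IsClosed (act B⁻¹ (quad a b c)) :=
  isClosed_act _ (isClosed_quad a b c)

theorem isConnected_arc (D : LevelDecomposition h a b c B g) :
    IsConnected (act B⁻¹ (quad a b c)) :=
  isConnected_act _ D.admissible.isConnected_quad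

theorem base_mem_arc (D : LevelDecomposition h a b c B g) : ![1, 0] ∈ act B⁻¹ (quad a b c) := by
  rw [D.act_inv_quad_eq]
  exact ⟨D.base_mem, D.eval_base⟩

theorem isQuarticCCGPSRCurve (D : LevelDecomposition h a b c B g) :
    IsQuarticCCGPSRCurve h (act B⁻¹ (quad a b c)) where
  gpsr :=
    { homogeneous := D.isHomogeneous
      smooth := by
        rw [D.act_inv_quad_eq]
        exact isSmoothCurve_level D.isHomogeneous
          (isOpen_quadrant.preimage (continuous_const.matrix_mulVec continuous_id))
      level := fun p hp => (D.arc_subset hp).1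
      hyperbolic := fun p hp => (D.arc_subset hp).2 }
  closed := D.isClosed_arc
  connected := D.isConnected_arc

theorem mem_act_arc (D : LevelDecomposition h a b c B g) {i : Fin (n + 1)} {p : Plane} :
    p ∈ act (g i) (act B⁻¹ (quad a b c)) ↔
      B.val.mulVec ((g i)⁻¹.val.mulVec p) ∈ quadrant ∧ eval p h = 1 := by
  have h2 := inv_mem (D.mem_autGroup i) p
  rw [mem_act, D.act_inv_quad_eq]
  show _ ∧ eval ((g i)⁻¹.val.mulVec p) h = 1 ↔ _
  rw [h2]
  rfl

/-- Since `cover` concerns all points with `h = 1`, the hyperbolicity condition is automatic: each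
piece is the image under an automorphism of a hyperbolic arc. -/
theorem hyperbolicLevelSet_eq (D : LevelDecomposition h a b c B g) :
    hyperbolicLevelSet h = ⋃ i, act (g i) (act B⁻¹ (quad a b c)) := by
  apply Set.Subset.antisymm
  · rintro p ⟨hp, -⟩
    obtain ⟨i, hi⟩ := D.cover p hp
    exact Set.mem_iUnion.2 ⟨i, D.mem_act_arc.2 ⟨hi, hp⟩⟩
  · refine Set.iUnion_subset fun i => ?_
    rw [← act_hyperbolicLevelSet (D.mem_autGroup i)]
    exact Set.image_mono D.arc_subset

theorem index_eq_of_mem (D : LevelDecomposition h a b c B g) (i j : Fin (n + 1)) (p : Plane)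
    (hi : p ∈ act (g i) (act B⁻¹ (quad a b c))) (hj : p ∈ act (g j) (act B⁻¹ (quad a b c))) :
    i = j :=
  D.disjoint p i j (D.mem_act_arc.1 hi).1 (D.mem_act_arc.1 hj).1

theorem connectedComponentIn_eq (D : LevelDecomposition h a b c B g) :
    connectedComponentIn (hyperbolicLevelSet h) ![1, 0] = act B⁻¹ (quad a b c) := by
  have := connectedComponentIn_eq_of_closed_cover D.hyperbolicLevelSet_eq
    (fun i => isClosed_act (g i) D.isClosed_arc) (fun i => isConnected_act (g i) D.isConnected_arc)
    D.index_eq_of_mem (i := 0) (p := ![1, 0])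
    (by rw [D.g_zero, act_one]; exact D.base_mem_arc)
  rwa [D.g_zero, act_one] at this

theorem components_eq (D : LevelDecomposition h a b c B g) :
    components (hyperbolicLevelSet h) = Set.range fun i => act (g i) (act B⁻¹ (quad a b c)) :=
  components_eq_range D.hyperbolicLevelSet_eq
    (fun i => isClosed_act (g i) D.isClosed_arc) (fun i => isConnected_act (g i) D.isConnected_arc)
    D.index_eq_of_mem

theorem hasEquivalentClosedComponents (D : LevelDecomposition h a b c B g) :
    HasEquivalentClosedComponents h (n + 1) := by
  rw [HasEquivalentClosedComponents, D.components_eq]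
  refine ⟨?_, ?_, ?_⟩
  · rw [← Set.image_univ, Function.Injective.encard_image]
    · simp
    · intro i j hij
      obtain ⟨p, hp⟩ := (isConnected_act (g i) D.isConnected_arc).nonempty
      refine D.index_eq_of_mem i j p hp ?_
      rw [← show act (g i) _ = act (g j) _ from hij]
      exact hp
  · rintro _ ⟨i, rfl⟩
    exact isClosed_act (g i) D.isClosed_arc
  · rintro _ ⟨i, rfl⟩ _ ⟨j, rfl⟩
    exact Equivalent.trans (Equivalent.symm ⟨g i, rfl⟩) ⟨g j, rfl⟩

/-- The conjugate by `B` of a stabiliser element of the arc stabilises the arc in the quadrant. -/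
theorem act_conj {A : GL (Fin 2) ℝ} (hA : act A (act B⁻¹ (quad a b c)) = act B⁻¹ (quad a b c)) :
    act (B * A * B⁻¹) (quad a b c) = quad a b c := by
  rw [← act_act, ← act_act, hA, act_act_inv]

/-- Every automorphism is `g i` times an element that `B` conjugates to a positive monomial
matrix. -/
theorem exists_eq_mul (D : LevelDecomposition h a b c B g) {A : GL (Fin 2) ℝ}
    (hA : A ∈ autGroup h) : ∃ i, act ((g i)⁻¹ * A) (act B⁻¹ (quad a b c)) = act B⁻¹ (quad a b c) := by
  have hC : act B⁻¹ (quad a b c) ∈ components (hyperbolicLevelSet h) := by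
    rw [D.components_eq]
    exact ⟨0, by simp only [D.g_zero, act_one]⟩
  -- An automorphism permutes the components, and each of these is the image of the arc under some
  -- `g i`.
  have := act_mem_components hA hC
  rw [D.components_eq] at this
  obtain ⟨i, hi⟩ := this
  refine ⟨i, ?_⟩
  rw [← act_act, ← hi, act_inv_act]

end LevelDecomposition

/-! ### Homogeneous curves -/

theorem IsHomogeneousCurve.act {H : Set Plane} (hH : IsHomogeneousCurve H) (A : GL (Fin 2) ℝ) :
    IsHomogeneousCurve (act A H) := by
  rintro _ ⟨p, hp, rfl⟩ _ ⟨q, hq, rfl⟩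
  obtain ⟨T, hT, hTp⟩ := hH p hp q hq
  refine ⟨A * T * A⁻¹, ?_, ?_⟩
  · rw [← act_act, ← act_act, act_inv_act, hT]
  · simp only [Units.val_mul, ← Matrix.mulVec_mulVec, inv_mulVec_mulVec, hTp]

/-- The only diagonal candidate taking `p` to `q` has the coordinate ratios as entries, and it
preserves the arc once it preserves the form. If the form is a single monomial this is automatic:
both points have value `1`, so the scaling factor of the monomial is `1`. -/
theorem isHomogeneousCurve_quad_of_invariant {a b c : ℝ}
    (h : ∀ p ∈ quad a b c, ∀ q ∈ quad a b c, ∀ l m : ℝ, 0 < l → 0 < m → l * p 0 = q 0 →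
      m * p 1 = q 1 → l ^ 3 * m * a = a ∧ (l * m) ^ 2 * b = b ∧ l * m ^ 3 * c = c) :
    IsHomogeneousCurve (quad a b c) := by
  intro p hp q hq
  have hl := div_pos hq.1.1 hp.1.1
  have hm := div_pos hq.1.2 hp.1.2
  have hl' := div_mul_cancel₀ (q 0) hp.1.1.ne'
  have hm' := div_mul_cancel₀ (q 1) hp.1.2.ne'
  refine ⟨diagGL _ _ hl hm, ?_, ?_⟩
  · obtain ⟨e1, e2, e3⟩ := h p hp q hq _ _ hl hm hl' hm'
    have := quad_eq_act_inv_diagGL hl hm a b c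
    rw [e1, e2, e3] at this
    conv_lhs => rw [this]
    rw [act_act_inv]
  · rw [diagGL_mulVec, hl', hm']
    ext i
    fin_cases i <;> rfl

theorem isHomogeneousCurve_quad_zero_b_zero (b : ℝ) : IsHomogeneousCurve (quad 0 b 0) := by
  refine isHomogeneousCurve_quad_of_invariant fun p hp q hq l m hl hm h0 h1 => ⟨by simp, ?_, by simp⟩
  have hp2 := hp.2
  have hq2 := hq.2
  rw [eval_quartic_of_zero] at hp2 hq2
  rw [← h0, ← h1] at hq2
  have h3 : (l * m) ^ 2 * (b * (p 0 * p 1) ^ 2) = 1 := by linear_combination hq2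
  have h4 : b * (p 0 * p 1) ^ 2 = 1 := by linear_combination hp2
  rw [h4, mul_one] at h3
  rw [h3, one_mul]

theorem isHomogeneousCurve_quad_a_zero_zero (a : ℝ) : IsHomogeneousCurve (quad a 0 0) := by
  refine isHomogeneousCurve_quad_of_invariant fun p hp q hq l m hl hm h0 h1 => ⟨?_, by simp, by simp⟩
  have hp2 := hp.2
  have hq2 := hq.2
  rw [eval_quartic_of_zero] at hp2 hq2
  rw [← h0, ← h1] at hq2
  have h3 : (l ^ 3 * m) * (a * (p 0 ^ 3 * p 1)) = 1 := by linear_combination hq2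
  have h4 : a * (p 0 ^ 3 * p 1) = 1 := by linear_combination hp2
  rw [h4, mul_one] at h3
  rw [h3, one_mul]

/-! ### Singularities at infinity -/

theorem cone_act (A : GL (Fin 2) ℝ) (H : Set Plane) : cone (act A H) = act A (cone H) := by
  ext q
  constructor
  · rintro ⟨r, hr, _, ⟨p, hp, rfl⟩, rfl⟩
    exact ⟨r • p, ⟨r, hr, p, hp, rfl⟩, Matrix.mulVec_smul _ _ _⟩
  · rintro ⟨_, ⟨r, hr, p, hp, rfl⟩, rfl⟩
    exact ⟨r, hr, _, ⟨p, hp, rfl⟩, Matrix.mulVec_smul _ _ _⟩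

theorem IsSingularAtInfinity.linSubst {h : MvPolynomial (Fin 2) ℝ} {H : Set Plane}
    (hH : IsSingularAtInfinity h H) (B : GL (Fin 2) ℝ) :
    IsSingularAtInfinity (linSubst B.val h) (QuarticGPSR.act B⁻¹ H) := by
  obtain ⟨p, hp, hp0, hev, hd⟩ := hH
  refine ⟨B⁻¹.val.mulVec p, ?_, ?_, ?_, ?_⟩
  · rw [cone_act, act_eq_image, ← (actHomeo B⁻¹).image_frontier]
    exact ⟨p, hp, rfl⟩
  · intro h0
    apply hp0
    rw [← mulVec_inv_mulVec B p, h0, Matrix.mulVec_zero]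
  · rw [eval_linSubst, mulVec_inv_mulVec, hev]
  · intro i
    simp only [pderiv_linSubst, map_sum, map_mul, eval_linSubst, mulVec_inv_mulVec, hd, mul_zero,
      Finset.sum_const_zero]

theorem isSingularAtInfinity_linSubst_iff {h : MvPolynomial (Fin 2) ℝ} {H : Set Plane}
    (B : GL (Fin 2) ℝ) :
    IsSingularAtInfinity (linSubst B.val h) (act B⁻¹ H) ↔ IsSingularAtInfinity h H := by
  refine ⟨fun hH => ?_, fun hH => hH.linSubst B⟩
  have := hH.linSubst B⁻¹
  rwa [linSubst_inv_linSubst, inv_inv, act_act_inv] at this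

theorem Admissible.cone_quad {a b c : ℝ} (H : Admissible a b c) : cone (quad a b c) = quadrant := by
  ext q
  constructor
  · rintro ⟨r, hr, p, hp, rfl⟩
    exact smul_mem_quadrant hr hp.1
  · intro hq
    obtain ⟨r, hr, hrq⟩ := H.exists_smul_mem_quad hq
    exact ⟨r⁻¹, inv_pos.2 hr, _, hrq, by rw [smul_smul, inv_mul_cancel₀ hr.ne', one_smul]⟩

/-- For `c = 0` the form is divisible by `x²`, so it is singular along the boundary ray through `(0,
1)`. -/
theorem Admissible.isSingularAtInfinity {a b c : ℝ} (H : Admissible a b c) (hc : c = 0) :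
    IsSingularAtInfinity (quartic 0 a b c 0) (quad a b c) := by
  refine ⟨![0, 1], ?_, ?_, ?_, ?_⟩
  · rw [H.cone_quad, isOpen_quadrant.frontier_eq]
    refine ⟨?_, fun h => by simpa using h.1⟩
    refine mem_closure_of_tendsto (f := fun t : ℝ => (![t, 1] : Plane))
      (b := nhdsWithin 0 (Set.Ioi 0)) ?_ ?_
    · refine Filter.Tendsto.mono_left (Continuous.tendsto' ?_ _ _ rfl) nhdsWithin_le_nhds
      refine continuous_pi fun i => ?_
      fin_cases i
      · exact continuous_id
      · exact continuous_const
    · filter_upwards [self_mem_nhdsWithin] with t ht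
      exact ⟨ht, by simp⟩
  · intro h
    simpa using congrFun h 1
  · simp [eval_quartic]
  · rw [Fin.forall_fin_two, eval_pderiv_zero_quartic, eval_pderiv_one_quartic]
    simp [hc]

/-- Boundary points lie on the axes. There the transversal partial derivative is `c y³` on `x = 0`
and `a x³` on `y = 0`, so it vanishes only at the origin. -/
theorem Admissible.not_isSingularAtInfinity {a b c : ℝ} (H : Admissible a b c) (ha : a ≠ 0)
    (hc : c ≠ 0) : ¬ IsSingularAtInfinity (quartic 0 a b c 0) (quad a b c) := by
  rintro ⟨p, hp, hp0, -, hd⟩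
  rw [H.cone_quad, isOpen_quadrant.frontier_eq] at hp
  obtain ⟨hp1, hp2⟩ := hp
  have hcl : closure quadrant ⊆ {p : Plane | 0 ≤ p 0} ∩ {p | 0 ≤ p 1} :=
    closure_minimal (fun p hp => ⟨hp.1.le, hp.2.le⟩)
      ((isClosed_le continuous_const (continuous_apply 0)).inter
        (isClosed_le continuous_const (continuous_apply 1)))
  obtain ⟨h0, h1⟩ := hcl hp1
  have hd0 := hd 0
  have hd1 := hd 1
  rw [eval_pderiv_zero_quartic] at hd0
  rw [eval_pderiv_one_quartic] at hd1
  apply hp0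
  have hz : p 0 = 0 ∨ p 1 = 0 := by
    by_contra! hne
    exact hp2 ⟨lt_of_le_of_ne h0 hne.1.symm, lt_of_le_of_ne h1 hne.2.symm⟩
  rcases hz with hz | hz
  · rw [hz] at hd0
    simp [hc] at hd0
    ext i
    fin_cases i
    exacts [hz, hd0]
  · rw [hz] at hd1
    simp [ha] at hd1
    ext i
    fin_cases i
    exacts [hd1, hz]

/-! ### Forms in standard position and their first automorphisms. -/

theorem stdPoly_eq_quartic (L K : ℝ) : stdPoly L K = quartic 1 0 (-1) L K := by
  apply MvPolynomial.funext
  intro p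
  simp only [stdPoly, eval_quartic, map_add, map_sub, map_mul, map_pow, eval_X, eval_C]
  ring

theorem eval_stdPoly (L K : ℝ) (p : Plane) : eval p (stdPoly L K) =
    p 0 ^ 4 - p 0 ^ 2 * p 1 ^ 2 + L * p 0 * p 1 ^ 3 + K * p 1 ^ 4 := by
  rw [stdPoly_eq_quartic, eval_quartic]; ring

/-- The element of `GL(2)` with the rows `(1, s)` and `(1, t)`. -/
noncomputable def rowsGL (s t : ℝ) (h : s ≠ t) : GL (Fin 2) ℝ :=
  Matrix.GeneralLinearGroup.mkOfDetNeZero !![1, s; 1, t] (by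
    rw [Matrix.det_fin_two_of, one_mul, mul_one]
    exact sub_ne_zero.2 h.symm)

theorem rowsGL_mulVec {s t : ℝ} (h : s ≠ t) (p : Plane) :
    (rowsGL s t h).val.mulVec p = ![p 0 + s * p 1, p 0 + t * p 1] := by
  show Matrix.mulVec !![1, s; 1, t] p = _
  rw [mulVec_fin_two, one_mul]

theorem neg_one_inv_mulVec (p : Plane) : (-1 : GL (Fin 2) ℝ)⁻¹.val.mulVec p = -p := by
  have : (-1 : GL (Fin 2) ℝ)⁻¹ = -1 := by
    rw [inv_eq_iff_mul_eq_one]; simp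
  rw [this, Units.val_neg, Units.val_one, Matrix.neg_mulVec, Matrix.one_mulVec]

theorem neg_one_mem_autGroup {h : MvPolynomial (Fin 2) ℝ} (hh : h.IsHomogeneous 4) :
    -1 ∈ autGroup h := by
  intro p
  rw [Units.val_neg, Units.val_one, Matrix.neg_mulVec, Matrix.one_mulVec, ← neg_one_smul ℝ p,
    eval_smul_of_isHomogeneous hh]
  norm_num

theorem isHomogeneous_stdPoly (L K : ℝ) : (stdPoly L K).IsHomogeneous 4 := by
  rw [stdPoly_eq_quartic]
  exact isHomogeneous_quartic _ _ _ _ _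

/-- The quarter turn as an element of `GL(2)`. -/
noncomputable def quarterTurnGL (c : ℝ) (hc : c ≠ 0) : GL (Fin 2) ℝ :=
  Matrix.GeneralLinearGroup.mkOfDetNeZero (quarterTurn c) (by
    rw [quarterTurn, Matrix.det_fin_two_of, neg_mul, mul_inv_cancel₀ hc]; norm_num)

theorem quarterTurnGL_mulVec {c : ℝ} (hc : c ≠ 0) (p : Plane) :
    (quarterTurnGL c hc).val.mulVec p = ![-(c * p 1), c⁻¹ * p 0] := by
  show Matrix.mulVec !![0, -c; c⁻¹, 0] p = _
  rw [mulVec_fin_two]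
  simp

theorem quarterTurnGL_sq {c : ℝ} (hc : c ≠ 0) : quarterTurnGL c hc ^ 2 = -1 := by
  apply Units.ext
  show (quarterTurn c) ^ 2 = -1
  rw [pow_two, quarterTurn]
  ext i j
  fin_cases i <;> fin_cases j <;> simp [hc]

theorem quarterTurnGL_pow_four {c : ℝ} (hc : c ≠ 0) : quarterTurnGL c hc ^ 4 = 1 := by
  rw [show 4 = 2 * 2 from rfl, pow_mul, quarterTurnGL_sq, neg_one_sq]

theorem quarterTurnGL_inv_mulVec {c : ℝ} (hc : c ≠ 0) (p : Plane) :
    (quarterTurnGL c hc)⁻¹.val.mulVec p = ![c * p 1, -(c⁻¹ * p 0)] := by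
  have h : (quarterTurnGL c hc)⁻¹ = -quarterTurnGL c hc := by
    rw [inv_eq_iff_mul_eq_one, mul_neg, ← pow_two, quarterTurnGL_sq, neg_neg]
  rw [h, Units.val_neg, Matrix.neg_mulVec, quarterTurnGL_mulVec]
  simp

/-! ### The forms `(x² - s² y²) (x² - (1 - s²) y²)` -/

theorem ne_neg_self_of_pos {s : ℝ} (hs : 0 < s) : s ≠ -s := by
  intro h; linarith

/-- In the coordinates `X = x + sy`, `Y = x - sy` the factor `x² - s²y²` is `XY`, and `x² - (1 - s²)
y²` is `((2s² - 1)(X² + Y²) + 2XY) / (4s²)`. -/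
theorem stdPoly_zero_eq_linSubst {s K : ℝ} (hs : 0 < s) (hK : K = s ^ 2 - s ^ 4) :
    stdPoly 0 K = linSubst (rowsGL s (-s) (ne_neg_self_of_pos hs)).val
      (quartic 0 ((2 * s ^ 2 - 1) / (4 * s ^ 2)) (1 / (2 * s ^ 2)) ((2 * s ^ 2 - 1) / (4 * s ^ 2))
        0) := by
  apply MvPolynomial.funext
  intro p
  rw [eval_linSubst, rowsGL_mulVec, eval_quartic, eval_stdPoly, hK]
  simp only [Matrix.cons_val_zero, Matrix.cons_val_one]
  field_simp
  ring

theorem admissible_of_half_le_sq {s : ℝ} (hs : 0 < s) (h : 1 / 2 ≤ s ^ 2) :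
    Admissible ((2 * s ^ 2 - 1) / (4 * s ^ 2)) (1 / (2 * s ^ 2))
      ((2 * s ^ 2 - 1) / (4 * s ^ 2)) := by
  have h1 : 0 ≤ (2 * s ^ 2 - 1) / (4 * s ^ 2) := div_nonneg (by linarith) (by positivity)
  have h2 : 0 < 1 / (2 * s ^ 2) := by positivity
  exact ⟨h1, h2.le, h1, Or.inl h2⟩

theorem eval_stdPoly_zero_factor {s K : ℝ} (hK : K = s ^ 2 - s ^ 4) (p : Plane) :
    eval p (stdPoly 0 K) = (p 0 ^ 2 - s ^ 2 * p 1 ^ 2) * (p 0 ^ 2 - (1 - s ^ 2) * p 1 ^ 2) := by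
  rw [eval_stdPoly, hK]; ring

theorem rowsGL_mulVec_mem_quadrant {s : ℝ} (hs : 0 < s) (p : Plane) :
    (rowsGL s (-s) (ne_neg_self_of_pos hs)).val.mulVec p ∈ quadrant ↔ s * |p 1| < p 0 := by
  rw [rowsGL_mulVec]
  simp only [quadrant, Set.mem_ofPred_eq, Matrix.cons_val_zero, Matrix.cons_val_one]
  have : s * |p 1| = |s * p 1| := by rw [abs_mul, abs_of_pos hs]
  rw [this, abs_lt]
  constructor
  · rintro ⟨h1, h2⟩; constructor <;> linarith
  · rintro ⟨h1, h2⟩; constructor <;> linarith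

theorem quarterTurnGL_mem_autGroup {c K : ℝ} (hc : c ≠ 0) (hK : K = c ^ 4) :
    quarterTurnGL c hc ∈ autGroup (stdPoly 0 K) := by
  intro p
  rw [quarterTurnGL_mulVec, eval_stdPoly, eval_stdPoly, hK]
  simp only [Matrix.cons_val_zero, Matrix.cons_val_one]
  field_simp
  ring

/-- Where the form is positive, the two quadratic factors are both positive (two arcs around the
`x`-axis) or both negative (two arcs around the `y`-axis). The quarter turn permutes the four
cyclically. The boundary value `s² = 1/2` is admitted, since it yields case a). -/
theorem levelDecomposition_quarterTurn {s c K : ℝ} (hs : 0 < s) (h : 1 / 2 ≤ s ^ 2) (hc : 0 < c)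
    (hK : K = s ^ 2 - s ^ 4) (hcK : K = c ^ 4) :
    LevelDecomposition (n := 3) (stdPoly 0 K) ((2 * s ^ 2 - 1) / (4 * s ^ 2)) (1 / (2 * s ^ 2))
      ((2 * s ^ 2 - 1) / (4 * s ^ 2)) (rowsGL s (-s) (ne_neg_self_of_pos hs))
      fun i => quarterTurnGL c hc.ne' ^ (i : ℕ) := by
  have hinv : ∀ p : Plane, ∀ i : Fin 4, (rowsGL s (-s) (ne_neg_self_of_pos hs)).val.mulVec
      ((quarterTurnGL c hc.ne' ^ (i : ℕ))⁻¹.val.mulVec p) ∈ quadrant ↔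
      ![s * |p 1| < p 0, s * |p 0| < c ^ 2 * p 1, s * |p 1| < -p 0, s * |p 0| < -(c ^ 2 * p 1)] i := by
    intro p i
    rw [rowsGL_mulVec_mem_quadrant hs]
    have hcc : ∀ x y : ℝ, s * |-(c⁻¹ * x)| < y * c ↔ s * |x| < c ^ 2 * y := by
      intro x y
      rw [abs_neg, abs_mul, abs_of_pos (inv_pos.2 hc)]
      have : s * (c⁻¹ * |x|) = (s * |x|) / c := by field_simp
      rw [this, div_lt_iff₀ hc]
      ring_nf
    have h2 : ((quarterTurnGL c hc.ne') ^ 2)⁻¹.val.mulVec p = -p := by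
      rw [quarterTurnGL_sq, neg_one_inv_mulVec]
    have h3 : ((quarterTurnGL c hc.ne') ^ 3)⁻¹.val.mulVec p = -![c * p 1, -(c⁻¹ * p 0)] := by
      rw [pow_succ, quarterTurnGL_sq, mul_inv_rev, Units.val_mul, ← Matrix.mulVec_mulVec,
        neg_one_inv_mulVec, Matrix.mulVec_neg, quarterTurnGL_inv_mulVec]
    fin_cases i
    · simp
    · simp only [Fin.mk_one, Fin.isValue, pow_one, quarterTurnGL_inv_mulVec,
        Matrix.cons_val_one, Matrix.cons_val_zero]
      rw [mul_comm c, hcc]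
    · show s * |((quarterTurnGL c hc.ne' ^ 2)⁻¹.val.mulVec p) 1| <
        ((quarterTurnGL c hc.ne' ^ 2)⁻¹.val.mulVec p) 0 ↔ _
      rw [h2]
      simp
    · show s * |((quarterTurnGL c hc.ne' ^ 3)⁻¹.val.mulVec p) 1| <
        ((quarterTurnGL c hc.ne' ^ 3)⁻¹.val.mulVec p) 0 ↔ s * |p 0| < -(c ^ 2 * p 1)
      rw [h3]
      have := hcc (p 0) (-p 1)
      simp only [Pi.neg_apply, Matrix.cons_val_zero, Matrix.cons_val_one, abs_neg] at this ⊢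
      rw [show -(c * p 1) = -p 1 * c by ring, this, mul_neg]
  -- From `c⁴ = s²(1 - s²)` and `s² ≥ 1/2`; this keeps the arcs around the two axes disjoint.
  have hcs : c ^ 2 ≤ s ^ 2 := by
    have : c ^ 4 ≤ s ^ 4 := by nlinarith
    nlinarith [sq_nonneg (c ^ 2 - s ^ 2), sq_nonneg c, sq_nonneg s]
  refine ⟨stdPoly_zero_eq_linSubst hs hK, admissible_of_half_le_sq hs h,
    fun i => pow_mem (quarterTurnGL_mem_autGroup hc.ne' hcK) _, ?_, ?_, pow_zero _, ?_, ?_⟩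
  · intro p hp
    simp only [hinv]
    rw [eval_stdPoly_zero_factor hK] at hp
    by_cases hlt : s ^ 2 * p 1 ^ 2 < p 0 ^ 2
    · have h1 : s * |p 1| < |p 0| := by
        refine lt_of_pow_lt_pow_left₀ 2 (abs_nonneg _) ?_
        rw [mul_pow, sq_abs, sq_abs]; exact hlt
      rcases le_total 0 (p 0) with h0 | h0
      · exact ⟨0, by rw [abs_of_nonneg h0] at h1; exact h1⟩
      · exact ⟨2, by rw [abs_of_nonpos h0] at h1; exact h1⟩
    -- The first factor is not positive but the product is `1`, so the second factor must be
    -- negative.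
    · have hlt2 : p 0 ^ 2 < (1 - s ^ 2) * p 1 ^ 2 := by
        by_contra! hge
        nlinarith [mul_nonneg (sub_nonneg.2 (not_lt.1 hlt)) (sub_nonneg.2 hge)]
      have h1 : s * |p 0| < c ^ 2 * |p 1| := by
        refine lt_of_pow_lt_pow_left₀ 2 (by positivity) ?_
        rw [mul_pow, mul_pow, sq_abs, sq_abs, ← pow_mul, ← hcK, hK]
        nlinarith [mul_lt_mul_of_pos_left hlt2 (pow_pos hs 2)]
      rcases le_total 0 (p 1) with h0 | h0
      · exact ⟨1, by rw [abs_of_nonneg h0] at h1; exact h1⟩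
      · exact ⟨3, by rw [abs_of_nonpos h0, mul_neg] at h1; exact h1⟩
  · intro p
    simp only [hinv]
    have hexcl : s * |p 1| < |p 0| → s * |p 0| < c ^ 2 * |p 1| → False := by
      intro h1 h2
      have h3 := mul_lt_mul_of_pos_left h1 hs
      have h4 := mul_le_mul_of_nonneg_right hcs (abs_nonneg (p 1))
      nlinarith
    have n0 := abs_nonneg (p 0)
    have n1 := abs_nonneg (p 1)
    have sn0 := mul_nonneg hs.le n0
    have sn1 := mul_nonneg hs.le n1
    have l0 := le_abs_self (p 0)
    have l0' := neg_le_abs (p 0)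
    have l1 := mul_le_mul_of_nonneg_left (le_abs_self (p 1)) (sq_nonneg c)
    have l1' := mul_le_mul_of_nonneg_left (neg_le_abs (p 1)) (sq_nonneg c)
    intro i j hi hj
    fin_cases i <;> fin_cases j <;> first
      | rfl
      | (exfalso
         simp at hi hj
         first
          | linarith
          | exact hexcl (by linarith) (by linarith))
  · rw [rowsGL_mulVec_mem_quadrant hs]; simp
  · simp [eval_stdPoly]

/-- For `s ≥ 1` the factor `x² - (1 - s²) y²` is never negative, so `h = 1` forces `x² > s²y²`,
which leaves two opposite arcs. -/
theorem levelDecomposition_neg {s K : ℝ} (hs : 1 ≤ s) (hK : K = s ^ 2 - s ^ 4) :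
    LevelDecomposition (n := 1) (stdPoly 0 K) ((2 * s ^ 2 - 1) / (4 * s ^ 2)) (1 / (2 * s ^ 2))
      ((2 * s ^ 2 - 1) / (4 * s ^ 2)) (rowsGL s (-s) (ne_neg_self_of_pos (one_pos.trans_le hs)))
      ![1, -1] := by
  have hs0 : 0 < s := one_pos.trans_le hs
  have hinv : ∀ p : Plane, ∀ i : Fin 2, (rowsGL s (-s) (ne_neg_self_of_pos hs0)).val.mulVec
      (((![1, -1] : Fin 2 → GL (Fin 2) ℝ) i)⁻¹.val.mulVec p) ∈ quadrant ↔
      ![s * |p 1| < p 0, s * |p 1| < -p 0] i := by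
    intro p i
    rw [rowsGL_mulVec_mem_quadrant hs0]
    fin_cases i
    · simp
    · show s * |((-1 : GL (Fin 2) ℝ)⁻¹.val.mulVec p) 1| < ((-1 : GL (Fin 2) ℝ)⁻¹.val.mulVec p) 0 ↔ _
      rw [neg_one_inv_mulVec]
      simp
  refine ⟨stdPoly_zero_eq_linSubst hs0 hK, admissible_of_half_le_sq hs0 (by nlinarith), ?_, ?_, ?_,
    rfl, ?_, ?_⟩
  · exact Fin.forall_fin_two.2 ⟨one_mem _, neg_one_mem_autGroup (isHomogeneous_stdPoly _ _)⟩
  · intro p hp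
    simp only [hinv]
    rw [eval_stdPoly_zero_factor hK] at hp
    have h2 : 0 ≤ p 0 ^ 2 - (1 - s ^ 2) * p 1 ^ 2 := by
      nlinarith [sq_nonneg (p 0), mul_nonneg (show 0 ≤ s ^ 2 - 1 by nlinarith) (sq_nonneg (p 1))]
    have h3 : 0 < p 0 ^ 2 - s ^ 2 * p 1 ^ 2 := by
      by_contra! hle
      nlinarith
    have h1 : s * |p 1| < |p 0| := by
      refine lt_of_pow_lt_pow_left₀ 2 (abs_nonneg _) ?_
      rw [mul_pow, sq_abs, sq_abs]; linarith
    rcases le_total 0 (p 0) with h0 | h0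
    · exact ⟨0, by rw [abs_of_nonneg h0] at h1; exact h1⟩
    · exact ⟨1, by rw [abs_of_nonpos h0] at h1; exact h1⟩
  · intro p
    simp only [hinv]
    have sn1 := mul_nonneg hs0.le (abs_nonneg (p 1))
    intro i j hi hj
    fin_cases i <;> fin_cases j <;> first
      | rfl
      | (exfalso
         simp at hi hj
         linarith)
  · rw [rowsGL_mulVec_mem_quadrant hs0]; simp
  · simp [eval_stdPoly]

/-! ### The form with a triple root -/

theorem sqrt_six_eq : √6 = √2 * √3 := by
  rw [← Real.sqrt_mul (by norm_num)]; norm_num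

theorem rows_b_ne : -(1 / √6) ≠ √3 / √2 := by
  have h1 : 0 < 1 / √6 := by positivity
  have h2 : 0 < √3 / √2 := by positivity
  intro h
  linarith

/-- With `u = 1/√6` the form is `(x - uy)³ (x + 3uy)`: the roots `u` (triple) and `-3u` sum to zero,
which removes the `x³y` term, and `6u² = 1` normalises the `x²y²` term. -/
theorem stdPoly_b_eq_linSubst :
    stdPoly Lb (-1 / 12) = linSubst (rowsGL (-(1 / √6)) (√3 / √2) rows_b_ne).val
      (quartic 0 1 0 0 0) := by
  apply MvPolynomial.funext
  intro p
  rw [eval_linSubst, rowsGL_mulVec, eval_quartic, eval_stdPoly, sqrt_six_eq, Lb]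
  simp only [Matrix.cons_val_zero, Matrix.cons_val_one]
  have h2 : √2 ^ 2 = 2 := Real.sq_sqrt (by norm_num)
  have h3 : √3 ^ 2 = 3 := Real.sq_sqrt (by norm_num)
  -- Both surds and `Lb` are polynomials in `u`, so only `u² = 1/6` is needed in the end.
  set u : ℝ := 1 / (√2 * √3) with hu
  have hu2 : u ^ 2 = 1 / 6 := by rw [hu, div_pow, mul_pow, h2, h3]; norm_num
  have h1 : √3 / √2 = 3 * u := by
    rw [hu]; field_simp; rw [h3]
  have h4 : 2 * √2 / (3 * √3) = 8 * u ^ 3 := by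
    rw [show u ^ 3 = u ^ 2 * u by ring, hu2, hu]; field_simp; rw [h2]; norm_num
  rw [h1, h4]
  linear_combination (6 * p 0 ^ 2 * p 1 ^ 2 + 3 * p 1 ^ 4 * (u ^ 2 + 1 / 6)) * hu2

theorem admissible_one_zero_zero : Admissible 1 0 0 :=
  ⟨zero_le_one, le_rfl, le_rfl, Or.inr ⟨one_pos, rfl⟩⟩

theorem levelDecomposition_b :
    LevelDecomposition (n := 1) (stdPoly Lb (-1 / 12)) 1 0 0
      (rowsGL (-(1 / √6)) (√3 / √2) rows_b_ne) ![1, -1] := by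
  have hinv : ∀ p : Plane, ∀ i : Fin 2, (rowsGL (-(1 / √6)) (√3 / √2) rows_b_ne).val.mulVec
      (((![1, -1] : Fin 2 → GL (Fin 2) ℝ) i)⁻¹.val.mulVec p) ∈ quadrant ↔
      ![(rowsGL (-(1 / √6)) (√3 / √2) rows_b_ne).val.mulVec p ∈ quadrant,
        -(rowsGL (-(1 / √6)) (√3 / √2) rows_b_ne).val.mulVec p ∈ quadrant] i := by
    intro p i
    fin_cases i
    · simp
    · show (rowsGL (-(1 / √6)) (√3 / √2) rows_b_ne).val.mulVec
        ((-1 : GL (Fin 2) ℝ)⁻¹.val.mulVec p) ∈ quadrant ↔ _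
      rw [neg_one_inv_mulVec, Matrix.mulVec_neg]
      rfl
  refine ⟨stdPoly_b_eq_linSubst, admissible_one_zero_zero, ?_, ?_, ?_, rfl, ?_, ?_⟩
  · exact Fin.forall_fin_two.2 ⟨one_mem _, neg_one_mem_autGroup (isHomogeneous_stdPoly _ _)⟩
  · intro p hp
    simp only [hinv]
    rw [stdPoly_b_eq_linSubst, eval_linSubst, eval_quartic_of_zero] at hp
    generalize (rowsGL (-(1 / √6)) (√3 / √2) rows_b_ne).val.mulVec p = q at hp ⊢
    have hpos : 0 < q 0 * q 1 := by
      by_contra! hle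
      have := sq_nonneg (q 0)
      nlinarith
    rcases mul_pos_iff.1 hpos with h | h
    · exact ⟨0, h⟩
    · exact ⟨1, neg_pos.2 h.1, neg_pos.2 h.2⟩
  · intro p
    simp only [hinv]
    generalize (rowsGL (-(1 / √6)) (√3 / √2) rows_b_ne).val.mulVec p = q
    intro i j hi hj
    fin_cases i <;> fin_cases j <;> first
      | rfl
      | (exfalso
         simp [quadrant] at hi hj
         linarith [hi.1, hj.1])
  · rw [rowsGL_mulVec]; simp [quadrant]
  · simp [eval_stdPoly]

/-! ### The form with a double root at one end of the arc -/

theorem rows_c_ne : -(1 / √3) ≠ 2 / √3 := by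
  have h1 : 0 < 1 / √3 := by positivity
  have h2 : 0 < 2 / √3 := by positivity
  intro h
  linarith

/-- With `u = 1/√3`, `X = x - uy` and `Y = x + 2uy` one has `2X + Y = 3x`, and the form is `X² Y (2X
+ Y) / 3 = x (x - uy)² (x + 2uy)`. -/
theorem stdPoly_c_eq_linSubst :
    stdPoly Lc 0 = linSubst (rowsGL (-(1 / √3)) (2 / √3) rows_c_ne).val
      (quartic 0 (2 / 3) (1 / 3) 0 0) := by
  apply MvPolynomial.funext
  intro p
  rw [eval_linSubst, rowsGL_mulVec, eval_quartic, eval_stdPoly, Lc]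
  simp only [Matrix.cons_val_zero, Matrix.cons_val_one]
  have h3 : √3 ^ 2 = 3 := Real.sq_sqrt (by norm_num)
  set u : ℝ := 1 / √3 with hu
  have hu2 : u ^ 2 = 1 / 3 := by rw [hu, div_pow, h3]; norm_num
  have h1 : 2 / √3 = 2 * u := by rw [hu]; ring
  have h4 : 2 / (3 * √3) = 2 * u ^ 3 := by
    rw [show u ^ 3 = u ^ 2 * u by ring, hu2, hu]; field_simp
  rw [h1, h4]
  linear_combination (3 * p 0 ^ 2 * p 1 ^ 2) * hu2

theorem admissible_c : Admissible (2 / 3) (1 / 3) 0 :=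
  ⟨by norm_num, by norm_num, le_rfl, Or.inl (by norm_num)⟩

/-- The involution `(X, Y) ↦ (X, -2 X - Y)` in the eigencoordinates of the form with a double
root. -/
noncomputable def flipC : GL (Fin 2) ℝ :=
  (rowsGL (-(1 / √3)) (2 / √3) rows_c_ne)⁻¹ *
    Matrix.GeneralLinearGroup.mkOfDetNeZero !![1, 0; -2, -1] (by simp) *
    rowsGL (-(1 / √3)) (2 / √3) rows_c_ne

theorem rowsGL_mulVec_flipC (p : Plane) :
    (rowsGL (-(1 / √3)) (2 / √3) rows_c_ne).val.mulVec (flipC.val.mulVec p) =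
      ![(rowsGL (-(1 / √3)) (2 / √3) rows_c_ne).val.mulVec p 0,
        -2 * (rowsGL (-(1 / √3)) (2 / √3) rows_c_ne).val.mulVec p 0 -
          (rowsGL (-(1 / √3)) (2 / √3) rows_c_ne).val.mulVec p 1] := by
  rw [flipC, Units.val_mul, Units.val_mul, ← Matrix.mulVec_mulVec, ← Matrix.mulVec_mulVec,
    mulVec_inv_mulVec]
  generalize (rowsGL (-(1 / √3)) (2 / √3) rows_c_ne).val.mulVec p = q
  show Matrix.mulVec !![1, 0; -2, -1] q = _
  rw [mulVec_fin_two]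
  ext i
  fin_cases i <;> simp
  ring

theorem flipC_mul_self : flipC * flipC = 1 := by
  have h : ∀ T : GL (Fin 2) ℝ, T * T = 1 → ∀ B : GL (Fin 2) ℝ,
      (B⁻¹ * T * B) * (B⁻¹ * T * B) = 1 := by
    intro T hT B
    calc _ = B⁻¹ * (T * T) * B := by group
      _ = 1 := by rw [hT]; group
  refine h _ (Units.ext ?_) _
  show (!![1, 0; -2, -1] * !![1, 0; -2, -1] : Matrix (Fin 2) (Fin 2) ℝ) = 1
  ext i j
  fin_cases i <;> fin_cases j <;> simp

theorem flipC_inv : flipC⁻¹ = flipC := inv_eq_of_mul_eq_one_left flipC_mul_self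

theorem flipC_mem_autGroup : flipC ∈ autGroup (stdPoly Lc 0) := by
  intro p
  rw [stdPoly_c_eq_linSubst, eval_linSubst, eval_linSubst, rowsGL_mulVec_flipC, eval_quartic,
    eval_quartic]
  simp only [Matrix.cons_val_zero, Matrix.cons_val_one]
  ring

/-- In the coordinates `X`, `Y` the form is `X² Y (2X + Y) / 3`, so the level set lies in `X ≠ 0`,
`Y (2X + Y) > 0`. These are four sectors, told apart by the signs of `X` and `Y`; `flipC` exchanges
`Y` and `-(2X + Y)` and, together with `-1`, permutes the sectors. -/
theorem levelDecomposition_c :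
    LevelDecomposition (n := 3) (stdPoly Lc 0) (2 / 3) (1 / 3) 0
      (rowsGL (-(1 / √3)) (2 / √3) rows_c_ne) ![1, -1, flipC, -flipC] := by
  have hinv : ∀ p : Plane, ∀ i : Fin 4, (rowsGL (-(1 / √3)) (2 / √3) rows_c_ne).val.mulVec
      (((![1, -1, flipC, -flipC] : Fin 4 → GL (Fin 2) ℝ) i)⁻¹.val.mulVec p) =
      (fun q : Plane => ![q, -q, ![q 0, -2 * q 0 - q 1], -![q 0, -2 * q 0 - q 1]] i)
        ((rowsGL (-(1 / √3)) (2 / √3) rows_c_ne).val.mulVec p) := by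
    intro p i
    fin_cases i
    · simp
    · show (rowsGL (-(1 / √3)) (2 / √3) rows_c_ne).val.mulVec
        ((-1 : GL (Fin 2) ℝ)⁻¹.val.mulVec p) = _
      rw [neg_one_inv_mulVec, Matrix.mulVec_neg]
      rfl
    · show (rowsGL (-(1 / √3)) (2 / √3) rows_c_ne).val.mulVec (flipC⁻¹.val.mulVec p) = _
      rw [flipC_inv, rowsGL_mulVec_flipC]
      rfl
    · show (rowsGL (-(1 / √3)) (2 / √3) rows_c_ne).val.mulVec ((-flipC)⁻¹.val.mulVec p) = _
      have h : (-flipC)⁻¹ = -flipC := by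
        rw [inv_eq_iff_mul_eq_one, neg_mul_neg, flipC_mul_self]
      rw [h, Units.val_neg, Matrix.neg_mulVec, Matrix.mulVec_neg, rowsGL_mulVec_flipC]
      rfl
  refine ⟨stdPoly_c_eq_linSubst, admissible_c, ?_, ?_, ?_, rfl, ?_, ?_⟩
  · have hneg : -1 ∈ autGroup (stdPoly Lc 0) := neg_one_mem_autGroup (isHomogeneous_stdPoly _ _)
    intro i
    fin_cases i
    · exact one_mem _
    · exact hneg
    · exact flipC_mem_autGroup
    · have := mul_mem hneg flipC_mem_autGroup
      rwa [neg_one_mul] at this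
  · intro p hp
    simp only [hinv]
    rw [stdPoly_c_eq_linSubst, eval_linSubst, eval_quartic_of_zero] at hp
    generalize (rowsGL (-(1 / √3)) (2 / √3) rows_c_ne).val.mulVec p = q at hp ⊢
    have h0 : q 0 ≠ 0 := fun h => by rw [h] at hp; simp at hp
    have hpos : 0 < q 1 * (2 * q 0 + q 1) := by
      by_contra! hle
      have := sq_nonneg (q 0)
      nlinarith
    rcases mul_pos_iff.1 hpos with h | h <;> rcases h0.lt_or_gt with h' | h'
    · exact ⟨3, by simp [quadrant]; constructor <;> linarith [h.2]⟩
    · exact ⟨0, h', h.1⟩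
    · exact ⟨1, by simp [quadrant]; constructor <;> linarith [h.1]⟩
    · exact ⟨2, by simp [quadrant]; constructor <;> linarith [h.2]⟩
  · intro p
    simp only [hinv]
    generalize (rowsGL (-(1 / √3)) (2 / √3) rows_c_ne).val.mulVec p = q
    intro i j hi hj
    fin_cases i <;> fin_cases j <;> first
      | rfl
      | (exfalso
         simp [quadrant] at hi hj
         linarith [hi.1, hj.1, hi.2, hj.2])
  · rw [rowsGL_mulVec]; simp [quadrant]
  · simp [eval_stdPoly]

/-! ### Homomorphisms from dihedral and cyclic groups -/

/-- The homomorphism from the dihedral group of order `2 n` given by a rotation and a reflection. -/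
def dihedralHom {G : Type*} [Group G] {n : ℕ} [NeZero n] (R s : G) (hR : R ^ n = 1)
    (hs : s * s = 1) (hsR : s * R * s = R⁻¹) : DihedralGroup n →* G :=
  have hadd : ∀ i j : ZMod n, R ^ (i + j).val = R ^ i.val * R ^ j.val := fun i j => by
    rw [ZMod.val_add, ← pow_add, ← pow_eq_pow_mod _ hR]
  have hsub : ∀ i j : ZMod n, R ^ (j - i).val = (R ^ i.val)⁻¹ * R ^ j.val := fun i j => by
    rw [eq_inv_mul_iff_mul_eq, ← hadd, add_sub_cancel]
  have hconj : ∀ k : ℕ, s * R ^ k = (R ^ k)⁻¹ * s := fun k => by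
    have h1 : SemiconjBy s R R⁻¹ := by
      rw [SemiconjBy, ← hsR, mul_assoc (s * R), hs, mul_one]
    have := h1.pow_right k
    rwa [SemiconjBy, inv_pow] at this
  have hconj' : ∀ k : ℕ, R ^ k * s = s * (R ^ k)⁻¹ := fun k => by
    rw [eq_mul_inv_iff_mul_eq, mul_assoc, hconj, mul_inv_cancel_left]
  { toFun := fun g => match g with
      | DihedralGroup.r i => R ^ i.val
      | DihedralGroup.sr i => s * R ^ i.val
    map_one' := by
      show R ^ (0 : ZMod n).val = 1
      rw [ZMod.val_zero, pow_zero]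
    map_mul' := fun a b => by
      rcases a with i | i <;> rcases b with j | j
      · exact hadd i j
      · show s * R ^ (j - i).val = R ^ i.val * (s * R ^ j.val)
        rw [hsub, ← mul_assoc, ← mul_assoc, hconj']
      · show s * R ^ (i + j).val = s * R ^ i.val * R ^ j.val
        rw [hadd, mul_assoc]
      · show R ^ (j - i).val = s * R ^ i.val * (s * R ^ j.val)
        rw [hsub, hconj, mul_assoc, ← mul_assoc s s, hs, one_mul] }

theorem dihedralGroup_induction {n : ℕ} [NeZero n] {p : DihedralGroup n → Prop} (one : p 1)
    (mul : ∀ a b, p a → p b → p (a * b)) (r : p (DihedralGroup.r 1)) (sr : p (DihedralGroup.sr 0))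
    (g : DihedralGroup n) : p g := by
  have hpow : ∀ k : ℕ, p (DihedralGroup.r 1 ^ k) := by
    intro k
    induction k with
    | zero => simpa using one
    | succ k ih => rw [pow_succ]; exact mul _ _ ih r
  have hr : ∀ i : ZMod n, p (DihedralGroup.r i) := by
    intro i
    have := hpow i.val
    rwa [DihedralGroup.r_one_pow, ZMod.natCast_zmod_val] at this
  rcases g with i | i
  · exact hr i
  · have := mul _ _ sr (hr i)
    rwa [DihedralGroup.sr_mul_r, zero_add] at this

/-- The homomorphism from the group of order two given by an involution. -/
def involutionHom {G : Type*} [Group G] (s : G) (hs : s * s = 1) :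
    Multiplicative (ZMod 2) →* G where
  toFun a := s ^ a.toAdd.val
  map_one' := by simp
  map_mul' a b := by
    rw [toAdd_mul, ZMod.val_add, ← pow_add, ← pow_eq_pow_mod _ (by rw [pow_two, hs])]

theorem involutionHom_ofAdd_one {G : Type*} [Group G] (s : G) (hs : s * s = 1) :
    involutionHom s hs (Multiplicative.ofAdd 1) = s := pow_one s

theorem forall_multiplicative_zmod_two {p : Multiplicative (ZMod 2) → Prop} (h0 : p 1)
    (h1 : p (Multiplicative.ofAdd 1)) (a : Multiplicative (ZMod 2)) : p a := by
  have : ∀ b : ZMod 2, b = 0 ∨ b = 1 := by decide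
  rcases this a.toAdd with h | h
  · have h' : a = 1 := h
    rwa [h']
  · have h' : a = Multiplicative.ofAdd 1 := h
    rwa [h']

theorem exists_mulEquiv_autGroup {G : Type*} [Group G] {h : MvPolynomial (Fin 2) ℝ}
    (F : G →* GL (Fin 2) ℝ) (hmem : ∀ g, F g ∈ autGroup h) (hker : ∀ g, F g = 1 → g = 1)
    (hsurj : ∀ A ∈ autGroup h, ∃ g, F g = A) :
    ∃ e : G ≃* autGroup h, ∀ g, (e g : GL (Fin 2) ℝ) = F g := by
  refine ⟨MulEquiv.ofBijective (F.codRestrict _ hmem) ⟨?_, ?_⟩, fun g => rfl⟩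
  · rw [injective_iff_map_eq_one]
    intro g hg
    exact hker g (congrArg Subtype.val hg)
  · rintro ⟨A, hA⟩
    obtain ⟨g, hg⟩ := hsurj A hA
    exact ⟨g, Subtype.ext hg⟩

/-! ### Stabilisers of arcs -/

/-- Identifies a stabiliser element from its monomial conjugate without computing `B⁻¹`. -/
theorem eq_of_conj_val_eq {B S T : GL (Fin 2) ℝ} {M : Matrix (Fin 2) (Fin 2) ℝ}
    (hS : (B * S * B⁻¹).val = M) (hT : B.val * T.val = M * B.val) : S = T := by
  have h : B * S = B * T := by
    apply Units.ext
    rw [Units.val_mul B T, hT, ← hS, ← Units.val_mul]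
    group
  exact mul_left_cancel h

theorem LevelDecomposition.exists_eq_mul_monomial {h : MvPolynomial (Fin 2) ℝ} {a b c : ℝ}
    {B : GL (Fin 2) ℝ} {n : ℕ} {g : Fin (n + 1) → GL (Fin 2) ℝ}
    (D : LevelDecomposition h a b c B g) {A : GL (Fin 2) ℝ} (hA : A ∈ autGroup h) :
    ∃ i S, A = g i * S ∧ ∃ l m : ℝ, 0 < l ∧ 0 < m ∧
      (((B * S * B⁻¹).val = !![l, 0; 0, m] ∧ a = l ^ 3 * m * a ∧ b = (l * m) ^ 2 * b ∧
        c = l * m ^ 3 * c) ∨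
      ((B * S * B⁻¹).val = !![0, l; m, 0] ∧ a = l * m ^ 3 * c ∧ b = (l * m) ^ 2 * b ∧
        c = l ^ 3 * m * a)) := by
  obtain ⟨i, hi⟩ := D.exists_eq_mul hA
  exact ⟨i, (g i)⁻¹ * A, (mul_inv_cancel_left _ _).symm,
    monomial_of_act_quad D.admissible D.admissible (act_conj hi)⟩

theorem eq_one_of_scale {l m : ℝ} (hl : 0 < l) (hm : 0 < m) (h1 : l ^ 3 * m = 1)
    (h2 : l * m ^ 3 = 1) : l = 1 ∧ m = 1 := by
  have h3 : (l * m) ^ 4 = 1 := by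
    calc (l * m) ^ 4 = (l ^ 3 * m) * (l * m ^ 3) := by ring
      _ = 1 := by rw [h1, h2, one_mul]
  have h4 : l * m = 1 := (pow_eq_one_iff_of_nonneg (by positivity) (by norm_num)).1 h3
  have h5 : l ^ 2 = 1 := by
    calc l ^ 2 = l ^ 2 * (l * m) := by rw [h4, mul_one]
      _ = l ^ 3 * m := by ring
      _ = 1 := h1
  have h6 : l = 1 := (pow_eq_one_iff_of_nonneg hl.le (by norm_num)).1 h5
  exact ⟨h6, by rwa [h6, one_mul] at h4⟩

/-! ### One-parameter groups -/

/-- The one-parameter group of diagonal matrices with entries `exp (α t)` and `exp (β t)`. -/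
noncomputable def expDiagHom (α β : ℝ) : Multiplicative ℝ →* GL (Fin 2) ℝ where
  toFun t := diagGL (Real.exp (α * t.toAdd)) (Real.exp (β * t.toAdd)) (Real.exp_pos _)
    (Real.exp_pos _)
  map_one' := by
    apply Units.ext
    show !![_, 0; 0, _] = (1 : Matrix (Fin 2) (Fin 2) ℝ)
    ext i j
    fin_cases i <;> fin_cases j <;> simp
  map_mul' s t := by
    apply Units.ext
    show !![_, 0; 0, _] = (!![_, 0; 0, _] * !![_, 0; 0, _] : Matrix (Fin 2) (Fin 2) ℝ)
    ext i j
    fin_cases i <;> fin_cases j <;> simp [mul_add, Real.exp_add]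

/-- The conjugate by `B` of a one-parameter group of diagonal matrices. -/
noncomputable def flowHom (B : GL (Fin 2) ℝ) (α β : ℝ) : Multiplicative ℝ →* GL (Fin 2) ℝ :=
  (MulAut.conj B⁻¹).toMonoidHom.comp (expDiagHom α β)

theorem flowHom_apply (B : GL (Fin 2) ℝ) (α β t : ℝ) :
    flowHom B α β (Multiplicative.ofAdd t) = B⁻¹ *
      diagGL (Real.exp (α * t)) (Real.exp (β * t)) (Real.exp_pos _) (Real.exp_pos _) * B := by
  show B⁻¹ * _ * B⁻¹⁻¹ = _
  rw [inv_inv]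
  rfl

theorem flowHom_eq_of_mul_eq {B : GL (Fin 2) ℝ} {α β t : ℝ} {M : Matrix (Fin 2) (Fin 2) ℝ}
    (hM : B.val * M = !![Real.exp (α * t), 0; 0, Real.exp (β * t)] * B.val) :
    (flowHom B α β (Multiplicative.ofAdd t)).val = M := by
  rw [flowHom_apply, Units.val_mul, Units.val_mul, Matrix.mul_assoc]
  show B⁻¹.val * (!![Real.exp (α * t), 0; 0, Real.exp (β * t)] * B.val) = M
  rw [← hM, ← Matrix.mul_assoc, ← Units.val_mul, inv_mul_cancel, Units.val_one, Matrix.one_mul]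

/-- The condition on the exponents is imposed only when the coefficient `x` is non-zero, so that one
statement serves forms with some vanishing coefficients. -/
theorem exp_scale {α β t x : ℝ} {k j : ℕ} (h : x ≠ 0 → k * α + j * β = 0) :
    Real.exp (α * t) ^ k * Real.exp (β * t) ^ j * x = x := by
  rcases eq_or_ne x 0 with rfl | hx
  · simp
  · rw [← Real.exp_nat_mul, ← Real.exp_nat_mul, ← Real.exp_add,
      show (k : ℝ) * (α * t) + j * (β * t) = (k * α + j * β) * t by ring, h hx, zero_mul,
      Real.exp_zero, one_mul]

theorem act_flowHom {a b c α β : ℝ} (ha : a ≠ 0 → 3 * α + β = 0) (hb : b ≠ 0 → α + β = 0)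
    (hc : c ≠ 0 → α + 3 * β = 0) (B : GL (Fin 2) ℝ) (t : ℝ) :
    act (flowHom B α β (Multiplicative.ofAdd t)) (act B⁻¹ (quad a b c)) =
      act B⁻¹ (quad a b c) := by
  have := quad_eq_act_inv_diagGL (Real.exp_pos (α * t)) (Real.exp_pos (β * t)) a b c
  have e1 := exp_scale (α := α) (β := β) (t := t) (x := a) (k := 3) (j := 1)
    fun h => by have := ha h; push_cast; linarith
  have e2 := exp_scale (α := α) (β := β) (t := t) (x := b) (k := 2) (j := 2)
    fun h => by have := hb h; push_cast; linarith
  have e3 := exp_scale (α := α) (β := β) (t := t) (x := c) (k := 1) (j := 3)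
    fun h => by have := hc h; push_cast; linarith
  rw [pow_one] at e1 e3
  rw [e1, mul_pow, e2, e3] at this
  rw [flowHom_apply, act_act, mul_assoc, mul_inv_cancel, mul_one, ← act_act]
  conv_lhs => rw [this]
  rw [act_act_inv]

theorem flowHom_mem_autGroup {h : MvPolynomial (Fin 2) ℝ} {a b c α β : ℝ}
    (ha : a ≠ 0 → 3 * α + β = 0) (hb : b ≠ 0 → α + β = 0)
    (hc : c ≠ 0 → α + 3 * β = 0) {B : GL (Fin 2) ℝ} (hh : h = linSubst B.val (quartic 0 a b c 0))
    (t : ℝ) : flowHom B α β (Multiplicative.ofAdd t) ∈ autGroup h := by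
  have e1 := exp_scale (α := α) (β := β) (t := t) (x := a) (k := 3) (j := 1)
    fun h => by have := ha h; push_cast; linarith
  have e2 := exp_scale (α := α) (β := β) (t := t) (x := b) (k := 2) (j := 2)
    fun h => by have := hb h; push_cast; linarith
  have e3 := exp_scale (α := α) (β := β) (t := t) (x := c) (k := 1) (j := 3)
    fun h => by have := hc h; push_cast; linarith
  rw [pow_one] at e1 e3
  intro p
  rw [hh, eval_linSubst, eval_linSubst, flowHom_apply, Units.val_mul, Units.val_mul,
    ← Matrix.mulVec_mulVec, ← Matrix.mulVec_mulVec, mulVec_inv_mulVec, diagGL_mulVec]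
  generalize B.val.mulVec p = q
  simp only [eval_quartic, Matrix.cons_val_zero, Matrix.cons_val_one]
  linear_combination q 0 ^ 3 * q 1 * e1 + q 0 ^ 2 * q 1 ^ 2 * e2 + q 0 * q 1 ^ 3 * e3

/-! ### Reflections and the dihedral group. -/

/-- The reflection `y ↦ -y` as an element of `GL(2)`. -/
noncomputable def reflYGL : GL (Fin 2) ℝ :=
  Matrix.GeneralLinearGroup.mkOfDetNeZero reflY (by simp [reflY])

/-- The reflection `x ↦ -x` as an element of `GL(2)`. -/
noncomputable def reflXGL : GL (Fin 2) ℝ :=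
  Matrix.GeneralLinearGroup.mkOfDetNeZero reflX (by simp [reflX])

theorem reflYGL_val : reflYGL.val = reflY := rfl

theorem reflXGL_val : reflXGL.val = reflX := rfl

theorem reflYGL_mul_self : reflYGL * reflYGL = 1 := by
  apply Units.ext
  show reflY * reflY = 1
  ext i j
  fin_cases i <;> fin_cases j <;> simp [reflY]

theorem reflXGL_mul_self : reflXGL * reflXGL = 1 := by
  apply Units.ext
  show reflX * reflX = 1
  ext i j
  fin_cases i <;> fin_cases j <;> simp [reflX]

theorem reflYGL_mul_reflXGL : reflYGL * reflXGL = -1 := by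
  apply Units.ext
  show reflY * reflX = -1
  ext i j
  fin_cases i <;> fin_cases j <;> simp [reflX, reflY]

theorem reflXGL_mul_reflYGL : reflXGL * reflYGL = -1 := by
  apply Units.ext
  show reflX * reflY = -1
  ext i j
  fin_cases i <;> fin_cases j <;> simp [reflX, reflY]

theorem reflYGL_mul_quarterTurnGL {c : ℝ} (hc : c ≠ 0) :
    reflYGL * quarterTurnGL c hc * reflYGL = (quarterTurnGL c hc)⁻¹ := by
  have h : (quarterTurnGL c hc)⁻¹ = -quarterTurnGL c hc := by
    rw [inv_eq_iff_mul_eq_one, mul_neg, ← pow_two, quarterTurnGL_sq, neg_neg]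
  rw [h]
  apply Units.ext
  show reflY * quarterTurn c * reflY = -quarterTurn c
  ext i j
  fin_cases i <;> fin_cases j <;> simp [reflY, quarterTurn]

theorem reflYGL_mem_autGroup (K : ℝ) : reflYGL ∈ autGroup (stdPoly 0 K) := by
  intro p
  rw [reflYGL_val, reflY, mulVec_fin_two, eval_stdPoly, eval_stdPoly]
  simp only [Matrix.cons_val_zero, Matrix.cons_val_one]
  ring

theorem reflXGL_mem_autGroup (K : ℝ) : reflXGL ∈ autGroup (stdPoly 0 K) := by
  intro p
  rw [reflXGL_val, reflX, mulVec_fin_two, eval_stdPoly, eval_stdPoly]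
  simp only [Matrix.cons_val_zero, Matrix.cons_val_one]
  ring

theorem rowsGL_mul_reflY (s : ℝ) (hs : s ≠ -s) :
    (rowsGL s (-s) hs).val * reflY = !![0, 1; 1, 0] * (rowsGL s (-s) hs).val := by
  show !![1, s; 1, -s] * reflY = !![0, 1; 1, 0] * !![1, s; 1, -s]
  ext i j
  fin_cases i <;> fin_cases j <;> simp [reflY]

/-- The homomorphism from the dihedral group given by the quarter turn and the reflection. -/
noncomputable def dihedralGL (c : ℝ) (hc : c ≠ 0) : DihedralGroup 4 →* GL (Fin 2) ℝ :=
  dihedralHom (quarterTurnGL c hc) reflYGL (quarterTurnGL_pow_four hc) reflYGL_mul_self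
    (reflYGL_mul_quarterTurnGL hc)

theorem dihedralGL_mem_autGroup {c K : ℝ} (hc : c ≠ 0) (hK : K = c ^ 4) (g : DihedralGroup 4) :
    dihedralGL c hc g ∈ autGroup (stdPoly 0 K) := by
  rcases g with i | i
  · exact pow_mem (quarterTurnGL_mem_autGroup hc hK) _
  · exact mul_mem (reflYGL_mem_autGroup K) (pow_mem (quarterTurnGL_mem_autGroup hc hK) _)

theorem det_quarterTurnGL {c : ℝ} (hc : c ≠ 0) : (quarterTurnGL c hc).val.det = 1 := by
  show (quarterTurn c).det = 1
  rw [quarterTurn, Matrix.det_fin_two_of, neg_mul, mul_inv_cancel₀ hc]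
  norm_num

/-- A power of the quarter turn that preserves the arc has index `0`, since different powers below
`4` give disjoint arcs; a reflection is excluded because its determinant is `-1` while `T` has
positive determinant. `T = 1` gives injectivity in case d), a hyperbolic rotation `T` gives it in
case a). -/
theorem eq_one_of_mul_dihedralGL_eq_one {h : MvPolynomial (Fin 2) ℝ} {a b d c : ℝ}
    {B : GL (Fin 2) ℝ} (hc : c ≠ 0)
    (D : LevelDecomposition (n := 3) h a b d B fun i => quarterTurnGL c hc ^ (i : ℕ))
    {T : GL (Fin 2) ℝ} (hT : act T (act B⁻¹ (quad a b d)) = act B⁻¹ (quad a b d))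
    (hdet : 0 < T.val.det) {g : DihedralGroup 4} (hg : T * dihedralGL c hc g = 1) : g = 1 := by
  rcases g with i | i
  · have h1 : dihedralGL c hc (DihedralGroup.r i) = quarterTurnGL c hc ^ i.val := rfl
    rw [h1] at hg
    have h2 : quarterTurnGL c hc ^ i.val = T⁻¹ := eq_inv_of_mul_eq_one_right hg
    have h3 := D.base_mem_arc
    have h4 := D.index_eq_of_mem ⟨i.val, ZMod.val_lt i⟩ 0 ![1, 0]
      (by
        show _ ∈ act (quarterTurnGL c hc ^ i.val) _
        have h4 : act T⁻¹ (act B⁻¹ (quad a b d)) = act B⁻¹ (quad a b d) := by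
          conv_lhs => rw [← hT]
          rw [act_inv_act]
        rwa [h2, h4])
      (by rwa [D.g_zero, act_one])
    have h5 : i.val = 0 := congrArg Fin.val h4
    rw [(ZMod.val_eq_zero i).1 h5, DihedralGroup.r_zero]
  · exfalso
    have h1 : dihedralGL c hc (DihedralGroup.sr i) = reflYGL * quarterTurnGL c hc ^ i.val := rfl
    rw [h1] at hg
    have h2 := congrArg (fun A : GL (Fin 2) ℝ => A.val.det) hg
    simp only [Units.val_mul, Units.val_pow_eq_pow_val, Matrix.det_mul, Matrix.det_pow,
      det_quarterTurnGL, Units.val_one, Matrix.det_one, reflYGL_val] at h2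
    simp [reflY] at h2
    linarith

/-! ### The curves with `L = 0` and `K < 1/4` -/

/-- As the outer coefficients are equal and positive, both `l³m` and `lm³` are `1`, so `l = m = 1`.
The remaining swap of the factors `x + sy` and `x - sy` is the reflection `y ↦ -y`. -/
theorem eq_one_or_reflY_of_conj {s a b l m : ℝ} (hs : s ≠ -s) (ha : 0 < a)
    {S : GL (Fin 2) ℝ} (hl : 0 < l) (hm : 0 < m)
    (h : ((rowsGL s (-s) hs * S * (rowsGL s (-s) hs)⁻¹).val = !![l, 0; 0, m] ∧
        a = l ^ 3 * m * a ∧ b = (l * m) ^ 2 * b ∧ a = l * m ^ 3 * a) ∨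
      ((rowsGL s (-s) hs * S * (rowsGL s (-s) hs)⁻¹).val = !![0, l; m, 0] ∧
        a = l * m ^ 3 * a ∧ b = (l * m) ^ 2 * b ∧ a = l ^ 3 * m * a)) :
    S = 1 ∨ S = reflYGL := by
  have hlm : l ^ 3 * m * a = a → l * m ^ 3 * a = a → l = 1 ∧ m = 1 := fun h1 h2 =>
    eq_one_of_scale hl hm (mul_right_cancel₀ ha.ne' (by rw [h1, one_mul]))
      (mul_right_cancel₀ ha.ne' (by rw [h2, one_mul]))
  rcases h with ⟨hM, h1, -, h2⟩ | ⟨hM, h2, -, h1⟩ <;> obtain ⟨rfl, rfl⟩ := hlm h1.symm h2.symm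
  · left
    refine eq_of_conj_val_eq hM ?_
    rw [Units.val_one, mul_one, ← Matrix.one_fin_two, one_mul]
  · right
    exact eq_of_conj_val_eq hM (rowsGL_mul_reflY s hs)

theorem exists_param_of_lt {K : ℝ} (hK : K < 1 / 4) :
    ∃ s : ℝ, 0 < s ∧ 1 / 2 < s ^ 2 ∧ K = s ^ 2 - s ^ 4 := by
  have h0 : 0 < √(1 - 4 * K) := Real.sqrt_pos.2 (by linarith)
  have h1 : √(1 - 4 * K) ^ 2 = 1 - 4 * K := Real.sq_sqrt (by linarith)
  have h2 : √((1 + √(1 - 4 * K)) / 2) ^ 2 = (1 + √(1 - 4 * K)) / 2 := Real.sq_sqrt (by linarith)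
  -- The larger root `s²` of `T² - T + K = 0`, which exceeds `1/2`.
  refine ⟨√((1 + √(1 - 4 * K)) / 2), Real.sqrt_pos.2 (by linarith), by rw [h2]; linarith, ?_⟩
  rw [show ∀ x : ℝ, x ^ 2 - x ^ 4 = x ^ 2 - (x ^ 2) ^ 2 by intro x; ring, h2]
  linear_combination h1 / 4

theorem mulEquiv_autGroup_of_pos {K : ℝ} (hK : K < 1 / 4) (hK0 : 0 < K) :
    HasEquivalentClosedComponents (stdPoly 0 K) 4 ∧
      ∃ e : DihedralGroup 4 ≃* autGroup (stdPoly 0 K),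
        ((e (DihedralGroup.sr 0) : GL (Fin 2) ℝ) : Matrix (Fin 2) (Fin 2) ℝ) = reflY ∧
        ((e (DihedralGroup.r 1) : GL (Fin 2) ℝ) : Matrix (Fin 2) (Fin 2) ℝ) =
          quarterTurn (K ^ (1 / 4 : ℝ)) := by
  obtain ⟨s, hs, hs2, hKs⟩ := exists_param_of_lt hK
  have hc : 0 < K ^ (1 / 4 : ℝ) := Real.rpow_pos_of_pos hK0 _
  have hc4 : K = (K ^ (1 / 4 : ℝ)) ^ 4 := by
    rw [← Real.rpow_natCast, ← Real.rpow_mul hK0.le]; norm_num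
  have D := levelDecomposition_quarterTurn hs hs2.le hc hKs hc4
  have ha : 0 < (2 * s ^ 2 - 1) / (4 * s ^ 2) := div_pos (by linarith) (by positivity)
  refine ⟨D.hasEquivalentClosedComponents, ?_⟩
  have hsurj : ∀ A ∈ autGroup (stdPoly 0 K), ∃ g, dihedralGL _ hc.ne' g = A := by
    intro A hA
    obtain ⟨i, S, rfl, l, m, hl, hm, hlm⟩ := D.exists_eq_mul_monomial hA
    rcases eq_one_or_reflY_of_conj _ ha hl hm hlm with rfl | rfl
    · exact ⟨DihedralGroup.r i, (mul_one _).symm⟩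
    · refine ⟨DihedralGroup.r i * DihedralGroup.sr 0, ?_⟩
      rw [map_mul]
      show quarterTurnGL _ hc.ne' ^ _ * (reflYGL * quarterTurnGL _ hc.ne' ^ 0) = _
      rw [pow_zero, mul_one]
      rfl
  obtain ⟨e, he⟩ := exists_mulEquiv_autGroup (h := stdPoly 0 K) (dihedralGL _ hc.ne')
    (dihedralGL_mem_autGroup hc.ne' hc4)
    (fun g hg => eq_one_of_mul_dihedralGL_eq_one hc.ne' D (T := 1) (act_one _) (by simp)
      (by rw [one_mul, hg])) hsurj
  refine ⟨e, ?_, ?_⟩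
  · rw [he]
    show (reflYGL * quarterTurnGL _ hc.ne' ^ 0).val = reflY
    rw [pow_zero, mul_one]; rfl
  · rw [he]
    show (quarterTurnGL _ hc.ne' ^ 1).val = _
    rw [pow_one]; rfl

theorem mulEquiv_autGroup_of_nonpos {K : ℝ} (hK : K ≤ 0) :
    HasEquivalentClosedComponents (stdPoly 0 K) 2 ∧
      ∃ e : Multiplicative (ZMod 2) × Multiplicative (ZMod 2) ≃* autGroup (stdPoly 0 K),
        ((e (Multiplicative.ofAdd 1, 1) : GL (Fin 2) ℝ) : Matrix (Fin 2) (Fin 2) ℝ) = reflY ∧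
        ((e (1, Multiplicative.ofAdd 1) : GL (Fin 2) ℝ) : Matrix (Fin 2) (Fin 2) ℝ) = reflX := by
  obtain ⟨s, hs, hs2, hKs⟩ := exists_param_of_lt (K := K) (by linarith)
  -- Here `s²(1 - s²) = K ≤ 0`.
  have hs1 : 1 ≤ s := by
    by_contra! h
    have : s ^ 2 < 1 := by nlinarith
    nlinarith
  have D := levelDecomposition_neg hs1 hKs
  have ha : 0 < (2 * s ^ 2 - 1) / (4 * s ^ 2) := div_pos (by linarith) (by positivity)
  refine ⟨D.hasEquivalentClosedComponents, ?_⟩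
  have hY := involutionHom_ofAdd_one _ reflYGL_mul_self
  have hX := involutionHom_ofAdd_one _ reflXGL_mul_self
  have hcomm : ∀ a b, Commute (involutionHom _ reflYGL_mul_self a)
      (involutionHom _ reflXGL_mul_self b) := by
    intro a b
    refine Commute.pow_pow ?_ _ _
    rw [Commute, SemiconjBy, reflYGL_mul_reflXGL, reflXGL_mul_reflYGL]
  set F := (involutionHom _ reflYGL_mul_self).noncommCoprod (involutionHom _ reflXGL_mul_self) hcomm with hF
  have hmem : ∀ g, F g ∈ autGroup (stdPoly 0 K) := by
    rintro ⟨a, b⟩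
    rw [MonoidHom.noncommCoprod_apply]
    exact mul_mem (pow_mem (reflYGL_mem_autGroup K) _) (pow_mem (reflXGL_mem_autGroup K) _)
  have hker : ∀ g, F g = 1 → g = 1 := by
    rintro ⟨a, b⟩
    rw [MonoidHom.noncommCoprod_apply]
    have hYne : reflYGL ≠ 1 := fun h => by
      have := congrArg (fun A : GL (Fin 2) ℝ => A.val 1 1) h
      rw [reflYGL_val] at this
      norm_num [reflY] at this
    have hXne : reflXGL ≠ 1 := fun h => by
      have := congrArg (fun A : GL (Fin 2) ℝ => A.val 0 0) h
      rw [reflXGL_val] at this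
      norm_num [reflX] at this
    have hne : reflYGL * reflXGL ≠ 1 := fun h => by
      rw [reflYGL_mul_reflXGL] at h
      have := congrArg (fun A : GL (Fin 2) ℝ => A.val 0 0) h
      norm_num at this
    induction a using forall_multiplicative_zmod_two <;>
      induction b using forall_multiplicative_zmod_two <;>
      simp only [hY, hX, map_one, mul_one, one_mul]
    · exact fun _ => rfl
    · exact fun h => (hXne h).elim
    · exact fun h => (hYne h).elim
    · exact fun h => (hne h).elim
  have hsurj : ∀ A ∈ autGroup (stdPoly 0 K), ∃ g, F g = A := by
    intro A hA
    obtain ⟨i, S, rfl, l, m, hl, hm, hlm⟩ := D.exists_eq_mul_monomial hA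
    have hYX : -reflYGL = reflXGL := by
      rw [← neg_one_mul, ← reflXGL_mul_reflYGL, mul_assoc, reflYGL_mul_self, mul_one]
    rcases eq_one_or_reflY_of_conj _ ha hl hm hlm with rfl | rfl <;> fin_cases i
    · exact ⟨1, by simp⟩
    · refine ⟨(Multiplicative.ofAdd 1, Multiplicative.ofAdd 1), ?_⟩
      rw [MonoidHom.noncommCoprod_apply, hY, hX, reflYGL_mul_reflXGL]
      exact (mul_one _).symm
    · refine ⟨(Multiplicative.ofAdd 1, 1), ?_⟩
      rw [MonoidHom.noncommCoprod_apply, hY, map_one, mul_one]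
      exact (one_mul _).symm
    · refine ⟨(1, Multiplicative.ofAdd 1), ?_⟩
      rw [MonoidHom.noncommCoprod_apply, hX, map_one, one_mul, ← hYX]
      exact (neg_one_mul _).symm
  obtain ⟨e, he⟩ := exists_mulEquiv_autGroup F hmem hker hsurj
  refine ⟨e, ?_, ?_⟩
  · rw [he, MonoidHom.noncommCoprod_apply, hY, map_one, mul_one, reflYGL_val]
  · rw [he, MonoidHom.noncommCoprod_apply, hX, map_one, one_mul, reflXGL_val]

/-- Level decompositions of all the forms `stdPoly 0 K` with `K < 1/4`. -/
theorem exists_levelDecomposition_of_lt {K s : ℝ} (hs : 0 < s)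
    (hs2 : 1 / 2 < s ^ 2) (hKs : K = s ^ 2 - s ^ 4) :
    ∃ (n : ℕ) (g : Fin (n + 1) → GL (Fin 2) ℝ),
      LevelDecomposition (stdPoly 0 K) ((2 * s ^ 2 - 1) / (4 * s ^ 2)) (1 / (2 * s ^ 2))
        ((2 * s ^ 2 - 1) / (4 * s ^ 2)) (rowsGL s (-s) (ne_neg_self_of_pos hs)) g := by
  rcases le_or_gt K 0 with h | h
  · have hs1 : 1 ≤ s := by
      by_contra! h
      have : s ^ 2 < 1 := by nlinarith
      nlinarith
    exact ⟨1, _, levelDecomposition_neg hs1 hKs⟩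
  · have hc : 0 < K ^ (1 / 4 : ℝ) := Real.rpow_pos_of_pos h _
    have hc4 : K = (K ^ (1 / 4 : ℝ)) ^ 4 := by
      rw [← Real.rpow_natCast, ← Real.rpow_mul h.le]; norm_num
    exact ⟨3, _, levelDecomposition_quarterTurn hs hs2.le hc hKs hc4⟩

/-- An arc in the quadrant has more than one point. -/
theorem Admissible.exists_mem_quad_ne {a b c : ℝ} (H : Admissible a b c) (p : Plane) :
    ∃ q ∈ quad a b c, q ≠ p := by
  obtain ⟨r, hr, hq⟩ := H.exists_smul_mem_quad (p := ![1, 1]) (by simp [quadrant])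
  obtain ⟨r', hr', hq'⟩ := H.exists_smul_mem_quad (p := ![1, 2]) (by simp [quadrant])
  by_cases h : r • ![1, 1] = p
  · refine ⟨_, hq', fun h' => ?_⟩
    rw [← h] at h'
    have h0 := congrFun h' 0
    have h1 := congrFun h' 1
    simp at h0 h1
    linarith
  · exact ⟨_, hq, h⟩

/-- A curve with a point fixed by all its linear symmetries is not homogeneous. -/
theorem LevelDecomposition.not_isHomogeneousCurve {h : MvPolynomial (Fin 2) ℝ} {a b c : ℝ}
    {B : GL (Fin 2) ℝ} {n : ℕ} {g : Fin (n + 1) → GL (Fin 2) ℝ}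
    (D : LevelDecomposition h a b c B g)
    (hfix : ∀ S : GL (Fin 2) ℝ, act S (act B⁻¹ (quad a b c)) = act B⁻¹ (quad a b c) →
      S.val.mulVec ![1, 0] = ![1, 0]) :
    ¬ IsHomogeneousCurve (act B⁻¹ (quad a b c)) := by
  intro hH
  obtain ⟨q, hq, hne⟩ := D.admissible.exists_mem_quad_ne (B.val.mulVec ![1, 0])
  obtain ⟨S, hS, hSq⟩ := hH _ D.base_mem_arc (B⁻¹.val.mulVec q) ⟨q, hq, rfl⟩
  rw [hfix S hS] at hSq
  apply hne
  rw [hSq, mulVec_inv_mulVec]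

theorem not_isHomogeneousCurve_of_lt {K : ℝ} (hK : K < 1 / 4) :
    ¬ IsHomogeneousCurve (stdCurve 0 K) ∧ ¬ IsSingularAtInfinity (stdPoly 0 K) (stdCurve 0 K) := by
  obtain ⟨s, hs, hs2, hKs⟩ := exists_param_of_lt hK
  obtain ⟨n, g, D⟩ := exists_levelDecomposition_of_lt hs hs2 hKs
  have ha : 0 < (2 * s ^ 2 - 1) / (4 * s ^ 2) := div_pos (by linarith) (by positivity)
  rw [stdCurve, D.connectedComponentIn_eq]
  constructor
  · refine D.not_isHomogeneousCurve fun S hS => ?_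
    obtain ⟨l, m, hl, hm, h⟩ := monomial_of_act_quad D.admissible D.admissible (LevelDecomposition.act_conj hS)
    rcases eq_one_or_reflY_of_conj _ ha hl hm h with rfl | rfl
    · simp
    · rw [reflYGL_val, reflY, mulVec_fin_two]; simp
  · rw [D.eq, isSingularAtInfinity_linSubst_iff]
    exact D.admissible.not_isSingularAtInfinity ha.ne' ha.ne'

/-! ### The curve with `(L, K) = (0, 1/4)` -/

theorem sqrt_two_sq : √2 ^ 2 = 2 := Real.sq_sqrt (by norm_num)

theorem sqrt_three_sq : √3 ^ 2 = 3 := Real.sq_sqrt (by norm_num)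

theorem inv_sqrt_two_pos : 0 < 1 / √2 := by positivity

theorem inv_sqrt_two_sq : (1 / √2) ^ 2 = 1 / 2 := by rw [div_pow, sqrt_two_sq, one_pow]

/-- The degenerate case `s = c = 1/√2` of the quarter turn decomposition: the two quadratic factors
coincide, the outer coefficients vanish and the form is `X²Y²`. -/
theorem levelDecomposition_a :
    LevelDecomposition (n := 3) (stdPoly 0 (1 / 4)) 0 1 0
      (rowsGL (1 / √2) (-(1 / √2)) (ne_neg_self_of_pos inv_sqrt_two_pos))
      fun i => quarterTurnGL (1 / √2) inv_sqrt_two_pos.ne' ^ (i : ℕ) := by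
  have h2 := inv_sqrt_two_sq
  have h4 : (1 / √2) ^ 4 = 1 / 4 := by
    rw [show (1 / √2) ^ 4 = ((1 / √2) ^ 2) ^ 2 by ring, h2]; norm_num
  have D := levelDecomposition_quarterTurn inv_sqrt_two_pos h2.ge inv_sqrt_two_pos
    (K := 1 / 4) (by rw [h2, h4]; norm_num) h4.symm
  rw [h2] at D
  norm_num at D
  norm_num
  exact D

/-- The hyperbolic rotations. -/
noncomputable def hypRotationHom : Multiplicative ℝ →* GL (Fin 2) ℝ :=
  flowHom (rowsGL (1 / √2) (-(1 / √2)) (ne_neg_self_of_pos inv_sqrt_two_pos)) 1 (-1)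

/-- In the null coordinates `x ± y/√2` a hyperbolic rotation is `diag(eᵗ, e⁻ᵗ)`. -/
theorem rowsGL_mul_hypRotation (t : ℝ) :
    (rowsGL (1 / √2) (-(1 / √2)) (ne_neg_self_of_pos inv_sqrt_two_pos)).val * hypRotation t =
      !![Real.exp (1 * t), 0; 0, Real.exp (-1 * t)] *
        (rowsGL (1 / √2) (-(1 / √2)) (ne_neg_self_of_pos inv_sqrt_two_pos)).val := by
  show !![1, 1 / √2; 1, -(1 / √2)] * hypRotation t = _ * !![1, 1 / √2; 1, -(1 / √2)]
  have h1 : √2 ≠ 0 := by positivity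
  have e1 := Real.cosh_add_sinh t
  have e2 := Real.cosh_sub_sinh t
  ext i j
  fin_cases i <;> fin_cases j <;> simp [hypRotation, h1]
  · linear_combination (√2)⁻¹ * e1
  · linear_combination e2
  · linear_combination -(√2)⁻¹ * e2

theorem hypRotationHom_val (t : ℝ) :
    (hypRotationHom (Multiplicative.ofAdd t)).val = hypRotation t :=
  flowHom_eq_of_mul_eq (rowsGL_mul_hypRotation t)

theorem det_hypRotation (t : ℝ) : (hypRotation t).det = 1 := by
  have h1 : √2 ≠ 0 := by positivity
  rw [hypRotation, Matrix.det_fin_two_of, ← Real.cosh_sq_sub_sinh_sq t]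
  field_simp

theorem quarterTurn_mul_hypRotation (t : ℝ) :
    quarterTurn (1 / √2) * hypRotation t = hypRotation (-t) * quarterTurn (1 / √2) := by
  have h1 : √2 ≠ 0 := by positivity
  ext i j
  fin_cases i <;> fin_cases j <;> simp [quarterTurn, hypRotation] <;> field_simp

theorem reflY_mul_hypRotation (t : ℝ) : reflY * hypRotation t = hypRotation (-t) * reflY := by
  ext i j
  fin_cases i <;> fin_cases j <;> simp [reflY, hypRotation]
  ring

/-- The action of the dihedral group on `ℝ` in which the rotation by a quarter turn and the
reflection act by inversion. -/
def inversionAction : DihedralGroup 4 →* MulAut (Multiplicative ℝ) :=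
  dihedralHom (MulEquiv.inv _) (MulEquiv.inv _) (by ext; simp [pow_succ])
    (by ext; simp) (by ext; simp [MulAut.inv_def])

/-- This is the compatibility needed to define a homomorphism on the semidirect product. Both sides
are multiplicative in `g`, so it suffices to treat the quarter turn and the reflection, each of
which inverts the rotations. -/
theorem hypRotationHom_comp_inversionAction (g : DihedralGroup 4) (t : Multiplicative ℝ) :
    hypRotationHom (inversionAction g t) = dihedralGL (1 / √2) inv_sqrt_two_pos.ne' g *
      hypRotationHom t * (dihedralGL (1 / √2) inv_sqrt_two_pos.ne' g)⁻¹ := by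
  induction g using dihedralGroup_induction generalizing t with
  | one => simp
  | mul a b ha hb =>
    rw [map_mul, MulAut.mul_apply, ha, hb, map_mul, mul_inv_rev]
    simp only [mul_assoc]
  | r =>
    rw [eq_mul_inv_iff_mul_eq]
    apply Units.ext
    show (hypRotationHom ((MulEquiv.inv _) t) * quarterTurnGL _ _ ^ 1).val =
      (quarterTurnGL _ _ ^ 1 * hypRotationHom t).val
    rw [pow_one, Units.val_mul, Units.val_mul]
    have h1 := hypRotationHom_val (-t.toAdd)
    have h2 := hypRotationHom_val t.toAdd
    exact (congrArg₂ (· * ·) h1 rfl).trans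
      ((quarterTurn_mul_hypRotation t.toAdd).symm.trans (congrArg₂ (· * ·) rfl h2.symm))
  | sr =>
    rw [eq_mul_inv_iff_mul_eq]
    apply Units.ext
    have h0 : dihedralGL (1 / √2) inv_sqrt_two_pos.ne' (DihedralGroup.sr 0) = reflYGL :=
      mul_one _
    have h0' : inversionAction (DihedralGroup.sr 0) = MulEquiv.inv _ := mul_one _
    rw [h0, h0', Units.val_mul, Units.val_mul]
    have h1 := hypRotationHom_val (-t.toAdd)
    have h2 := hypRotationHom_val t.toAdd
    exact (congrArg₂ (· * ·) h1 rfl).trans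
      ((reflY_mul_hypRotation t.toAdd).symm.trans (congrArg₂ (· * ·) rfl h2.symm))

theorem mulEquiv_autGroup_a :
    ∃ (φ : DihedralGroup 4 →* MulAut (Multiplicative ℝ))
      (e : Multiplicative ℝ ⋊[φ] DihedralGroup 4 ≃* autGroup (stdPoly 0 (1 / 4))),
      (∀ t : ℝ, ((e (SemidirectProduct.inl (Multiplicative.ofAdd t)) : GL (Fin 2) ℝ) :
        Matrix (Fin 2) (Fin 2) ℝ) = hypRotation t) ∧
      ((e (SemidirectProduct.inr (DihedralGroup.sr 0)) : GL (Fin 2) ℝ) :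
        Matrix (Fin 2) (Fin 2) ℝ) = reflY ∧
      ((e (SemidirectProduct.inr (DihedralGroup.r 1)) : GL (Fin 2) ℝ) :
        Matrix (Fin 2) (Fin 2) ℝ) = quarterTurn (1 / √2) := by
  have D := levelDecomposition_a
  have hc4 : 1 / 4 = (1 / √2) ^ 4 := by
    rw [show (1 / √2) ^ 4 = ((1 / √2) ^ 2) ^ 2 by ring, inv_sqrt_two_sq]; norm_num
  have hr : dihedralGL (1 / √2) inv_sqrt_two_pos.ne' (DihedralGroup.r 1) =
      quarterTurnGL (1 / √2) inv_sqrt_two_pos.ne' := pow_one _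
  have hsr : dihedralGL (1 / √2) inv_sqrt_two_pos.ne' (DihedralGroup.sr 0) = reflYGL :=
    mul_one _
  set F : Multiplicative ℝ ⋊[inversionAction] DihedralGroup 4 →* GL (Fin 2) ℝ :=
    SemidirectProduct.lift hypRotationHom (dihedralGL (1 / √2) inv_sqrt_two_pos.ne')
      (fun g => MonoidHom.ext fun t => hypRotationHom_comp_inversionAction g t) with hF
  have hFapp : ∀ x, F x = hypRotationHom x.left *
      dihedralGL (1 / √2) inv_sqrt_two_pos.ne' x.right := fun x => rfl
  have hmem : ∀ x, F x ∈ autGroup (stdPoly 0 (1 / 4)) := fun x =>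
    mul_mem (flowHom_mem_autGroup (by simp) (by simp) (by simp) D.eq x.left.toAdd)
      (dihedralGL_mem_autGroup _ hc4 _)
  have hker : ∀ x, F x = 1 → x = 1 := by
    intro x hx
    rw [hFapp] at hx
    have hval := hypRotationHom_val x.left.toAdd
    rw [ofAdd_toAdd] at hval
    have h1 : x.right = 1 := by
      refine eq_one_of_mul_dihedralGL_eq_one _ D
        (act_flowHom (by simp) (by simp) (by simp) _ x.left.toAdd) ?_ hx
      show 0 < (hypRotationHom x.left).val.det
      rw [hval, det_hypRotation]
      exact one_pos
    rw [h1, map_one, mul_one] at hx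
    rw [hx] at hval
    -- The lower left entry `√2 sinh t` vanishes only for `t = 0`.
    have h2 := congrArg (fun M : Matrix (Fin 2) (Fin 2) ℝ => M 1 0) hval
    simp [hypRotation] at h2
    exact SemidirectProduct.ext h2 h1
  have hsurj : ∀ A ∈ autGroup (stdPoly 0 (1 / 4)), ∃ x, F x = A := by
    intro A hA
    obtain ⟨i, S, rfl, l, m, hl, hm, h⟩ := D.exists_eq_mul_monomial hA
    -- Invariance of `X²Y²` gives `lm = 1`, so the diagonal part is the rotation with parameter `log
    -- l`.
    have hlm : 1 = (l * m) ^ 2 * 1 → Real.exp (1 * Real.log l) = l ∧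
        Real.exp (-1 * Real.log l) = m := by
      intro h
      have h1 : l * m = 1 :=
        (pow_eq_one_iff_of_nonneg (by positivity) two_ne_zero).1 (by linarith)
      rw [one_mul, neg_one_mul, Real.exp_neg, Real.exp_log hl]
      exact ⟨rfl, inv_eq_of_mul_eq_one_right h1⟩
    have hBf := rowsGL_mul_hypRotation (Real.log l)
    rw [← hypRotationHom_val] at hBf
    rcases h with ⟨hM, -, h, -⟩ | ⟨hM, -, h, -⟩ <;> obtain ⟨e1, e2⟩ := hlm h <;>
      rw [e1, e2] at hBf
    · refine ⟨SemidirectProduct.inr (DihedralGroup.r i) *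
        SemidirectProduct.inl (Multiplicative.ofAdd (Real.log l)), ?_⟩
      rw [eq_of_conj_val_eq hM hBf, map_mul, SemidirectProduct.lift_inr,
        SemidirectProduct.lift_inl]
      rfl
    · refine ⟨SemidirectProduct.inr (DihedralGroup.r i) *
        (SemidirectProduct.inl (Multiplicative.ofAdd (Real.log l)) *
          SemidirectProduct.inr (DihedralGroup.sr 0)), ?_⟩
      have hS := eq_of_conj_val_eq (T := hypRotationHom (Multiplicative.ofAdd (Real.log l)) *
        reflYGL) hM (by
          rw [Units.val_mul, ← Matrix.mul_assoc, hBf, Matrix.mul_assoc, reflYGL_val,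
            rowsGL_mul_reflY, ← Matrix.mul_assoc]
          congr 1
          ext i j
          fin_cases i <;> fin_cases j <;> simp)
      rw [hS, map_mul, map_mul, SemidirectProduct.lift_inr,
        SemidirectProduct.lift_inl, SemidirectProduct.lift_inr, hsr]
      rfl
  obtain ⟨e, he⟩ := exists_mulEquiv_autGroup F hmem hker hsurj
  refine ⟨inversionAction, e, fun t => ?_, ?_, ?_⟩
  · rw [he, SemidirectProduct.lift_inl, hypRotationHom_val]
  · rw [he, SemidirectProduct.lift_inr, hsr, reflYGL_val]
  · rw [he, SemidirectProduct.lift_inr, hr]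
    rfl

theorem isHomogeneousCurve_a : IsHomogeneousCurve (stdCurve 0 (1 / 4)) ∧
    IsSingularAtInfinity (stdPoly 0 (1 / 4)) (stdCurve 0 (1 / 4)) := by
  have D := levelDecomposition_a
  rw [stdCurve, D.connectedComponentIn_eq]
  refine ⟨(isHomogeneousCurve_quad_zero_b_zero 1).act _, ?_⟩
  rw [D.eq, isSingularAtInfinity_linSubst_iff]
  exact D.admissible.isSingularAtInfinity rfl

/-! ### The curve with `(L, K) = (Lb, -1/12)` -/

theorem neg_inv_sqrt_three_mul (t : ℝ) : -(1 / √3) * t = -(t / √3) := by ring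

theorem three_mul_neg_inv_sqrt_three : 3 * -(1 / √3) + √3 = 0 := by
  have h1 : √3 ≠ 0 := by positivity
  field_simp
  linarith [sqrt_three_sq]

theorem rowsGL_mul_flowB (t : ℝ) :
    (rowsGL (-(1 / √6)) (√3 / √2) rows_b_ne).val * flowB t =
      !![Real.exp (-(1 / √3) * t), 0; 0, Real.exp (√3 * t)] *
        (rowsGL (-(1 / √6)) (√3 / √2) rows_b_ne).val := by
  show !![1, -(1 / √6); 1, √3 / √2] * flowB t = _ * !![1, -(1 / √6); 1, √3 / √2]
  -- `flowB` lists the two eigenvalues in the order opposite to the rows of `rowsGL`, so this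
  -- product is the swap rather than the identity.
  have h1 : !![1, -(1 / √6); 1, √3 / √2] *
      !![1 / 4, 3 / 4; √3 / (2 * √2), -(√3 / (2 * √2))] = !![0, 1; 1, 0] := by
    have h2 : √2 ≠ 0 := by positivity
    have h3 : √3 ≠ 0 := by positivity
    have e2 := sqrt_two_sq
    have e3 := sqrt_three_sq
    rw [sqrt_six_eq]
    ext i j
    fin_cases i <;> fin_cases j <;> simp <;> field_simp <;> simp only [e2, e3] <;> norm_num
  rw [flowB, ← Matrix.mul_assoc, ← Matrix.mul_assoc, h1, neg_inv_sqrt_three_mul]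
  ext i j
  fin_cases i <;> fin_cases j <;> simp

theorem flowHom_b_val (t : ℝ) :
    (flowHom (rowsGL (-(1 / √6)) (√3 / √2) rows_b_ne) (-(1 / √3)) √3
      (Multiplicative.ofAdd t)).val = flowB t :=
  flowHom_eq_of_mul_eq (rowsGL_mul_flowB t)

theorem neg_one_mul_neg_one_GL : (-1 : GL (Fin 2) ℝ) * -1 = 1 := by simp

/-- A scalar matrix is unchanged by conjugation, so the comparison can be made with the diagonal
matrix itself. Used with `r = 1` for injectivity and with `r = -1`, where it contradicts positivity
of the exponential. -/
theorem flowHom_eq_imp {B : GL (Fin 2) ℝ} {α β t r : ℝ} {T : GL (Fin 2) ℝ}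
    (hT : T.val = r • (1 : Matrix (Fin 2) (Fin 2) ℝ))
    (h : flowHom B α β (Multiplicative.ofAdd t) = T) : Real.exp (α * t) = r := by
  rw [flowHom_apply, mul_assoc, inv_mul_eq_iff_eq_mul] at h
  have h1 : diagGL (Real.exp (α * t)) (Real.exp (β * t)) (Real.exp_pos _) (Real.exp_pos _) = T := by
    apply mul_right_cancel (b := B)
    rw [h]
    apply Units.ext
    rw [Units.val_mul, Units.val_mul, hT]
    simp
  have h2 := congrArg (fun A : GL (Fin 2) ℝ => A.val 0 0) h1
  rw [hT] at h2
  have h3 : Real.exp (α * t) = (r • (1 : Matrix (Fin 2) (Fin 2) ℝ)) 0 0 := h2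
  simpa using h3

theorem mulEquiv_autGroup_b :
    ∃ e : Multiplicative ℝ × Multiplicative (ZMod 2) ≃* autGroup (stdPoly Lb (-1 / 12)),
      (∀ t : ℝ, ((e (Multiplicative.ofAdd t, 1) : GL (Fin 2) ℝ) :
        Matrix (Fin 2) (Fin 2) ℝ) = flowB t) ∧
      (∀ t : ℝ, act (e (Multiplicative.ofAdd t, 1) : GL (Fin 2) ℝ) (stdCurve Lb (-1 / 12)) =
        stdCurve Lb (-1 / 12)) ∧
      ((e (1, Multiplicative.ofAdd 1) : GL (Fin 2) ℝ) : Matrix (Fin 2) (Fin 2) ℝ) = -1 := by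
  have D := levelDecomposition_b
  have h3 := three_mul_neg_inv_sqrt_three
  set f := flowHom (rowsGL (-(1 / √6)) (√3 / √2) rows_b_ne) (-(1 / √3)) √3 with hf
  have hone := involutionHom_ofAdd_one _ neg_one_mul_neg_one_GL
  set F := f.noncommCoprod (involutionHom _ neg_one_mul_neg_one_GL) (fun _ b => by
    refine Commute.pow_right ?_ _
    exact Commute.neg_one_right _) with hF
  have hFapp : ∀ a b, F (a, b) = f a * involutionHom _ neg_one_mul_neg_one_GL b := fun _ _ => rfl
  have hmem : ∀ x, F x ∈ autGroup (stdPoly Lb (-1 / 12)) := fun x =>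
    mul_mem (flowHom_mem_autGroup (fun _ => h3) (by simp) (by simp) D.eq x.1.toAdd)
      (pow_mem (neg_one_mem_autGroup D.isHomogeneous) _)
  have hker : ∀ x, F x = 1 → x = 1 := by
    rintro ⟨a, b⟩ h
    rw [hFapp] at h
    induction b using forall_multiplicative_zmod_two with
    | h0 =>
      rw [map_one, mul_one] at h
      have h1 := flowHom_eq_imp (t := a.toAdd) (r := 1) (by simp) h
      have h2 : √3 ≠ 0 := by positivity
      simp [h2] at h1
      rw [h1]
      rfl
    | h1 =>
      rw [hone] at h
      have h1 := flowHom_eq_imp (t := a.toAdd) (r := -1) (T := -1) (by simp)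
        (by rw [mul_neg, mul_one] at h; rw [← h, neg_neg]; rfl)
      linarith [Real.exp_pos (-(1 / √3) * a.toAdd)]
  have hsurj : ∀ A ∈ autGroup (stdPoly Lb (-1 / 12)), ∃ x, F x = A := by
    intro A hA
    obtain ⟨i, S, rfl, l, m, hl, hm, h⟩ := D.exists_eq_mul_monomial hA
    rcases h with ⟨hM, h, -, -⟩ | ⟨-, h, -, -⟩
    · have h2 : √3 ≠ 0 := by positivity
      -- The parameter `t = -√3 log l` solves `exp (-t/√3) = l`; then `exp (√3 t) = l⁻³ = m` because
      -- `l³m = 1`.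
      have e1 : Real.exp (-(1 / √3) * (-√3 * Real.log l)) = l := by
        rw [show -(1 / √3) * (-√3 * Real.log l) = Real.log l by field_simp, Real.exp_log hl]
      have e2 : Real.exp (√3 * (-√3 * Real.log l)) = m := by
        rw [show √3 * (-√3 * Real.log l) = -((3 : ℕ) * Real.log l) by
          push_cast; linear_combination (-Real.log l) * sqrt_three_sq, Real.exp_neg,
          Real.exp_nat_mul, Real.exp_log hl]
        exact inv_eq_of_mul_eq_one_right (by linarith)
      have hBf := rowsGL_mul_flowB (-√3 * Real.log l)
      rw [← flowHom_b_val, e1, e2] at hBf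
      have hS := eq_of_conj_val_eq hM hBf
      fin_cases i
      · refine ⟨(Multiplicative.ofAdd (-√3 * Real.log l), 1), ?_⟩
        rw [hFapp, map_one, mul_one, hS]
        exact (one_mul _).symm
      · refine ⟨(Multiplicative.ofAdd (-√3 * Real.log l), Multiplicative.ofAdd 1), ?_⟩
        rw [hFapp, hone, hS]
        exact (mul_neg_one _).trans (neg_one_mul _).symm
    · norm_num at h
  obtain ⟨e, he⟩ := exists_mulEquiv_autGroup F hmem hker hsurj
  have he1 : ∀ t, (e (Multiplicative.ofAdd t, 1) : GL (Fin 2) ℝ) =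
      f (Multiplicative.ofAdd t) := fun t => by
    rw [he, hFapp, map_one, mul_one]
  refine ⟨e, fun t => ?_, fun t => ?_, ?_⟩
  · rw [he1, flowHom_b_val]
  · rw [he1, stdCurve, D.connectedComponentIn_eq]
    exact act_flowHom (fun _ => h3) (by simp) (by simp) _ t
  · rw [he, hFapp, hone, map_one, one_mul, Units.val_neg, Units.val_one]

theorem isHomogeneousCurve_b : IsHomogeneousCurve (stdCurve Lb (-1 / 12)) ∧
    IsSingularAtInfinity (stdPoly Lb (-1 / 12)) (stdCurve Lb (-1 / 12)) := by
  have D := levelDecomposition_b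
  rw [stdCurve, D.connectedComponentIn_eq]
  refine ⟨(isHomogeneousCurve_quad_a_zero_zero 1).act _, ?_⟩
  rw [D.eq, isSingularAtInfinity_linSubst_iff]
  exact D.admissible.isSingularAtInfinity rfl

/-! ### The curve with `(L, K) = (Lc, 0)` -/

/-- A swap is impossible since only one outer coefficient is non-zero; in the diagonal case `lm = 1`
and `l³m = 1` give `l = 1`. -/
theorem eq_one_of_conj_c {B S : GL (Fin 2) ℝ} {l m : ℝ} (hl : 0 < l) (hm : 0 < m)
    (h : ((B * S * B⁻¹).val = !![l, 0; 0, m] ∧ (2 / 3 : ℝ) = l ^ 3 * m * (2 / 3) ∧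
        (1 / 3 : ℝ) = (l * m) ^ 2 * (1 / 3) ∧ (0 : ℝ) = l * m ^ 3 * 0) ∨
      ((B * S * B⁻¹).val = !![0, l; m, 0] ∧ (2 / 3 : ℝ) = l * m ^ 3 * 0 ∧
        (1 / 3 : ℝ) = (l * m) ^ 2 * (1 / 3) ∧ (0 : ℝ) = l ^ 3 * m * (2 / 3))) : S = 1 := by
  rcases h with ⟨hM, h1, h2, -⟩ | ⟨-, h, -, -⟩
  · have h3 : l * m = 1 :=
      (pow_eq_one_iff_of_nonneg (by positivity) two_ne_zero).1 (by linarith)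
    have h4 : l ^ 2 = 1 := by
      have : l ^ 3 * m = l ^ 2 * (l * m) := by ring
      rw [h3] at this
      linarith
    have h5 : l = 1 := (pow_eq_one_iff_of_nonneg hl.le two_ne_zero).1 h4
    rw [h5, one_mul] at h3
    subst h5 h3
    refine eq_of_conj_val_eq hM ?_
    rw [Units.val_one, mul_one, ← Matrix.one_fin_two, one_mul]
  · norm_num at h

theorem LevelDecomposition.injective {h : MvPolynomial (Fin 2) ℝ} {a b c : ℝ}
    {B : GL (Fin 2) ℝ} {n : ℕ} {g : Fin (n + 1) → GL (Fin 2) ℝ}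
    (D : LevelDecomposition h a b c B g) : Function.Injective g := by
  intro i j hij
  obtain ⟨p, hp⟩ := (isConnected_act (g i) D.isConnected_arc).nonempty
  exact D.index_eq_of_mem i j p hp (hij ▸ hp)

theorem mulEquiv_autGroup_c :
    Nonempty (Multiplicative (ZMod 2) × Multiplicative (ZMod 2) ≃* autGroup (stdPoly Lc 0)) := by
  have D := levelDecomposition_c
  have hX := involutionHom_ofAdd_one _ neg_one_mul_neg_one_GL
  have hY := involutionHom_ofAdd_one _ flipC_mul_self
  set F := (involutionHom _ neg_one_mul_neg_one_GL).noncommCoprod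
    (involutionHom _ flipC_mul_self) (fun a b =>
      Commute.pow_pow (Commute.neg_one_left _) _ _) with hF
  have hFapp : ∀ a b, F (a, b) = involutionHom _ neg_one_mul_neg_one_GL a *
    involutionHom _ flipC_mul_self b := fun _ _ => rfl
  have hmem : ∀ x, F x ∈ autGroup (stdPoly Lc 0) := fun x =>
    mul_mem (pow_mem (neg_one_mem_autGroup D.isHomogeneous) _) (pow_mem flipC_mem_autGroup _)
  have hker : ∀ x, F x = 1 → x = 1 := by
    rintro ⟨a, b⟩
    rw [hFapp]
    have h1 := D.injective.ne (a₁ := 1) (a₂ := 0) (by decide)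
    have h2 := D.injective.ne (a₁ := 2) (a₂ := 0) (by decide)
    have h3 := D.injective.ne (a₁ := 3) (a₂ := 0) (by decide)
    induction a using forall_multiplicative_zmod_two <;>
      induction b using forall_multiplicative_zmod_two <;>
      simp only [hY, hX, map_one, mul_one, one_mul]
    · exact fun _ => rfl
    · exact fun h => (h2 h).elim
    · exact fun h => (h1 h).elim
    · exact fun h => (h3 ((neg_one_mul flipC).symm.trans h)).elim
  have hsurj : ∀ A ∈ autGroup (stdPoly Lc 0), ∃ x, F x = A := by
    intro A hA
    obtain ⟨i, S, rfl, l, m, hl, hm, h⟩ := D.exists_eq_mul_monomial hA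
    rw [eq_one_of_conj_c hl hm h, mul_one]
    fin_cases i
    · exact ⟨1, map_one _⟩
    · refine ⟨(Multiplicative.ofAdd 1, 1), ?_⟩
      rw [hFapp, hX, map_one, mul_one]
      rfl
    · refine ⟨(1, Multiplicative.ofAdd 1), ?_⟩
      rw [hFapp, hY, map_one, one_mul]
      rfl
    · refine ⟨(Multiplicative.ofAdd 1, Multiplicative.ofAdd 1), ?_⟩
      rw [hFapp, hX, hY]
      exact neg_one_mul _
  obtain ⟨e, -⟩ := exists_mulEquiv_autGroup F hmem hker hsurj
  exact ⟨e⟩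

theorem not_isHomogeneousCurve_c : ¬ IsHomogeneousCurve (stdCurve Lc 0) ∧
    IsSingularAtInfinity (stdPoly Lc 0) (stdCurve Lc 0) := by
  have D := levelDecomposition_c
  rw [stdCurve, D.connectedComponentIn_eq]
  constructor
  · refine D.not_isHomogeneousCurve fun S hS => ?_
    obtain ⟨l, m, hl, hm, h⟩ :=
      monomial_of_act_quad D.admissible D.admissible (LevelDecomposition.act_conj hS)
    rw [eq_one_of_conj_c hl hm h]
    simp
  · rw [D.eq, isSingularAtInfinity_linSubst_iff]
    exact D.admissible.isSingularAtInfinity rfl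

/-! ### Closed smooth curves in the level set are open in the level set -/

theorem hasDerivAt_eval_line {h : MvPolynomial (Fin 2) ℝ} (hh : h.IsHomogeneous 4) (q v : Plane)
    (t : ℝ) : HasDerivAt (fun t : ℝ => eval (q + t • v) h)
      (v 0 * eval (q + t • v) (pderiv 0 h) + v 1 * eval (q + t • v) (pderiv 1 h)) t := by
  obtain ⟨a, b, c, d, e, rfl⟩ := exists_eq_quartic hh
  simp only [eval_quartic, eval_pderiv_zero_quartic, eval_pderiv_one_quartic, Pi.add_apply,
    Pi.smul_apply, smul_eq_mul]
  have hl : ∀ i, HasDerivAt (fun t : ℝ => q i + t * v i) (v i) t := fun i => by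
    simpa using ((hasDerivAt_id t).mul_const (v i)).const_add (q i)
  have h0 := hl 0
  have h1 := hl 1
  refine ((((((h0.pow 4).const_mul a).add (((h0.pow 3).const_mul b).mul h1)).add
    (((h0.pow 2).const_mul c).mul (h1.pow 2))).add ((h0.const_mul d).mul (h1.pow 3))).add
    ((h1.pow 4).const_mul e)).congr_deriv ?_
  simp only [Pi.pow_apply]
  ring

theorem euler_identity {h : MvPolynomial (Fin 2) ℝ} (hh : h.IsHomogeneous 4) (p : Plane) :
    p 0 * eval p (pderiv 0 h) + p 1 * eval p (pderiv 1 h) = 4 * eval p h := by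
  obtain ⟨a, b, c, d, e, rfl⟩ := exists_eq_quartic hh
  simp only [eval_quartic, eval_pderiv_zero_quartic, eval_pderiv_one_quartic]
  ring

theorem exists_sign_change {g : ℝ → ℝ} {g' : ℝ} (hg : HasDerivAt g g' 0) (h0 : g 0 = 0)
    (hg' : 0 < g') {ε : ℝ} (hε : 0 < ε) : ∃ t, 0 < t ∧ t < ε ∧ g (-t) < 0 ∧ 0 < g t := by
  have h1 := hasDerivAt_iff_tendsto_slope.1 hg
  have h2 := h1.eventually (lt_mem_nhds hg')
  rw [eventually_nhdsWithin_iff, Metric.eventually_nhds_iff] at h2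
  obtain ⟨δ, hδ, h⟩ := h2
  have ht : 0 < min δ ε / 2 := by positivity
  have hd : min δ ε / 2 < δ := by have := min_le_left δ ε; have := lt_min hδ hε; linarith
  refine ⟨min δ ε / 2, ht, by have := min_le_right δ ε; have := lt_min hδ hε; linarith, ?_, ?_⟩
  · have := h (y := -(min δ ε / 2)) (by simpa [abs_of_pos (lt_min hδ hε)] using hd) (by simpa using ht.ne')
    rw [slope_def_field, h0, sub_zero, sub_zero] at this
    rcases div_pos_iff.1 this with h | h
    · linarith [h.2]
    · exact h.1
  · have := h (y := min δ ε / 2) (by simpa [abs_of_pos (lt_min hδ hε)] using hd) (by simpa using ht.ne')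
    rw [slope_def_field, h0, sub_zero, sub_zero] at this
    rcases div_pos_iff.1 this with h | h
    · exact h.1
    · linarith [h.2]

/-- This is what makes a GPSR curve open in its level set. Choose a direction `v` transversal at `p`
both to `H = {F = 0}` and to `{h = 1}`. For `q` near `p` the function `F` changes sign along the
short segment `q + t v`, so the segment meets `H`. If `h q = 1`, then `h` takes the same value at
`q` and at the meeting point but is strictly monotone along the segment, so the two points agree. -/
theorem IsQuarticGPSRCurve.eventually_mem {h : MvPolynomial (Fin 2) ℝ} {H : Set Plane}
    (hH : IsQuarticGPSRCurve h H) {p : Plane} (hp : p ∈ H) :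
    ∀ᶠ q in nhds p, eval q h = 1 → q ∈ H := by
  have hh := hH.homogeneous
  obtain ⟨U, hU, hpU, F, hF, hF', hHU⟩ := hH.smooth p hp
  have hFp : F p = 0 := ((hHU ▸ ⟨hp, hpU⟩ : p ∈ {q ∈ U | F q = 0})).2
  have hFd : HasFDerivAt F (fderiv ℝ F p) p :=
    (((hF p hpU).contDiffAt (hU.mem_nhds hpU)).differentiableAt (by simp)).hasFDerivAt
  let dh : Plane → Plane → ℝ := fun q v =>
    v 0 * eval q (pderiv 0 h) + v 1 * eval q (pderiv 1 h)
  have hdhp : dh p p ≠ 0 := by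
    show p 0 * _ + p 1 * _ ≠ 0
    rw [euler_identity hh, hH.level p hp]; norm_num
  obtain ⟨v, hv1, hv2⟩ : ∃ v, 0 < fderiv ℝ F p v ∧ dh p v ≠ 0 := by
    -- Neither linear form is zero, and `dh` does not vanish on `p` by Euler, so one of `w`, `p`, `w
    -- + p` avoids both kernels.
    have key : ∃ v, fderiv ℝ F p v ≠ 0 ∧ dh p v ≠ 0 := by
      obtain ⟨w, hw⟩ : ∃ w, fderiv ℝ F p w ≠ 0 := by
        by_contra! hcon
        exact hF' p hpU (ContinuousLinearMap.ext hcon)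
      by_cases h1 : dh p w = 0
      · by_cases h2 : fderiv ℝ F p p = 0
        · refine ⟨w + p, by rwa [map_add, h2, add_zero], ?_⟩
          have : dh p (w + p) = dh p w + dh p p := by
            simp only [dh, Pi.add_apply]; ring
          rwa [this, h1, zero_add]
        · exact ⟨p, h2, hdhp⟩
      · exact ⟨w, hw, h1⟩
    obtain ⟨v, h1, h2⟩ := key
    rcases h1.lt_or_gt with h1 | h1
    · refine ⟨-v, by rw [map_neg]; linarith, ?_⟩
      have : dh p (-v) = -dh p v := by simp only [dh, Pi.neg_apply]; ring
      rw [this]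
      exact neg_ne_zero.2 h2
    · exact ⟨v, h1, h2⟩
  have hcont : Continuous fun q => dh q v :=
    (continuous_const.mul (continuous_eval _)).add (continuous_const.mul (continuous_eval _))
  obtain ⟨ε, hε, hball⟩ := Metric.mem_nhds_iff.1
    (Filter.inter_mem (hU.mem_nhds hpU) (hcont.continuousAt.eventually_ne hv2))
  have hvpos : 0 < ‖v‖ + 1 := by positivity
  have hline : HasDerivAt (fun t : ℝ => F (p + t • v)) (fderiv ℝ F p v) 0 := by
    have h1 : HasDerivAt (fun t : ℝ => p + t • v) v 0 := by
      simpa using ((hasDerivAt_id (0 : ℝ)).smul_const v).const_add p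
    have h2 : HasFDerivAt F (fderiv ℝ F p) (p + (0 : ℝ) • v) := by simpa using hFd
    exact h2.comp_hasDerivAt 0 h1
  obtain ⟨η, hη, hηlt, hneg, hpos⟩ := exists_sign_change hline (by simpa using hFp) hv1
    (ε := ε / 2 / (‖v‖ + 1)) (by positivity)
  have hηv : η * ‖v‖ < ε / 2 := by
    rw [lt_div_iff₀ hvpos] at hηlt
    nlinarith
  have hmem : ∀ q ∈ Metric.ball p (ε / 2), ∀ t ∈ Set.Icc (-η) η, q + t • v ∈ Metric.ball p ε := by
    intro q hq t ht
    rw [Metric.mem_ball, dist_eq_norm] at hq ⊢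
    calc ‖q + t • v - p‖ = ‖(q - p) + t • v‖ := by congr 1; abel
      _ ≤ ‖q - p‖ + ‖t • v‖ := norm_add_le _ _
      _ < ε / 2 + ε / 2 := by
        refine add_lt_add_of_lt_of_le hq ?_
        rw [norm_smul, Real.norm_eq_abs]
        exact (mul_le_mul_of_nonneg_right (abs_le.2 ht) (norm_nonneg v)).trans hηv.le
      _ = ε := by ring
  have hcF : ∀ t ∈ Set.Icc (-η) η, ContinuousAt (fun q => F (q + t • v)) p := by
    intro t ht
    have h1 := (hball (hmem p (Metric.mem_ball_self (by positivity)) t ht)).1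
    have h2 : ContinuousAt F (p + t • v) := hF.continuousOn.continuousAt (hU.mem_nhds h1)
    exact ContinuousAt.comp (f := fun q : Plane => q + t • v) h2
      (continuous_id.add continuous_const).continuousAt
  have hηmem : η ∈ Set.Icc (-η) η := ⟨by linarith, le_rfl⟩
  have hηmem' : -η ∈ Set.Icc (-η) η := ⟨le_rfl, by linarith⟩
  filter_upwards [Metric.ball_mem_nhds p (half_pos hε),
    (hcF η hηmem).eventually (lt_mem_nhds hpos),
    (hcF (-η) hηmem').eventually (gt_mem_nhds hneg)] with q hq h1 h2 hq1
  have hcl : ContinuousOn (fun t : ℝ => F (q + t • v)) (Set.Icc (-η) η) :=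
    hF.continuousOn.comp (by fun_prop) fun t ht => (hball (hmem q hq t ht)).1
  obtain ⟨t, ht, hFt⟩ := intermediate_value_Icc (by linarith) hcl ⟨h2.le, h1.le⟩
  have hqt : q + t • v ∈ H := by
    have : q + t • v ∈ {q ∈ U | F q = 0} := ⟨(hball (hmem q hq t ht)).1, hFt⟩
    rw [← hHU] at this
    exact this.1
  -- Rolle: otherwise the derivative of `h` in direction `v` would vanish inside the ball on which
  -- it is non-zero.
  have hzero : t = 0 := by
    by_contra hne
    have hd := fun s => hasDerivAt_eval_line hh q v s
    have hc : Continuous fun t : ℝ => eval (q + t • v) h :=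
      continuous_iff_continuousAt.2 fun s => (hd s).continuousAt
    have e1 : eval (q + t • v) h = eval (q + (0 : ℝ) • v) h := by
      rw [hH.level _ hqt]; simpa using hq1.symm
    rcases lt_or_gt_of_ne hne with hlt | hlt
    · obtain ⟨s, hs, hs0⟩ := exists_hasDerivAt_eq_zero hlt hc.continuousOn e1 fun s _ => hd s
      exact (hball (hmem q hq s ⟨by linarith [hs.1, ht.1], by linarith [hs.2]⟩)).2 hs0
    · obtain ⟨s, hs, hs0⟩ := exists_hasDerivAt_eq_zero hlt hc.continuousOn e1.symm fun s _ => hd s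
      exact (hball (hmem q hq s ⟨by linarith [hs.1], by linarith [hs.2, ht.2]⟩)).2 hs0
  rw [hzero, zero_smul, add_zero] at hqt
  exact hqt

/-! ### Clopen components of the level set. -/

/-- A hyperbolic connected component of `{h = 1}` that is closed and open in `{h = 1}`. -/
structure IsLevelComponent (h : MvPolynomial (Fin 2) ℝ) (H : Set Plane) : Prop where
  closed : IsClosed H
  connected : IsConnected H
  exists_isOpen : ∃ O, IsOpen O ∧ H = O ∩ {p | eval p h = 1}
  hyperbolic : ∀ p ∈ H, IsHyperbolicPoint h p

theorem IsQuarticCCGPSRCurve.isLevelComponent {h : MvPolynomial (Fin 2) ℝ} {H : Set Plane}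
    (hH : IsQuarticCCGPSRCurve h H) : IsLevelComponent h H where
  closed := hH.closed
  connected := hH.connected
  exists_isOpen := by
    refine ⟨interior {q | eval q h = 1 → q ∈ H}, isOpen_interior, ?_⟩
    ext p
    constructor
    · intro hp
      exact ⟨mem_interior_iff_mem_nhds.2 (hH.gpsr.eventually_mem hp), hH.gpsr.level p hp⟩
    · rintro ⟨hp, hp1⟩
      exact interior_subset hp hp1
  hyperbolic := hH.gpsr.hyperbolic

theorem IsLevelComponent.level {h : MvPolynomial (Fin 2) ℝ} {H : Set Plane}
    (hH : IsLevelComponent h H) : ∀ p ∈ H, eval p h = 1 := by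
  obtain ⟨O, -, rfl⟩ := hH.exists_isOpen
  exact fun p hp => hp.2

theorem IsLevelComponent.linSubst {h : MvPolynomial (Fin 2) ℝ} {H : Set Plane}
    (hH : IsLevelComponent h H) (B : GL (Fin 2) ℝ) :
    IsLevelComponent (linSubst B.val h) (act B⁻¹ H) where
  closed := isClosed_act _ hH.closed
  connected := isConnected_act _ hH.connected
  exists_isOpen := by
    obtain ⟨O, hO, hHO⟩ := hH.exists_isOpen
    refine ⟨(fun p => B.val.mulVec p) ⁻¹' O, hO.preimage (actHomeo B).continuous, ?_⟩
    ext p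
    rw [mem_act_inv, hHO]
    show _ ∧ _ ↔ _ ∧ _ = _
    rw [eval_linSubst]
    rfl
  hyperbolic p hp := (isHyperbolicPoint_linSubst_iff B).2 (hH.hyperbolic _ (mem_act_inv.1 hp))

theorem subset_of_isPreconnected_of_isOpen {h : MvPolynomial (Fin 2) ℝ} {H O T : Set Plane}
    (hcl : IsClosed H) (hO : IsOpen O) (hH : H = O ∩ {p | eval p h = 1}) (hT : IsPreconnected T)
    (hT1 : ∀ p ∈ T, eval p h = 1) {p : Plane} (hpT : p ∈ T) (hpH : p ∈ H) : T ⊆ H := by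
  have hmem : ∀ q ∈ T, q ∈ H ↔ q ∈ O := fun q hq => by
    rw [hH]
    exact ⟨fun h => h.1, fun h => ⟨h, hT1 q hq⟩⟩
  have hcover : T ⊆ O ∪ Hᶜ := by
    intro q hq
    by_cases hqH : q ∈ H
    · exact Or.inl ((hmem q hq).1 hqH)
    · exact Or.inr hqH
  have hdisj : T ∩ (O ∩ Hᶜ) = ∅ := by
    apply Set.eq_empty_of_forall_notMem
    rintro q ⟨hq, hqO, hqH⟩
    exact hqH ((hmem q hq).2 hqO)
  rcases isPreconnected_iff_subset_of_disjoint.1 hT O Hᶜ hO hcl.isOpen_compl hcover hdisj with h | h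
  · exact fun q hq => (hmem q hq).2 (h hq)
  · exact (h hpT hpH).elim

/-- Both sets are connected and clopen in the level set and share `p`, so each contains the other.
-/
theorem IsLevelComponent.eq_quad {a b c : ℝ} {H : Set Plane}
    (hH : IsLevelComponent (quartic 0 a b c 0) H)
    (hpos : ∀ p ∈ quadrant, 0 < eval p (quartic 0 a b c 0)) {p : Plane} (hp : p ∈ H)
    (hpq : p ∈ quadrant) : H = quad a b c := by
  have hpquad : p ∈ quad a b c := ⟨hpq, hH.level p hp⟩
  apply Set.Subset.antisymm
  · exact subset_of_isPreconnected_of_isOpen (isClosed_quad a b c) isOpen_quadrant rfl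
      hH.connected.isPreconnected hH.level hp hpquad
  · obtain ⟨O, hO, hHO⟩ := hH.exists_isOpen
    exact subset_of_isPreconnected_of_isOpen hH.closed hO hHO
      (isConnected_quad hpos).isPreconnected (fun q hq => hq.2) hpquad hp

/-! ### Standard form at a point -/

theorem exists_linSubst_eq_stdPoly {h : MvPolynomial (Fin 2) ℝ} (hh : h.IsHomogeneous 4)
    {p : Plane} (hp1 : eval p h = 1) (hp : IsHyperbolicPoint h p) :
    ∃ (B : GL (Fin 2) ℝ) (L K : ℝ), linSubst B.val h = stdPoly L K ∧
      B.val.mulVec ![1, 0] = p := by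
  have he := euler_identity hh p
  rw [hp1] at he
  -- The second column spans the kernel of `dh` at `p`, which removes the `x³y` term; by Euler the
  -- determinant is `4 h(p) = 4`.
  let B : GL (Fin 2) ℝ := Matrix.GeneralLinearGroup.mkOfDetNeZero
    !![p 0, -eval p (pderiv 1 h); p 1, eval p (pderiv 0 h)] (by
      rw [Matrix.det_fin_two_of]
      intro h0
      linarith)
  have hBval : B.val = !![p 0, -eval p (pderiv 1 h); p 1, eval p (pderiv 0 h)] := rfl
  have hB : B.val.mulVec ![1, 0] = p := by
    rw [hBval, mulVec_fin_two]
    ext i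
    fin_cases i <;> simp
  obtain ⟨a, b, c, d, e, hq⟩ := exists_eq_quartic (isHomogeneous_linSubst B.val hh)
  have ha : a = 1 := by
    have := eval_linSubst B.val h ![1, 0]
    rw [hB, hp1, hq, eval_quartic] at this
    simpa using this
  have hb : b = 0 := by
    have := eval_pderiv_one_quartic a b c d e ![1, 0]
    rw [← hq, pderiv_linSubst] at this
    rw [Fin.sum_univ_two] at this
    simp only [map_add, map_mul, eval_C, eval_linSubst, hB] at this
    rw [hBval] at this
    simp at this
    linarith
  -- At `(1, 0)` the Hessian is `diag(12, 2c)`, so hyperbolicity says `c < 0`; rescaling `y` then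
  -- makes this coefficient `-1`.
  have hc : c < 0 := by
    have := isHyperbolicPoint_linSubst B (h := h) (p := ![1, 0]) (by rwa [hB])
    rw [hq, isHyperbolicPoint_quartic] at this
    simp [ha, hb] at this
    linarith
  subst ha hb
  have hk : 0 < √(-c) := Real.sqrt_pos.2 (by linarith)
  have hk2 : √(-c) ^ 2 = -c := Real.sq_sqrt (by linarith)
  refine ⟨B * diagGL 1 (1 / √(-c)) one_pos (by positivity), d / √(-c) ^ 3, e / √(-c) ^ 4, ?_, ?_⟩
  · rw [Units.val_mul, linSubst_mul, hq]
    apply MvPolynomial.funext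
    intro q
    rw [eval_linSubst, diagGL_mulVec, eval_quartic, eval_stdPoly]
    simp only [Matrix.cons_val_zero, Matrix.cons_val_one]
    have hc' : c = -√(-c) ^ 2 := by linarith
    generalize √(-c) = k at *
    subst hc'
    field_simp
    ring
  · rw [Units.val_mul, ← Matrix.mulVec_mulVec, diagGL_mulVec]
    simpa using hB

/-! ### The end points of the arc -/

/-- With `f = 1 - y² + Ly³ + Ky⁴` the Hessian determinant at `(1, y)` is `12 f f'' - 9 f'²`. If `K <
0`, or if `K = 0` and `L ≤ 0`, then `f` becomes negative. Otherwise `f'` has a positive zero, where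
`f'' = 2 + 4Ky² > 0`, so `f > 0` makes the determinant positive there. -/
theorem not_forall_pos_and_hyperbolic (L K : ℝ) :
    ¬ ∀ y : ℝ, 0 ≤ y → 0 < 1 - y ^ 2 + L * y ^ 3 + K * y ^ 4 ∧
      (12 - 2 * y ^ 2) * (-2 + 6 * L * y + 12 * K * y ^ 2) - (-4 * y + 3 * L * y ^ 2) ^ 2 < 0 := by
  intro h
  have key : 0 ≤ K → ∀ y : ℝ, 0 ≤ y → -2 + 3 * L * y + 4 * K * y ^ 2 = 0 → False := by
    intro hK y hy hz
    obtain ⟨h1, h2⟩ := h y hy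
    have h3 : 0 ≤ K * y ^ 2 := by positivity
    have h4 : -2 + 6 * L * y + 12 * K * y ^ 2 = 4 * (K * y ^ 2) + 2 := by linarith
    have h5 : (12 - 2 * y ^ 2) * (-2 + 6 * L * y + 12 * K * y ^ 2) - (-4 * y + 3 * L * y ^ 2) ^ 2 =
        12 * (1 - y ^ 2 + L * y ^ 3 + K * y ^ 4) * (-2 + 6 * L * y + 12 * K * y ^ 2) -
          9 * y ^ 2 * (-2 + 3 * L * y + 4 * K * y ^ 2) ^ 2 := by ring
    rw [h5, hz, h4] at h2
    have : 0 < 12 * (1 - y ^ 2 + L * y ^ 3 + K * y ^ 4) * (4 * (K * y ^ 2) + 2) := by positivity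
    linarith
  rcases lt_trichotomy K 0 with hK | hK | hK
  · have hy : 1 ≤ (|L| + 1) / (-K) + 1 := by
      have : 0 ≤ (|L| + 1) / (-K) := div_nonneg (by positivity) (by linarith)
      linarith
    have hKy : K * ((|L| + 1) / (-K) + 1) ≤ -|L| - 1 := by
      have : K * ((|L| + 1) / (-K)) = -(|L| + 1) := by field_simp [hK.ne]
      linarith
    generalize (|L| + 1) / (-K) + 1 = y at hy hKy
    have h1 := (h y (by linarith)).1
    have h2 : L + K * y ≤ -1 := by linarith [le_abs_self L]
    have h3 : 0 ≤ y ^ 3 := by positivity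
    nlinarith [mul_nonneg h3 (sub_nonneg.2 h2)]
  · rcases le_or_gt L 0 with hL | hL
    · have := (h 2 (by norm_num)).1
      rw [hK] at this
      linarith
    · refine key hK.ge (2 / (3 * L)) (by positivity) ?_
      rw [hK]
      field_simp
      ring
  -- The non-negative root of the quadratic `f'(y) / y = -2 + 3Ly + 4Ky²`.
  · have hD : 0 ≤ 9 * L ^ 2 + 32 * K := by positivity
    have hs := Real.sq_sqrt hD
    have hge : 3 * L ≤ √(9 * L ^ 2 + 32 * K) := Real.le_sqrt_of_sq_le (by nlinarith)
    refine key hK.le ((-3 * L + √(9 * L ^ 2 + 32 * K)) / (8 * K))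
      (div_nonneg (by linarith) (by linarith)) ?_
    generalize √(9 * L ^ 2 + 32 * K) = s at *
    field_simp
    linear_combination 4 * hs

theorem pos_of_forall_ne_zero {f : ℝ → ℝ} (hf : Continuous f) (h0 : 0 < f 0) {y : ℝ} (hy : 0 ≤ y)
    (hne : ∀ z, 0 ≤ z → z ≤ y → f z ≠ 0) : 0 < f y := by
  by_contra! hle
  obtain ⟨z, hz, hz0⟩ := intermediate_value_Icc' hy hf.continuousOn ⟨hle, h0.le⟩
  exact hne z hz.1 hz.2 hz0

theorem eval_stdPoly_one (L K y : ℝ) :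
    eval ![1, y] (stdPoly L K) = 1 - y ^ 2 + L * y ^ 3 + K * y ^ 4 := by
  rw [eval_stdPoly]; simp

theorem IsLevelComponent.exists_root {L K : ℝ} {H : Set Plane}
    (hH : IsLevelComponent (stdPoly L K) H) (hbase : ![1, 0] ∈ H) :
    ∃ b : ℝ, 0 < b ∧ eval ![1, b] (stdPoly L K) = 0 ∧
      ∀ y, 0 ≤ y → y < b → 0 < eval ![1, y] (stdPoly L K) := by
  set f : ℝ → ℝ := fun y => eval ![1, y] (stdPoly L K) with hf
  have hfc : Continuous f := by
    simp only [hf, eval_stdPoly_one]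
    fun_prop
  have hf0 : f 0 = 1 := by simp [hf, eval_stdPoly_one]
  have hex : ∃ b, 0 ≤ b ∧ f b = 0 := by
    by_contra! hne
    have hpos : ∀ y, 0 ≤ y → 0 < f y := fun y hy =>
      pos_of_forall_ne_zero hfc (by rw [hf0]; exact one_pos) hy fun z hz _ => hne z hz
    -- If `f` had no zero, the projections of all `(1, y)`, `y ≥ 0`, would form a connected subset
    -- of the level set through `(1, 0)`, hence lie in `H` and be hyperbolic.
    have hT : IsPreconnected ((fun y : ℝ => radialProj (stdPoly L K) ![1, y]) '' Set.Ici 0) := by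
      refine isPreconnected_Ici.image _ ?_
      refine (continuousOn_radialProj (stdPoly L K)).comp (Continuous.continuousOn ?_) hpos
      refine continuous_pi fun i => ?_
      fin_cases i
      · exact continuous_const
      · exact continuous_id
    obtain ⟨O, hO, hHO⟩ := hH.exists_isOpen
    have hsub := subset_of_isPreconnected_of_isOpen hH.closed hO hHO hT (by
      rintro _ ⟨y, hy, rfl⟩
      exact eval_radialProj (isHomogeneous_stdPoly L K) (hpos y hy))
      (p := ![1, 0]) ⟨0, Set.self_mem_Ici, radialProj_of_eval_eq_one hf0⟩ hbase
    refine not_forall_pos_and_hyperbolic L K fun y hy => ?_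
    have h1 := hpos y hy
    have h2 := hH.hyperbolic _ (hsub ⟨y, hy, rfl⟩)
    have h3 := radialProj_scale_pos h1
    simp only [radialProj] at h2
    generalize (√√(eval ![1, y] (stdPoly L K)))⁻¹ = r at h2 h3
    rw [stdPoly_eq_quartic, isHyperbolicPoint_quartic] at h2
    simp only [Pi.smul_apply, smul_eq_mul, Matrix.cons_val_zero, Matrix.cons_val_one] at h2
    refine ⟨by simpa only [hf, eval_stdPoly_one] using h1, ?_⟩
    -- The Hessian determinant is homogeneous of degree `4`, so its sign at the projected point is
    -- the sign at `(1, y)`.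
    have h4 : r ^ 4 * ((12 - 2 * y ^ 2) * (-2 + 6 * L * y + 12 * K * y ^ 2) -
        (-4 * y + 3 * L * y ^ 2) ^ 2) < 0 := by
      refine lt_of_eq_of_lt ?_ h2
      ring
    exact (pos_iff_neg_of_mul_neg h4).1 (by positivity)
  have hScl : IsClosed {y : ℝ | 0 ≤ y ∧ f y = 0} :=
    (isClosed_le continuous_const continuous_id).inter (isClosed_eq hfc continuous_const)
  have hbdd : BddBelow {y : ℝ | 0 ≤ y ∧ f y = 0} := ⟨0, fun y hy => hy.1⟩
  obtain ⟨hb0, hb⟩ := hScl.csInf_mem hex hbdd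
  refine ⟨sInf {y : ℝ | 0 ≤ y ∧ f y = 0}, lt_of_le_of_ne hb0 fun h0 => ?_, hb, ?_⟩
  · rw [← h0, hf0] at hb
    exact one_ne_zero hb
  · intro y hy hyb
    refine pos_of_forall_ne_zero hfc (by rw [hf0]; exact one_pos) hy fun z hz hzy hz0 => ?_
    exact absurd (csInf_le hbdd ⟨hz, hz0⟩) (by linarith)

theorem linSubst_reflYGL_stdPoly (L K : ℝ) :
    linSubst reflYGL.val (stdPoly L K) = stdPoly (-L) K := by
  apply MvPolynomial.funext
  intro p
  rw [eval_linSubst, reflYGL_val, reflY, mulVec_fin_two, eval_stdPoly, eval_stdPoly]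
  simp only [Matrix.cons_val_zero, Matrix.cons_val_one]
  ring

/-- A level component of a form in standard position is, in suitable linear coordinates, an arc in
the open first quadrant. -/
theorem IsLevelComponent.exists_equivalent_quad {L K : ℝ} {H : Set Plane}
    (hH : IsLevelComponent (stdPoly L K) H) (hbase : ![1, 0] ∈ H) :
    ∃ a b c : ℝ, (∀ p ∈ quadrant, 0 < eval p (quartic 0 a b c 0)) ∧
      (∀ p ∈ quad a b c, IsHyperbolicPoint (quartic 0 a b c 0) p) ∧
      Equivalent H (quad a b c) := by
  obtain ⟨b, hb, hfb, hposb⟩ := hH.exists_root hbase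
  have hH' := hH.linSubst reflYGL
  rw [linSubst_reflYGL_stdPoly] at hH'
  obtain ⟨a, ha, hfa, hposa⟩ := hH'.exists_root (by
    rw [mem_act_inv, reflYGL_val, reflY, mulVec_fin_two]
    simpa using hbase)
  have hrefl : ∀ y, eval ![1, y] (stdPoly (-L) K) = eval ![1, -y] (stdPoly L K) := by
    intro y
    rw [eval_stdPoly_one, eval_stdPoly_one]
    ring
  simp only [hrefl] at hfa hposa
  have hpos : ∀ y, -a < y → y < b → 0 < eval ![1, y] (stdPoly L K) := by
    intro y h1 h2
    rcases le_total 0 y with h | h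
    · exact hposb y h h2
    · have := hposa (-y) (by linarith) (by linarith)
      rwa [neg_neg] at this
  -- The columns `(1, b)` and `(1, -a)` span the zero rays nearest to `(1, 0)` on either side, so
  -- they become the coordinate axes.
  let B : GL (Fin 2) ℝ := Matrix.GeneralLinearGroup.mkOfDetNeZero !![1, 1; b, -a] (by
    rw [Matrix.det_fin_two_of]
    intro h0
    linarith)
  have hB : ∀ p : Plane, B.val.mulVec p = ![p 0 + p 1, b * p 0 - a * p 1] := by
    intro p
    show Matrix.mulVec !![1, 1; b, -a] p = _
    rw [mulVec_fin_two, one_mul, one_mul, neg_mul, ← sub_eq_add_neg]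
  have hG := hH.linSubst B
  obtain ⟨a0, a1, a2, a3, a4, hq⟩ :=
    exists_eq_quartic (isHomogeneous_linSubst B.val (isHomogeneous_stdPoly L K))
  have hz0 : a0 = 0 := by
    have := eval_linSubst B.val (stdPoly L K) ![1, 0]
    rw [hB, hq, eval_quartic] at this
    simpa [hfb] using this
  have hz4 : a4 = 0 := by
    have := eval_linSubst B.val (stdPoly L K) ![0, 1]
    rw [hB, hq, eval_quartic] at this
    simpa [hfa] using this
  subst hz0 hz4
  rw [hq] at hG
  have hposq : ∀ p ∈ quadrant, 0 < eval p (quartic 0 a1 a2 a3 0) := by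
    rintro p ⟨h0, h1⟩
    have hs : 0 < p 0 + p 1 := add_pos h0 h1
    have hp : ![p 0 + p 1, b * p 0 - a * p 1] =
        (p 0 + p 1) • ![1, (b * p 0 - a * p 1) / (p 0 + p 1)] := by
      ext i
      fin_cases i
      · simp
      · simp; field_simp
    rw [← hq, eval_linSubst, hB, hp, eval_smul_of_isHomogeneous (isHomogeneous_stdPoly L K)]
    -- The slope is a weighted mean of `b` and `-a` with positive weights, so it lies strictly
    -- between the two zeros.
    refine mul_pos (by positivity) (hpos _ ?_ ?_)
    · rw [lt_div_iff₀ hs]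
      nlinarith [mul_pos ha h0, mul_pos hb h0]
    · rw [div_lt_iff₀ hs]
      nlinarith [mul_pos ha h1, mul_pos hb h1]
  -- The vector with coordinates `a/(a+b)`, `b/(a+b)` is the base point `(1, 0)` in the new basis.
  have heq := hG.eq_quad hposq (p := ![a / (a + b), b / (a + b)]) (by
    rw [mem_act_inv, hB]
    have : (![a / (a + b) + b / (a + b), b * (a / (a + b)) - a * (b / (a + b))] : Plane) =
        ![1, 0] := by
      have : a + b ≠ 0 := by positivity
      ext i
      fin_cases i
      · simp; field_simp
      · simp; field_simp; ring
    simpa [this] using hbase) ⟨by simp; positivity, by simp; positivity⟩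
  exact ⟨a1, a2, a3, hposq, fun p hp => hG.hyperbolic p (heq ▸ hp), ⟨B⁻¹, heq⟩⟩

/-! ### Normal forms of arcs in the quadrant -/

theorem nonneg_of_quadratic_pos {a b c : ℝ} (h : ∀ t : ℝ, 0 < t → 0 < a * t ^ 2 + b * t + c) :
    0 ≤ a := by
  by_contra! ha
  have h0 : 0 ≤ (|b| + |c|) / (-a) := div_nonneg (by positivity) (by linarith)
  have h1 := h ((|b| + |c|) / (-a) + 1) (by linarith)
  have h2 : a * ((|b| + |c|) / (-a) + 1) = -(|b| + |c|) + a := by field_simp [ha.ne]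
  have ht : 1 ≤ (|b| + |c|) / (-a) + 1 := by linarith
  generalize (|b| + |c|) / (-a) + 1 = t at h1 h2 ht
  have h3 := mul_le_mul_of_nonneg_right (le_abs_self b) (show 0 ≤ t by linarith)
  have h4 := mul_le_mul_of_nonneg_left ht (abs_nonneg c)
  have h5 := le_abs_self c
  have h6 : a * t ^ 2 = (-(|b| + |c|) + a) * t := by rw [← h2]; ring
  nlinarith

theorem nonneg_of_affine_pos {a b : ℝ}
    (h : ∀ t : ℝ, 0 < t → 0 < a * t ^ 2 + b * t) : 0 ≤ b := by
  refine nonneg_of_quadratic_pos (a := b) (b := a) (c := 0) fun t ht => ?_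
  have h1 := h t⁻¹ (inv_pos.2 ht)
  have h2 : b * t ^ 2 + a * t + 0 = (a * t⁻¹ ^ 2 + b * t⁻¹) * t ^ 3 := by field_simp; ring
  rw [h2]
  positivity

/-- Positivity towards the two axes gives `a, c ≥ 0`, and also `b ≥ 0` if one of them vanishes. If
both are positive, hyperbolicity on the ray where `a x² = c y²` forces `b > 0`. -/
theorem admissible_or_of_hyperbolic {a b c : ℝ}
    (hpos : ∀ p ∈ quadrant, 0 < eval p (quartic 0 a b c 0))
    (hhyp : ∀ p ∈ quad a b c, IsHyperbolicPoint (quartic 0 a b c 0) p) :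
    Admissible a b c ∨ Admissible c b a := by
  have hq : ∀ x y : ℝ, 0 < x → 0 < y → 0 < a * x ^ 2 + b * x * y + c * y ^ 2 := by
    intro x y hx hy
    have := hpos ![x, y] ⟨hx, hy⟩
    rw [eval_quartic_of_zero] at this
    exact pos_of_mul_pos_right this (mul_pos hx hy).le
  have hhyp' : ∀ x y : ℝ, 0 < x → 0 < y → 0 < (a * x ^ 2 - c * y ^ 2) ^ 2 * 3 +
      4 * b ^ 2 * x ^ 2 * y ^ 2 + 4 * b * x * y * (a * x ^ 2 + c * y ^ 2) := by
    intro x y hx hy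
    have hp : (![x, y] : Plane) ∈ quadrant := ⟨hx, hy⟩
    have h1 := radialProj_scale_pos (hpos _ hp)
    have h2 := hhyp (radialProj (quartic 0 a b c 0) ![x, y])
      (by rw [quad_eq_image hpos]; exact ⟨_, hp, rfl⟩)
    simp only [radialProj] at h2
    generalize (√√(eval ![x, y] (quartic 0 a b c 0)))⁻¹ = r at h1 h2
    rw [isHyperbolicPoint_quartic] at h2
    simp only [Pi.smul_apply, smul_eq_mul, Matrix.cons_val_zero, Matrix.cons_val_one] at h2
    have h3 : 0 < (3 * r ^ 4) * ((a * x ^ 2 - c * y ^ 2) ^ 2 * 3 +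
      4 * b ^ 2 * x ^ 2 * y ^ 2 + 4 * b * x * y * (a * x ^ 2 + c * y ^ 2)) := by
      linarith
    exact pos_of_mul_pos_right h3 (by positivity)
  have ha : 0 ≤ a := nonneg_of_quadratic_pos (b := b) (c := c) fun t ht => by
    have := hq t 1 ht one_pos
    linarith
  have hc : 0 ≤ c := nonneg_of_quadratic_pos (b := b) (c := a) fun t ht => by
    have := hq 1 t one_pos ht
    linarith
  have h11 := hq 1 1 one_pos one_pos
  rcases ha.eq_or_lt with ha0 | ha0 <;> rcases hc.eq_or_lt with hc0 | hc0
  · subst ha0 hc0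
    have hb : 0 < b := by linarith
    exact Or.inl ⟨le_rfl, hb.le, le_rfl, Or.inl hb⟩
  · subst ha0
    have hb : 0 ≤ b := nonneg_of_affine_pos (a := c) fun t ht => by
      have := hq 1 t one_pos ht
      linarith
    exact Or.inr ⟨hc, hb, le_rfl, Or.inr ⟨hc0, rfl⟩⟩
  · subst hc0
    have hb : 0 ≤ b := nonneg_of_affine_pos (a := a) fun t ht => by
      have := hq t 1 ht one_pos
      linarith
    exact Or.inl ⟨ha, hb, le_rfl, Or.inr ⟨ha0, rfl⟩⟩
  · have hsa : 0 < √a := Real.sqrt_pos.2 ha0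
    have hsc : 0 < √c := Real.sqrt_pos.2 hc0
    -- At `(√c, √a)` the square vanishes and the remainder is `4bxy` times the positive value `a x²
    -- + b xy + c y²`.
    have h1 := hhyp' (√c) (√a) hsc hsa
    have h2 := hq (√c) (√a) hsc hsa
    have ea : √a ^ 2 = a := Real.sq_sqrt ha
    have ec : √c ^ 2 = c := Real.sq_sqrt hc
    have h3 : 0 < b * (4 * (√c * √a) * (a * √c ^ 2 + b * √c * √a + c * √a ^ 2)) := by
      have h5 : (a * √c ^ 2 - c * √a ^ 2) ^ 2 * 3 = 0 := by rw [ea, ec]; ring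
      rw [h5] at h1
      refine lt_of_lt_of_eq h1 ?_
      ring
    have hb : 0 < b := pos_of_mul_pos_left h3 (by positivity)
    exact Or.inl ⟨ha, hb.le, hc, Or.inl hb⟩

/-- Every closed connected quartic GPSR curve is equivalent to an admissible arc. -/
theorem IsQuarticCCGPSRCurve.exists_admissible {h : MvPolynomial (Fin 2) ℝ} {H : Set Plane}
    (hH : IsQuarticCCGPSRCurve h H) :
    ∃ a b c : ℝ, Admissible a b c ∧ Equivalent H (quad a b c) := by
  obtain ⟨p, hp⟩ := hH.connected.nonempty
  obtain ⟨B, L, K, hB, hBp⟩ := exists_linSubst_eq_stdPoly hH.gpsr.homogeneous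
    (hH.gpsr.level p hp) (hH.gpsr.hyperbolic p hp)
  have hG := hH.isLevelComponent.linSubst B
  rw [hB] at hG
  obtain ⟨a, b, c, hpos, hhyp, heq⟩ := hG.exists_equivalent_quad
    (by rw [mem_act_inv, hBp]; exact hp)
  have heq' : Equivalent H (quad a b c) := Equivalent.trans ⟨B⁻¹, rfl⟩ heq
  rcases admissible_or_of_hyperbolic hpos hhyp with h | h
  · exact ⟨a, b, c, h, heq'⟩
  · exact ⟨c, b, a, h, heq'.trans (equivalent_quad_swap a b c)⟩

/-! ### Normal forms: existence and uniqueness. -/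

/-- The list of normal forms in the quadrant, with the corresponding parameters `(L, K)`. -/
def IsNormalForm (q : ℝ × ℝ) (a b c : ℝ) : Prop :=
  (q = (0, 1 / 4) ∧ a = 0 ∧ b = 1 ∧ c = 0) ∨
  (q = (Lb, -1 / 12) ∧ a = 1 ∧ b = 0 ∧ c = 0) ∨
  (q = (Lc, 0) ∧ a = 2 / 3 ∧ b = 1 / 3 ∧ c = 0) ∨
  ∃ s : ℝ, 0 < s ∧ 1 / 2 < s ^ 2 ∧ q = (0, s ^ 2 - s ^ 4) ∧
    a = (2 * s ^ 2 - 1) / (4 * s ^ 2) ∧ b = 1 / (2 * s ^ 2) ∧ c = (2 * s ^ 2 - 1) / (4 * s ^ 2)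

theorem param_lt {s : ℝ} (hs : 1 / 2 < s ^ 2) : s ^ 2 - s ^ 4 < 1 / 4 := by
  have : 0 < (s ^ 2 - 1 / 2) ^ 2 := pow_pos (by linarith) 2
  nlinarith

theorem IsNormalForm.exists_levelDecomposition {q : ℝ × ℝ} {a b c : ℝ}
    (hq : IsNormalForm q a b c) : ∃ (B : GL (Fin 2) ℝ) (n : ℕ) (g : Fin (n + 1) → GL (Fin 2) ℝ),
      LevelDecomposition (stdPoly q.1 q.2) a b c B g := by
  rcases hq with ⟨rfl, rfl, rfl, rfl⟩ | ⟨rfl, rfl, rfl, rfl⟩ | ⟨rfl, rfl, rfl, rfl⟩ |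
    ⟨s, hs, hs2, rfl, rfl, rfl, rfl⟩
  · exact ⟨_, _, _, levelDecomposition_a⟩
  · exact ⟨_, _, _, levelDecomposition_b⟩
  · exact ⟨_, _, _, levelDecomposition_c⟩
  · obtain ⟨n, g, D⟩ := exists_levelDecomposition_of_lt hs hs2 rfl
    exact ⟨_, n, g, D⟩

theorem IsNormalForm.mem_classList {q : ℝ × ℝ} {a b c : ℝ} (hq : IsNormalForm q a b c) :
    q ∈ classList := by
  rcases hq with ⟨rfl, -⟩ | ⟨rfl, -⟩ | ⟨rfl, -⟩ | ⟨s, hs, hs2, rfl, -⟩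
  · exact Or.inl (Or.inl rfl)
  · exact Or.inl (Or.inr (Or.inl rfl))
  · exact Or.inl (Or.inr (Or.inr rfl))
  · exact Or.inr ⟨rfl, param_lt hs2⟩

theorem exists_isNormalForm {q : ℝ × ℝ} (hq : q ∈ classList) : ∃ a b c, IsNormalForm q a b c := by
  rcases hq with (rfl | rfl | rfl) | ⟨h1, h2⟩
  · exact ⟨_, _, _, Or.inl ⟨rfl, rfl, rfl, rfl⟩⟩
  · exact ⟨_, _, _, Or.inr (Or.inl ⟨rfl, rfl, rfl, rfl⟩)⟩
  · exact ⟨_, _, _, Or.inr (Or.inr (Or.inl ⟨rfl, rfl, rfl, rfl⟩))⟩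
  · obtain ⟨s, hs, hs2, hK⟩ := exists_param_of_lt h2
    exact ⟨_, _, _, Or.inr (Or.inr (Or.inr ⟨s, hs, hs2, Prod.ext h1 hK, rfl, rfl, rfl⟩))⟩

theorem IsNormalForm.equivalent {q : ℝ × ℝ} {a b c : ℝ} (hq : IsNormalForm q a b c) :
    Equivalent (quad a b c) (stdCurve q.1 q.2) := by
  obtain ⟨B, n, g, D⟩ := hq.exists_levelDecomposition
  rw [stdCurve, D.connectedComponentIn_eq]
  exact ⟨B⁻¹, rfl⟩

theorem IsNormalForm.admissible {q : ℝ × ℝ} {a b c : ℝ} (hq : IsNormalForm q a b c) :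
    Admissible a b c := by
  obtain ⟨B, n, g, D⟩ := hq.exists_levelDecomposition
  exact D.admissible

theorem exists_pow_four_mul_eq {x y : ℝ} (hx : 0 < x) (hy : 0 < y) :
    ∃ r : ℝ, 0 < r ∧ r ^ 4 * x = y := by
  refine ⟨√√(y / x), Real.sqrt_pos.2 (Real.sqrt_pos.2 (div_pos hy hx)), ?_⟩
  rw [show ∀ r : ℝ, r ^ 4 = (r ^ 2) ^ 2 by intro r; ring, Real.sq_sqrt (Real.sqrt_nonneg _),
    Real.sq_sqrt (div_pos hy hx).le, div_mul_cancel₀ _ hx.ne']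

/-- Every admissible arc is equivalent to one in normal form. -/
theorem Admissible.exists_isNormalForm {a b c : ℝ} (H : Admissible a b c) :
    ∃ q a' b' c', IsNormalForm q a' b' c' ∧ Equivalent (quad a b c) (quad a' b' c') := by
  have hc_zero : ∀ {a b : ℝ}, Admissible a b 0 → ∃ q a' b' c', IsNormalForm q a' b' c' ∧
      Equivalent (quad a b 0) (quad a' b' c') := by
    intro a b H
    rcases H.a_nonneg.eq_or_lt with ha | ha
    · subst ha
      have hb : 0 < b := by rcases H.pos with h | h; exacts [h, absurd h.1 (lt_irrefl 0)]
      obtain ⟨r, hr, hrb⟩ := exists_pow_four_mul_eq hb one_pos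
      refine ⟨_, _, _, _, Or.inl ⟨rfl, rfl, rfl, rfl⟩, ?_⟩
      convert equivalent_quad_scale hr hr 0 b 0 using 2
      · ring
      · rw [← hrb]; ring
      · ring
    · rcases H.b_nonneg.eq_or_lt with hb | hb
      · subst hb
        obtain ⟨r, hr, hra⟩ := exists_pow_four_mul_eq ha one_pos
        refine ⟨_, _, _, _, Or.inr (Or.inl ⟨rfl, rfl, rfl, rfl⟩), ?_⟩
        convert equivalent_quad_scale hr hr a 0 0 using 2
        · rw [← hra]; ring
        · ring
        · ring
      -- Here `k` is to be the product `lm`: `k² b = 1/3` fixes it, and then `l² k a = 2/3` fixes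
      -- `l`.
      · have hk : 0 < √(1 / (3 * b)) := Real.sqrt_pos.2 (by positivity)
        have hk2 : √(1 / (3 * b)) ^ 2 = 1 / (3 * b) := Real.sq_sqrt (by positivity)
        generalize √(1 / (3 * b)) = k at hk hk2
        have hl : 0 < √(2 / (3 * a * k)) := Real.sqrt_pos.2 (by positivity)
        have hl2 : √(2 / (3 * a * k)) ^ 2 = 2 / (3 * a * k) := Real.sq_sqrt (by positivity)
        generalize √(2 / (3 * a * k)) = l at hl hl2
        refine ⟨_, _, _, _, Or.inr (Or.inr (Or.inl ⟨rfl, rfl, rfl, rfl⟩)), ?_⟩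
        have hlk : l * (k / l) = k := by field_simp
        convert equivalent_quad_scale hl (div_pos hk hl) a b 0 using 2
        · rw [show l ^ 3 * (k / l) * a = l ^ 2 * (l * (k / l)) * a by ring, hlk, hl2]
          field_simp
        · rw [hlk, hk2]
          field_simp
        · ring
  rcases H.c_nonneg.eq_or_lt with hc | hc
  · subst hc
    exact hc_zero H
  have hb : 0 < b := by
    rcases H.pos with h | h
    · exact h
    · exact absurd h.2 hc.ne'
  rcases H.a_nonneg.eq_or_lt with ha | ha
  · subst ha
    obtain ⟨q, a', b', c', hq, he⟩ :=
      hc_zero (a := c) (b := b) ⟨H.c_nonneg, H.b_nonneg, le_rfl, Or.inl hb⟩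
    exact ⟨q, a', b', c', hq, (equivalent_quad_swap 0 b c).trans he⟩
  · have hsa : 0 < √a := Real.sqrt_pos.2 ha
    have hsc : 0 < √c := Real.sqrt_pos.2 hc
    have ea : √a ^ 2 = a := Real.sq_sqrt ha.le
    have ec : √c ^ 2 = c := Real.sq_sqrt hc.le
    generalize √a = u at hsa ea
    generalize √c = v at hsc ec
    subst ea ec
    have hr : 0 < 2 * (u * v) / b := by positivity
    -- With `a = u²`, `c = v²`, the scaling by `(rv, ru)` makes the outer coefficients equal, with
    -- ratio `uv/b` to the middle one. In the normal form this ratio is `(2s² - 1)/2`, which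
    -- determines `s²`; `r` then fixes the overall size.
    have hs2 : √((1 + 2 * (u * v) / b) / 2) ^ 2 = (1 + 2 * (u * v) / b) / 2 :=
      Real.sq_sqrt (by positivity)
    have hs : 0 < √((1 + 2 * (u * v) / b) / 2) := Real.sqrt_pos.2 (by positivity)
    generalize √((1 + 2 * (u * v) / b) / 2) = s at hs hs2
    obtain ⟨r, hr0, hrb⟩ := exists_pow_four_mul_eq (x := (u * v) ^ 2 * b) (y := 1 / (2 * s ^ 2))
      (by positivity) (by positivity)
    refine ⟨_, _, _, _, Or.inr (Or.inr (Or.inr ⟨s, hs, by rw [hs2]; linarith, rfl, rfl, rfl,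
      rfl⟩)), ?_⟩
    have h1 : (2 * s ^ 2 - 1) / (4 * s ^ 2) = (u * v) / b * (1 / (2 * s ^ 2)) := by
      have : 2 * s ^ 2 - 1 = 2 * (u * v) / b := by rw [hs2]; ring
      rw [this]
      field_simp
      ring
    convert equivalent_quad_scale (mul_pos hr0 hsc) (mul_pos hr0 hsa) (u ^ 2) b (v ^ 2) using 2
    · rw [h1, ← hrb]
      field_simp
    · rw [← hrb]; ring
    · rw [h1, ← hrb]
      field_simp

/-- Positive scaling preserves which coefficients vanish, and this separates the four types. Within
the last one, equality of the outer coefficients gives `x = z`, hence `y = x`, so the ratio of outer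
to middle coefficient, and with it `s²`, is the same on both sides. -/
theorem IsNormalForm.eq_of_scale {q q' : ℝ × ℝ} {a b c a' b' c' : ℝ} (hq : IsNormalForm q a b c)
    (hq' : IsNormalForm q' a' b' c') {x y z : ℝ} (hx : 0 < x) (hy : 0 < y) (hz : 0 < z)
    (hxyz : y ^ 2 = x * z) (ha : a = x * a') (hb : b = y * b') (hc : c = z * c') : q = q' := by
  have hs0 : ∀ s : ℝ, 1 / 2 < s ^ 2 → 0 < (2 * s ^ 2 - 1) / (4 * s ^ 2) := fun s hs =>
    div_pos (by linarith) (by linarith)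
  rcases hq with ⟨rfl, rfl, rfl, rfl⟩ | ⟨rfl, rfl, rfl, rfl⟩ | ⟨rfl, rfl, rfl, rfl⟩ |
    ⟨s, hs, hs2, rfl, rfl, rfl, rfl⟩ <;>
  rcases hq' with ⟨rfl, rfl, rfl, rfl⟩ | ⟨rfl, rfl, rfl, rfl⟩ | ⟨rfl, rfl, rfl, rfl⟩ |
    ⟨s', hs', hs2', rfl, rfl, rfl, rfl⟩
  · rfl
  · linarith
  · linarith
  · linarith [mul_pos hx (hs0 s' hs2')]
  · linarith
  · rfl
  · linarith
  · linarith [mul_pos hz (hs0 s' hs2')]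
  · linarith
  · linarith
  · rfl
  · linarith [mul_pos hz (hs0 s' hs2')]
  · linarith [hs0 s hs2]
  · linarith [hs0 s hs2]
  · linarith [hs0 s hs2]
  · have h1 : x = z := mul_right_cancel₀ (hs0 s' hs2').ne' (ha.symm.trans hc)
    have h2 : y = x := by
      rw [← h1, ← pow_two] at hxyz
      exact (pow_left_inj₀ hy.le hx.le two_ne_zero).1 hxyz
    rw [h2] at hb
    have h3 : (2 * s ^ 2 - 1) / (4 * s ^ 2) * (1 / (2 * s' ^ 2)) =
        (2 * s' ^ 2 - 1) / (4 * s' ^ 2) * (1 / (2 * s ^ 2)) := by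
      rw [ha, hb]; ring
    have h4 : s ^ 2 = s' ^ 2 := by
      field_simp at h3
      linarith
    rw [show s ^ 4 = (s ^ 2) ^ 2 by ring, h4]
    congr 1
    ring

theorem IsNormalForm.eq_of_equivalent {q q' : ℝ × ℝ} {a b c a' b' c' : ℝ}
    (hq : IsNormalForm q a b c) (hq' : IsNormalForm q' a' b' c')
    (h : Equivalent (quad a b c) (quad a' b' c')) : q = q' := by
  obtain ⟨A, hA⟩ := h
  obtain ⟨l, m, hl, hm, ⟨-, h1, h2, h3⟩ | ⟨-, h1, h2, h3⟩⟩ :=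
    monomial_of_act_quad hq.admissible hq'.admissible hA
  · exact hq.eq_of_scale hq' (x := l ^ 3 * m) (y := (l * m) ^ 2) (z := l * m ^ 3) (by positivity)
      (by positivity) (by positivity) (by ring) h1 h2 h3
  · have hca : ∀ {q : ℝ × ℝ} {a b c : ℝ}, IsNormalForm q a b c → c = 0 ∨ a = c := by
      intro q a b c h
      rcases h with ⟨-, -, -, h⟩ | ⟨-, -, -, h⟩ | ⟨-, -, -, h⟩ | ⟨s, -, -, -, h, -, h'⟩
      exacts [Or.inl h, Or.inl h, Or.inl h, Or.inr (h.trans h'.symm)]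
    -- Every normal form has `c = 0` or `a = c`. If a swap relates two of them, its scaling
    -- relations force `a' = c'`, so the swap can be read as a diagonal scaling.
    have hac : a' = c' := by
      rcases hca hq' with h | h
      · have ha : a = 0 := by rw [h1, h, mul_zero]
        rcases hca hq with h' | h'
        · have : l ^ 3 * m * a' = 0 := by rw [← h3, h']
          rw [(mul_eq_zero.1 this).resolve_left (by positivity), h]
        · have : l ^ 3 * m * a' = 0 := by rw [← h3, ← h', ha]
          rw [(mul_eq_zero.1 this).resolve_left (by positivity), h]
      · exact h
    rw [← hac] at h1
    rw [hac] at h3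
    exact hq.eq_of_scale hq' (x := l * m ^ 3) (y := (l * m) ^ 2) (z := l ^ 3 * m) (by positivity)
      (by positivity) (by positivity) (by ring) h1 h2 h3

theorem IsQuarticCCGPSRCurve.existsUnique {h : MvPolynomial (Fin 2) ℝ} {H : Set Plane}
    (hH : IsQuarticCCGPSRCurve h H) :
    ∃! q : ℝ × ℝ, q ∈ classList ∧ Equivalent H (stdCurve q.1 q.2) := by
  obtain ⟨a, b, c, hadm, heq⟩ := hH.exists_admissible
  obtain ⟨q, a', b', c', hq, heq'⟩ := hadm.exists_isNormalForm
  refine ⟨q, ⟨hq.mem_classList, (heq.trans heq').trans hq.equivalent⟩, ?_⟩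
  rintro q₂ ⟨hmem, h2⟩
  obtain ⟨a₂, b₂, c₂, hq₂⟩ := QuarticGPSR.exists_isNormalForm hmem
  exact hq₂.eq_of_equivalent hq ((hq₂.equivalent.trans h2.symm).trans (heq.trans heq'))

theorem isQuarticCCGPSRCurve_stdCurve {q : ℝ × ℝ} (hq : q ∈ classList) :
    IsQuarticCCGPSRCurve (stdPoly q.1 q.2) (stdCurve q.1 q.2) ∧
      ![1, 0] ∈ stdCurve q.1 q.2 := by
  obtain ⟨a, b, c, h⟩ := exists_isNormalForm hq
  obtain ⟨B, n, g, D⟩ := h.exists_levelDecomposition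
  rw [stdCurve, D.connectedComponentIn_eq]
  exact ⟨D.isQuarticCCGPSRCurve, D.base_mem_arc⟩

end QuarticGPSR

/-! ### The classification and the properties of the listed curves. -/

theorem mainTheorem1 :
    -- the listed curves are closed connected quartic GPSR curves in standard form
    (∀ q ∈ QuarticGPSR.classList,
      QuarticGPSR.IsQuarticCCGPSRCurve (QuarticGPSR.stdPoly q.1 q.2)
        (QuarticGPSR.stdCurve q.1 q.2) ∧
      ![1, 0] ∈ QuarticGPSR.stdCurve q.1 q.2) ∧
    -- every closed connected quartic GPSR curve is equivalent to exactly one of them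
    (∀ (h : MvPolynomial (Fin 2) ℝ) (H : Set QuarticGPSR.Plane),
      QuarticGPSR.IsQuarticCCGPSRCurve h H →
      ∃! q : ℝ × ℝ, q ∈ QuarticGPSR.classList ∧
        QuarticGPSR.Equivalent H (QuarticGPSR.stdCurve q.1 q.2)) ∧
    -- case a)
    (QuarticGPSR.HasEquivalentClosedComponents (QuarticGPSR.stdPoly 0 (1 / 4)) 4 ∧
      (∃ (φ : DihedralGroup 4 →* MulAut (Multiplicative ℝ))
        (e : Multiplicative ℝ ⋊[φ] DihedralGroup 4 ≃*
          QuarticGPSR.autGroup (QuarticGPSR.stdPoly 0 (1 / 4))),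
        (∀ t : ℝ, ((e (SemidirectProduct.inl (Multiplicative.ofAdd t)) : GL (Fin 2) ℝ) :
          Matrix (Fin 2) (Fin 2) ℝ) = QuarticGPSR.hypRotation t) ∧
        ((e (SemidirectProduct.inr (DihedralGroup.sr 0)) : GL (Fin 2) ℝ) :
          Matrix (Fin 2) (Fin 2) ℝ) = QuarticGPSR.reflY ∧
        ((e (SemidirectProduct.inr (DihedralGroup.r 1)) : GL (Fin 2) ℝ) :
          Matrix (Fin 2) (Fin 2) ℝ) = QuarticGPSR.quarterTurn (1 / √2)) ∧
      QuarticGPSR.IsHomogeneousCurve (QuarticGPSR.stdCurve 0 (1 / 4)) ∧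
      QuarticGPSR.IsSingularAtInfinity (QuarticGPSR.stdPoly 0 (1 / 4))
        (QuarticGPSR.stdCurve 0 (1 / 4))) ∧
    -- case b)
    (QuarticGPSR.HasEquivalentClosedComponents
        (QuarticGPSR.stdPoly QuarticGPSR.Lb (-1 / 12)) 2 ∧
      (∃ e : Multiplicative ℝ × Multiplicative (ZMod 2) ≃*
          QuarticGPSR.autGroup (QuarticGPSR.stdPoly QuarticGPSR.Lb (-1 / 12)),
        (∀ t : ℝ, ((e (Multiplicative.ofAdd t, 1) : GL (Fin 2) ℝ) :
          Matrix (Fin 2) (Fin 2) ℝ) = QuarticGPSR.flowB t) ∧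
        (∀ t : ℝ, QuarticGPSR.act (e (Multiplicative.ofAdd t, 1) : GL (Fin 2) ℝ)
          (QuarticGPSR.stdCurve QuarticGPSR.Lb (-1 / 12)) =
            QuarticGPSR.stdCurve QuarticGPSR.Lb (-1 / 12)) ∧
        ((e (1, Multiplicative.ofAdd 1) : GL (Fin 2) ℝ) :
          Matrix (Fin 2) (Fin 2) ℝ) = -1) ∧
      QuarticGPSR.IsHomogeneousCurve (QuarticGPSR.stdCurve QuarticGPSR.Lb (-1 / 12)) ∧
      QuarticGPSR.IsSingularAtInfinity (QuarticGPSR.stdPoly QuarticGPSR.Lb (-1 / 12))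
        (QuarticGPSR.stdCurve QuarticGPSR.Lb (-1 / 12))) ∧
    -- case c)
    (QuarticGPSR.HasEquivalentClosedComponents (QuarticGPSR.stdPoly QuarticGPSR.Lc 0) 4 ∧
      Nonempty (Multiplicative (ZMod 2) × Multiplicative (ZMod 2) ≃*
        QuarticGPSR.autGroup (QuarticGPSR.stdPoly QuarticGPSR.Lc 0)) ∧
      ¬ QuarticGPSR.IsHomogeneousCurve (QuarticGPSR.stdCurve QuarticGPSR.Lc 0) ∧
      QuarticGPSR.IsSingularAtInfinity (QuarticGPSR.stdPoly QuarticGPSR.Lc 0)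
        (QuarticGPSR.stdCurve QuarticGPSR.Lc 0)) ∧
    -- case d)
    (∀ K : ℝ, K < 1 / 4 →
      (0 < K →
        QuarticGPSR.HasEquivalentClosedComponents (QuarticGPSR.stdPoly 0 K) 4 ∧
        ∃ e : DihedralGroup 4 ≃* QuarticGPSR.autGroup (QuarticGPSR.stdPoly 0 K),
          ((e (DihedralGroup.sr 0) : GL (Fin 2) ℝ) : Matrix (Fin 2) (Fin 2) ℝ) =
            QuarticGPSR.reflY ∧
          ((e (DihedralGroup.r 1) : GL (Fin 2) ℝ) : Matrix (Fin 2) (Fin 2) ℝ) =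
            QuarticGPSR.quarterTurn (K ^ (1 / 4 : ℝ))) ∧
      (K ≤ 0 →
        QuarticGPSR.HasEquivalentClosedComponents (QuarticGPSR.stdPoly 0 K) 2 ∧
        ∃ e : Multiplicative (ZMod 2) × Multiplicative (ZMod 2) ≃*
            QuarticGPSR.autGroup (QuarticGPSR.stdPoly 0 K),
          ((e (Multiplicative.ofAdd 1, 1) : GL (Fin 2) ℝ) : Matrix (Fin 2) (Fin 2) ℝ) =
            QuarticGPSR.reflY ∧
          ((e (1, Multiplicative.ofAdd 1) : GL (Fin 2) ℝ) : Matrix (Fin 2) (Fin 2) ℝ) =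
            QuarticGPSR.reflX) ∧
      ¬ QuarticGPSR.IsHomogeneousCurve (QuarticGPSR.stdCurve 0 K) ∧
      ¬ QuarticGPSR.IsSingularAtInfinity (QuarticGPSR.stdPoly 0 K)
        (QuarticGPSR.stdCurve 0 K)) := by
  refine ⟨fun q hq => QuarticGPSR.isQuarticCCGPSRCurve_stdCurve hq, fun h H hH => hH.existsUnique,
    ⟨?_, QuarticGPSR.mulEquiv_autGroup_a, QuarticGPSR.isHomogeneousCurve_a⟩,
    ⟨?_, QuarticGPSR.mulEquiv_autGroup_b, QuarticGPSR.isHomogeneousCurve_b⟩,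
    ⟨?_, QuarticGPSR.mulEquiv_autGroup_c, QuarticGPSR.not_isHomogeneousCurve_c⟩,
    fun K hK => ⟨fun hK0 => QuarticGPSR.mulEquiv_autGroup_of_pos hK hK0,
      fun hK0 => QuarticGPSR.mulEquiv_autGroup_of_nonpos hK0,
      QuarticGPSR.not_isHomogeneousCurve_of_lt hK⟩⟩
  · exact QuarticGPSR.levelDecomposition_a.hasEquivalentClosedComponents
  · exact QuarticGPSR.levelDecomposition_b.hasEquivalentClosedComponents
  · exact QuarticGPSR.levelDecomposition_c.hasEquivalentClosedComponents
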